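/- Notation. Let $b$ be a prime, $s,m,n\in\mathbb N=\{1,2,\dots\}$, and let $\mathbb F_b=\{0,\dots,b-1\}$ be the field with $b$ elements. *Digital nets.* Given $C_1,\dots,C_s\in\mathbb F_b^{n\times m}$ and $0\le h<b^m$ with $h=\sum_{i=0}^{m-1}\eta_i b^i$, $\eta_i\in\{0,\dots,b-1\}$, put $x_{h,j}=\sum_{i=1}^n\xi_{i,h,j}b^{-i}$, where $(\xi_{1,h,j},\dots,\xi_{n,h,j})^\top=C_j(\eta_0,\dots,\eta_{m-1})^\top$. The multiset $P=\{\boldsymbol x_0,\dots,\boldsymbol x_{b^m-1}\}\subset[0,1)^s$, $\boldsymbol x_h=(x_{h,1},\dots,x_{h,s})$, is the digital net over $\mathbb F_b$ with generating matrices $C_1,\dots,C_s$; it has $N=b^m$ points. Let $\boldsymbol c_{i,j}$ be the $i$-th row of $C_j$. For an integer $\beta\ge1$ with $n\ge\beta m$ and an integer $0\le t\le\beta m$, $P$ is an order $\beta$ digital $(t,m,s)$-net over $\mathbb F_b$ if for all $v_1,\dots,v_s\ge0$ and all $n\ge i_{j,1}>\dots>i_{j,v_j}\ge1$ ($1\le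 j\le s$) with $\sum_{j=1}^s\sum_{l=1}^{\min(\beta,v_j)}i_{j,l}\le\beta m-t$ the vectors $\boldsymbol c_{i_{j,l},j}$ ($1\le j\le s$, $1\le l\le v_j$) are linearly independent over $\mathbb F_b$. *Function space.* Let $\alpha\ge2$ be an integer and let $\boldsymbol\gamma=(\gamma_u)_{u\subseteq\{1,\dots,s\}}$ be non-negative real weights. With $B_r$ the Bernoulli polynomial of degree $r$, $\mathcal H_{\alpha,\boldsymbol\gamma}$ is the reproducing kernel Hilbert space of functions $[0,1)^s\to\mathbb R$ with reproducing kernel $$\mathcal K_{\alpha,\boldsymbol\gamma}(\boldsymbol x,\boldsymbol y)=\sum_{u\subseteq\{1,\dots,s\}}\gamma_u\prod_{j\in u}\Big\{\sum_{r=1}^{\alpha}\frac{B_r(x_j)B_r(y_j)}{(r!)^2}+(-1)^{\alpha+1}\frac{B_{2\alpha}(|x_j-y_j|)}{(2\alpha)!}\Big\}.$$ All its elements are integrable. *Errors.* For a finite multiset $Q\subset[0,1)^s$ let $$e^{\mathrm{wor}}(\mathcal H_{\alpha,\boldsymbol\gamma};Q)=\sup_{\|f\|\le1}\Big|\frac1{|Q|}\sum_{\boldsymbol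 x\in Q}f(\boldsymbol x)-\int_{[0,1)^s}f(\boldsymbol x)\,d\boldsymbol x\Big|,$$ the supremum being over $f$ in the unit ball of $\mathcal H_{\alpha,\boldsymbol\gamma}$. For $x,\sigma\in[0,1)$ let $x\oplus\sigma$ be digitwise addition modulo $b$ of the $b$-adic expansions (those with infinitely many digits different from $b-1$), applied componentwise to vectors; let $P\oplus\boldsymbol\sigma=\{\boldsymbol x\oplus\boldsymbol\sigma:\boldsymbol x\in P\}$ and $$e^{\mathrm{rms\text{-}wor}}(\mathcal H_{\alpha,\boldsymbol\gamma};P)=\Big(\int_{[0,1)^s}e^{\mathrm{wor}}(\mathcal H_{\alpha,\boldsymbol\gamma};P\oplus\boldsymbol\sigma)^2\,d\boldsymbol\sigma\Big)^{1/2},$$ where the integrand is measurable. **Theorem.** Let $\alpha\ge2$, $\beta\ge2\alpha$, $m\ge1$ and $0\le t\le\beta m$ be integers, let $P$ be an order $\beta$ digital $(t,m,s)$-net over $\mathbb F_b$, and let $\boldsymbol\gamma$ be a set of non-negative weights. Then, with $N=b^m$, $$e^{\mathrm{rms\text{-}wor}}(\mathcal H_{\alpha,\boldsymbol\gamma};P)\le\frac1{N^\alpha}\sum_{\emptyset\ne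 u\subseteq\{1,\dots,s\}}\gamma_u^{1/2}\,C_{\alpha,\beta,b,t,u}\,(\log N)^{(|u|-1)/2},$$ with the positive constants $$C_{\alpha,\beta,b,t,u}=b^{A t+B\lceil t/\beta\rceil}\,D^{|u|/2}\,G_u^{1/2}\Big(\frac3{\log b}\Big)^{(|u|-1)/2},\qquad A=\frac{\alpha-1}{\beta-1},\quad B=\frac{\beta-\alpha}{\beta-1},$$ $$G_u=(b-1)^{|u|}\Big[\Big(\frac{b^{2B}}{b^{2B}-1}\Big)^{|u|}+b\Big(\frac1{b^{2B}-b}\Big)^{|u|}\Big],\qquad D=\max_{1\le v\le\alpha}\Big\{\sum_{\tau=v}^{\alpha}\frac{c_\tau^2}{b^{2(\tau-v)}}+\frac{2c_{2\alpha}}{b^{2(\alpha-v)}}\Big\},$$ $$c_1=\frac1{2\sin(\pi/b)},\qquad c_\tau=\frac{(1+1/b+1/(b(b+1)))^{\tau-2}}{(2\sin(\pi/b))^\tau}\quad(\tau\ge2).$$ -/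

import Mathlib

open MeasureTheory
open scoped NNReal ENNReal Nat

noncomputable section

namespace HigherOrderNet

/-! ### The weighted Sobolev space -/

/-- Lebesgue measure on `[0,1)`. -/
instance instMeasureSpaceIco : MeasureSpace (Set.Ico (0 : ℝ) 1) := Measure.Subtype.measureSpace

instance instIsProbabilityMeasureIco :
    IsProbabilityMeasure (volume : Measure (Set.Ico (0 : ℝ) 1)) :=
  ⟨by
    change (Measure.comap Subtype.val volume) Set.univ = 1
    rw [comap_subtype_coe_apply measurableSet_Ico, Set.image_univ, Subtype.range_coe,
      Real.volume_Ico]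
    simp⟩

/-- The half-open unit cube `[0,1)^s`; its `volume` is the `s`-fold product of Lebesgue measure
on `[0,1)`. -/
abbrev UnitCube (s : ℕ) : Type := Fin s → Set.Ico (0 : ℝ) 1

/-- The one-dimensional kernel without its constant term,
`∑_{r=1}^α B_r(x) B_r(y) / (r!)^2 + (-1)^(α+1) B_{2α}(|x-y|) / (2α)!`. -/
def kernelOne (α : ℕ) (x y : ℝ) : ℝ :=
  (∑ r ∈ Finset.Icc 1 α, bernoulliFun r x * bernoulliFun r y / ((r ! : ℝ) ^ 2)) +
    (-1 : ℝ) ^ (α + 1) * bernoulliFun (2 * α) |x - y| / ((2 * α)! : ℝ)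

/-- The reproducing kernel of the weighted Sobolev space of smoothness `α` with weights `γ`. -/
def sobolevKernel {s : ℕ} (α : ℕ) (γ : Finset (Fin s) → ℝ≥0) (x y : UnitCube s) : ℝ :=
  ∑ u : Finset (Fin s), (γ u : ℝ) * ∏ j ∈ u, kernelOne α (x j) (y j)

/-- The same kernel with the number `K(x,y)` regarded as the operator `v ↦ K(x,y) v` on `ℝ`. -/
def sobolevKernelOp {s : ℕ} (α : ℕ) (γ : Finset (Fin s) → ℝ≥0) :
    Matrix (UnitCube s) (UnitCube s) (ℝ →L[ℝ] ℝ) :=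
  Matrix.of fun x y => sobolevKernel α γ x y • ContinuousLinearMap.id ℝ ℝ

theorem posSemidef_rankOne {X : Type*} (g : X → ℝ) :
    (Matrix.of fun x y => g x * g y : Matrix X X ℝ).PosSemidef := by
  refine ⟨by ext x y; simp [mul_comm], fun c => ?_⟩
  have : (c.sum fun i xi => c.sum fun j xj =>
      star xi * (Matrix.of fun x y => g x * g y : Matrix X X ℝ) i j * xj) =
      (c.sum fun i xi => xi * g i) * (c.sum fun i xi => xi * g i) := by
    simp only [Finsupp.sum, Finset.sum_mul_sum, Matrix.of_apply, star_trivial]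
    refine Finset.sum_congr rfl fun i _ => Finset.sum_congr rfl fun j _ => by ring
  rw [this]
  exact mul_self_nonneg _

theorem posSemidef_hasSum {X : Type*} {M : ℕ → Matrix X X ℝ} {L : Matrix X X ℝ}
    (hM : ∀ n, (M n).PosSemidef) (h : ∀ x y, HasSum (fun n => M n x y) (L x y)) :
    L.PosSemidef := by
  refine ⟨?_, fun c => ?_⟩
  · ext x y
    rw [Matrix.conjTranspose_apply, star_trivial]
    refine (h y x).unique ?_
    convert h x y using 2 with n
    exact (hM n).1.apply x y
  · have : HasSum (fun n => c.sum fun i xi => c.sum fun j xj => star xi * M n i j * xj)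
        (c.sum fun i xi => c.sum fun j xj => star xi * L i j * xj) :=
      hasSum_sum fun i _ => hasSum_sum fun j _ => ((h i j).mul_left _).mul_right _
    exact this.nonneg fun n => (hM n).2 c

theorem posSemidef_bernoulli {X : Type*} (p : X → Set.Ico (0 : ℝ) 1) {α : ℕ} (hα : α ≠ 0) :
    (Matrix.of fun x y => (-1 : ℝ) ^ (α + 1) * bernoulliFun (2 * α) |(p x : ℝ) - p y| /
      ((2 * α)! : ℝ) : Matrix X X ℝ).PosSemidef := by
  set c : ℝ := 2 / (2 * Real.pi) ^ (2 * α) with hc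
  have hc0 : 0 ≤ c := by positivity
  refine posSemidef_hasSum (M := fun n => Matrix.of fun x y =>
    c * (1 / (n : ℝ) ^ (2 * α) * Real.cos (2 * Real.pi * n * |(p x : ℝ) - p y|))) ?_ ?_
  · intro n
    have h1 := posSemidef_rankOne fun x : X => Real.cos (2 * Real.pi * n * (p x : ℝ))
    have h2 := posSemidef_rankOne fun x : X => Real.sin (2 * Real.pi * n * (p x : ℝ))
    have h3 := (h1.add h2).smul (a := c * (1 / (n : ℝ) ^ (2 * α))) (by positivity)
    convert h3 using 1
    ext x y
    simp only [Matrix.of_apply, Matrix.smul_apply, Matrix.add_apply, smul_eq_mul]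
    have : Real.cos (2 * Real.pi * n * |(p x : ℝ) - p y|) =
        Real.cos (2 * Real.pi * n * (p x : ℝ) - 2 * Real.pi * n * (p y : ℝ)) := by
      rcases abs_cases ((p x : ℝ) - p y) with ⟨h, _⟩ | ⟨h, _⟩
      · rw [h]; ring_nf
      · rw [h, ← Real.cos_neg]; ring_nf
    rw [this, Real.cos_sub]
    ring
  · intro x y
    have hx := (p x).2
    have hy := (p y).2
    have hmem : |(p x : ℝ) - p y| ∈ Set.Icc (0 : ℝ) 1 :=
      ⟨abs_nonneg _, abs_le.2 ⟨by linarith [hx.1, hy.2], by linarith [hx.2, hy.1]⟩⟩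
    have := (hasSum_one_div_nat_pow_mul_cos hα hmem).mul_left c
    have hpi : (2 * Real.pi) ^ (2 * α) ≠ 0 := by positivity
    have he : (-1 : ℝ) ^ (α + 1) * bernoulliFun (2 * α) |(p x : ℝ) - p y| / ((2 * α)! : ℝ) =
        c * ((-1 : ℝ) ^ (α + 1) * (2 * Real.pi) ^ (2 * α) / 2 / ((2 * α)! : ℝ) *
          bernoulliFun (2 * α) |(p x : ℝ) - p y|) := by
      rw [hc]
      field_simp
    rw [Matrix.of_apply, he]
    exact this

theorem posSemidef_sobolevKernel {s α : ℕ} (hα : α ≠ 0) (γ : Finset (Fin s) → ℝ≥0) :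
    (Matrix.of (sobolevKernel α γ)).PosSemidef := by
  have h1 : ∀ j : Fin s, (Matrix.of fun x y : UnitCube s =>
      kernelOne α (x j) (y j)).PosSemidef := by
    intro j
    have ha := Matrix.posSemidef_sum (Finset.Icc 1 α) fun r _ =>
      posSemidef_rankOne fun x : UnitCube s => bernoulliFun r (x j) / (r ! : ℝ)
    have hb := posSemidef_bernoulli (fun x : UnitCube s => x j) hα
    convert ha.add hb using 1
    ext x y
    simp only [kernelOne, Matrix.of_apply, Matrix.add_apply, Matrix.sum_apply]
    congr 1
    exact Finset.sum_congr rfl fun r _ => by ring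
  have h2 : ∀ u : Finset (Fin s), (Matrix.of fun x y : UnitCube s =>
      ∏ j ∈ u, kernelOne α (x j) (y j)).PosSemidef := by
    intro u
    induction u using Finset.induction_on with
    | empty => simpa using posSemidef_rankOne fun _ : UnitCube s => (1 : ℝ)
    | insert j u hj ih =>
      have := Matrix.PosSemidef.hadamard (𝕜 := ℝ) (h1 j) ih
      have he : (Matrix.of fun x y : UnitCube s => ∏ i ∈ insert j u, kernelOne α (x i) (y i)) =
          Matrix.hadamard (Matrix.of fun x y : UnitCube s => kernelOne α (x j) (y j))
            (Matrix.of fun x y : UnitCube s => ∏ i ∈ u, kernelOne α (x i) (y i)) := by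
        ext x y
        simp [Finset.prod_insert hj]
      rw [he]
      exact this
  have h3 := Matrix.posSemidef_sum Finset.univ
    fun (u : Finset (Fin s)) _ => (h2 u).smul (a := (γ u : ℝ)) (γ u).coe_nonneg
  convert h3 using 1
  ext x y
  simp [sobolevKernel, Matrix.sum_apply]

instance posSemidef_sobolevKernelOp {s α : ℕ} [NeZero α] (γ : Finset (Fin s) → ℝ≥0) :
    Fact (sobolevKernelOp α γ).PosSemidef := by
  have h := posSemidef_sobolevKernel (NeZero.ne α) γ
  have hiff := (RKHS.posSemidef_tfae (K := sobolevKernelOp α γ)).out 0 2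
  refine ⟨hiff.mpr (And.intro ?_ fun v => ?_)⟩
  · ext x y
    have hs := h.1.apply x y
    simp only [Matrix.of_apply, star_trivial] at hs
    simp [sobolevKernelOp, Matrix.conjTranspose_apply, hs, ContinuousLinearMap.star_eq_adjoint,
      ContinuousLinearMap.adjoint_id]
  · have h2 := h.2 v
    refine h2.trans_eq ?_
    rw [Finsupp.sum_comm]
    simp [sobolevKernelOp, mul_comm, mul_left_comm]

/-- The weighted Sobolev space `H_{α,γ}`: the reproducing kernel Hilbert space of functions
`[0,1)^s → ℝ` whose reproducing kernel is `sobolevKernel α γ`. -/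
abbrev WeightedSobolevSpace {s : ℕ} (α : ℕ) [NeZero α] (γ : Finset (Fin s) → ℝ≥0) : Type :=
  RKHS.OfKernel (sobolevKernelOp α γ)

/-! ### Quasi-Monte Carlo integration and worst-case errors -/

/-- The equal-weight quadrature rule `I(f;P)`, where the multiset `P` is given as a finite
family of points. -/
def qmc {s : ℕ} {ι : Type*} [Fintype ι] (P : ι → UnitCube s) (f : UnitCube s → ℝ) : ℝ :=
  (Fintype.card ι : ℝ)⁻¹ * ∑ i, f (P i)

/-- The worst-case error of quasi-Monte Carlo integration over `P` in the unit ball of a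
reproducing kernel Hilbert space `V` of functions on the unit cube, as an element of `[0,∞]`. -/
def worstCaseError {s : ℕ} (V : Type*) [NormedAddCommGroup V] [InnerProductSpace ℝ V]
    [RKHS ℝ V (UnitCube s) ℝ] {ι : Type*} [Fintype ι] (P : ι → UnitCube s) : ℝ≥0∞ :=
  ⨆ (f : V) (_ : ‖f‖ ≤ 1), ENNReal.ofReal |qmc P f - ∫ x : UnitCube s, f x|

/-- Digitwise addition `x ⊕ y` modulo `b`; `Real.digits` are the digits of the `b`-adic expansion
of a point of `[0,1)` in which infinitely many digits differ from `b - 1`. -/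
def digitAdd (b : ℕ) [NeZero b] (x y : ℝ) : ℝ :=
  Real.ofDigits fun i => Real.digits x b i + Real.digits y b i

/-- Componentwise digitwise addition on the unit cube. If one of the two points has finite
`b`-adic expansions, then `Int.fract` has no effect, see `coe_digitShift_digitalNet`. -/
def digitShift {s : ℕ} (b : ℕ) [NeZero b] (x σ : UnitCube s) : UnitCube s :=
  fun j => ⟨Int.fract (digitAdd b (x j) (σ j)), Int.fract_nonneg _, Int.fract_lt_one _⟩

/-- The root mean square worst-case error of the randomly digitally shifted point set `P ⊕ σ`,
with `σ` uniformly distributed on the unit cube. -/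
def rmsWorstCaseError {s : ℕ} (b : ℕ) [NeZero b] (V : Type*) [NormedAddCommGroup V]
    [InnerProductSpace ℝ V] [RKHS ℝ V (UnitCube s) ℝ] {ι : Type*} [Fintype ι]
    (P : ι → UnitCube s) : ℝ≥0∞ :=
  (∫⁻ σ : UnitCube s, worstCaseError V (fun i => digitShift b (P i) σ) ^ 2) ^ (1 / 2 : ℝ)

/-! ### Digital nets -/

/-- A digit sequence with a digit different from `b - 1` represents a number smaller than `1`. -/
theorem ofDigits_lt_one {b : ℕ} (d : ℕ → Fin b) (i : ℕ) (hi : (d i : ℕ) + 1 < b) :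
    Real.ofDigits d < 1 := by
  have hb : 1 < b := by omega
  rw [← Real.ofDigits_const_last_eq_one' hb]
  have hb0 : (0 : ℝ) < b := by exact_mod_cast (by omega : 0 < b)
  refine Summable.tsum_lt_tsum (i := i) (fun n => ?_) ?_ Real.summable_ofDigitsTerm
    Real.summable_ofDigitsTerm
  · simp only [Real.ofDigitsTerm]
    have : (d n : ℕ) ≤ b - 1 := by have := (d n).2; omega
    gcongr
  · simp only [Real.ofDigitsTerm]
    have : (d i : ℕ) < b - 1 := by omega
    gcongr

/-- The vector `(η_0, …, η_{m-1})` of the `b`-adic digits of `h`. -/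
def digitVec (b m h : ℕ) : Fin m → ZMod b := fun i => ((h / b ^ (i : ℕ) % b : ℕ) : ZMod b)

/-- The digits `ξ_{1,h,j}, …, ξ_{n,h,j}` obtained from the generating matrix `A = C_j`, followed
by zeros. -/
def netDigits {b n m : ℕ} [NeZero b] (A : Matrix (Fin n) (Fin m) (ZMod b)) (h : ℕ) : ℕ → Fin b :=
  fun i => if hi : i < n then ⟨(A.mulVec (digitVec b m h) ⟨i, hi⟩).val, ZMod.val_lt _⟩ else 0

theorem ofDigits_netDigits_lt_one {b n m : ℕ} [Fact b.Prime]
    (A : Matrix (Fin n) (Fin m) (ZMod b)) (h : ℕ) : Real.ofDigits (netDigits A h) < 1 :=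
  ofDigits_lt_one _ n (by simpa [netDigits] using (Fact.out : b.Prime).one_lt)

/-- The digital net over `F_b` with generating matrices `C_1, …, C_s`, as the family of its
points `x_0, …, x_{b^m-1}`. -/
def digitalNet {b s n m : ℕ} [Fact b.Prime] (C : Fin s → Matrix (Fin n) (Fin m) (ZMod b)) :
    Fin (b ^ m) → UnitCube s :=
  fun h j => ⟨Real.ofDigits (netDigits (C j) h), Real.ofDigits_nonneg _,
    ofDigits_netDigits_lt_one _ _⟩

/-- The digital net with generating matrices `C_1, …, C_s` is an order `β` digital
`(t,m,s)`-net: every system of rows `i_{j,1} > … > i_{j,v_j}` of the matrices `C_j` whose `β`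
largest (1-based) row indices in each `C_j` sum up to at most `β m - t` in total is linearly
independent. -/
def IsOrderDigitalNet {b s n m : ℕ} (β t : ℕ)
    (C : Fin s → Matrix (Fin n) (Fin m) (ZMod b)) : Prop :=
  β * m ≤ n ∧ t ≤ β * m ∧
    ∀ (v : Fin s → ℕ) (i : (j : Fin s) → Fin (v j) → Fin n), (∀ j, StrictAnti (i j)) →
      (∑ j, ∑ l : Fin (v j), if (l : ℕ) < β then (i j l : ℕ) + 1 else 0) ≤ β * m - t →
      LinearIndependent (ZMod b) fun p : (j : Fin s) × Fin (v j) => (C p.1) (i p.1 p.2)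

/-! ### Digital shifts of digital nets stay in the unit cube -/

theorem digits_ofDigits_netDigits {b n m : ℕ} [Fact b.Prime]
    (A : Matrix (Fin n) (Fin m) (ZMod b)) (h : ℕ) {i : ℕ} (hi : n ≤ i) :
    Real.digits (Real.ofDigits (netDigits A h)) b i = 0 := by
  have hb0 : (b : ℝ) ≠ 0 := by exact_mod_cast (Fact.out : b.Prime).ne_zero
  have h0 : Real.ofDigits (fun k => netDigits A h (k + n)) = 0 := by
    simp [Real.ofDigits, Real.ofDigitsTerm, netDigits]
  have h1 := Real.ofDigits_eq_sum_add_ofDigits (netDigits A h) n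
  rw [h0, mul_zero, add_zero] at h1
  have h2 : Real.ofDigits (netDigits A h) * (b : ℝ) ^ (i + 1) =
      ((b * ∑ k ∈ Finset.range n, (netDigits A h k : ℕ) * b ^ (i - (k + 1)) : ℕ) : ℝ) := by
    rw [h1, Finset.sum_mul]
    push_cast
    rw [Finset.mul_sum]
    refine Finset.sum_congr rfl fun k hk => ?_
    have hk' : k < n := Finset.mem_range.1 hk
    obtain ⟨d, rfl⟩ : ∃ d, i = k + 1 + d := ⟨i - (k + 1), by omega⟩
    rw [Real.ofDigitsTerm, Nat.add_sub_cancel_left, pow_succ (b : ℝ) (k + 1 + d), pow_add]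
    field_simp
    ring
  rw [Real.digits, h2, Nat.floor_natCast]
  ext
  simp

theorem exists_digits_add_one_lt {b : ℕ} [NeZero b] (hb : 1 < b) {x : ℝ}
    (hx : x ∈ Set.Ico (0 : ℝ) 1) (n : ℕ) :
    ∃ i, n ≤ i ∧ (Real.digits x b i : ℕ) + 1 < b := by
  by_contra! hcon
  have hb0 : (0 : ℝ) < (b : ℝ) ^ n := by
    have : (0 : ℝ) < b := by exact_mod_cast (by omega : 0 < b)
    positivity
  have h1 := Real.ofDigits_eq_sum_add_ofDigits (Real.digits x b) n
  have h2 : (fun i => Real.digits x b (i + n)) =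
      fun _ => (⟨b - 1, Nat.sub_one_lt_of_lt hb⟩ : Fin b) := by
    funext i
    ext
    have := hcon (i + n) (by omega)
    have := (Real.digits x b (i + n)).2
    simp only
    omega
  rw [h2, Real.ofDigits_const_last_eq_one' hb, Real.ofDigits_digits hb hx, mul_one] at h1
  have h3 := Real.ofDigits_digits_sum_eq (b := b) hx n
  have h4 := Nat.lt_floor_add_one ((b : ℝ) ^ n * x)
  rw [← h3] at h4
  have h5 : (b : ℝ) ^ n * x = (b : ℝ) ^ n * (∑ i ∈ Finset.range n,
      Real.ofDigitsTerm (Real.digits x b) i) + 1 := by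
    rw [h1, mul_add, mul_inv_cancel₀ hb0.ne', ← h1]
  linarith

/-- Shifting a point of a digital net is plain componentwise digitwise addition. -/
theorem coe_digitShift_digitalNet {b s n m : ℕ} [Fact b.Prime]
    (C : Fin s → Matrix (Fin n) (Fin m) (ZMod b)) (h : Fin (b ^ m)) (σ : UnitCube s)
    (j : Fin s) :
    (digitShift b (digitalNet C h) σ j : ℝ) = digitAdd b (digitalNet C h j) (σ j) := by
  obtain ⟨i, hi, hlt⟩ := exists_digits_add_one_lt (Fact.out : b.Prime).one_lt (σ j).2 n
  refine Int.fract_eq_self.2 ⟨Real.ofDigits_nonneg _, ofDigits_lt_one _ i ?_⟩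
  simp only [digitalNet, digits_ofDigits_netDigits (C j) h hi, zero_add]
  exact hlt

/-! ### The constants -/

/-- `A_{αβ} = (α-1)/(β-1)`. -/
def constA (α β : ℕ) : ℝ := ((α : ℝ) - 1) / ((β : ℝ) - 1)

/-- `B_{αβ} = (β-α)/(β-1)`. -/
def constB (α β : ℕ) : ℝ := ((β : ℝ) - (α : ℝ)) / ((β : ℝ) - 1)

/-- `C_{τ,b}` for `τ ≥ 1`. -/
def constW (τ b : ℕ) : ℝ :=
  if τ = 1 then 1 / (2 * Real.sin (Real.pi / b))
  else (1 + 1 / (b : ℝ) + 1 / ((b : ℝ) * ((b : ℝ) + 1))) ^ (τ - 2) /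
    (2 * Real.sin (Real.pi / b)) ^ τ

/-- `D_{α,b}`, a maximum over `1 ≤ v ≤ α`. -/
def constD (α b : ℕ) : ℝ :=
  sSup ((fun v : ℕ => (∑ τ ∈ Finset.Icc v α, constW τ b ^ 2 / (b : ℝ) ^ (2 * (τ - v))) +
    2 * constW (2 * α) b / (b : ℝ) ^ (2 * (α - v))) '' Set.Icc 1 α)

/-- `G_{α,β,b,u}`, which depends on `u` through `k = |u|` only. -/
def constG (α β b k : ℕ) : ℝ :=
  ((b : ℝ) - 1) ^ k *
    (((b : ℝ) ^ (2 * constB α β) / ((b : ℝ) ^ (2 * constB α β) - 1)) ^ k +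
      (b : ℝ) * (1 / ((b : ℝ) ^ (2 * constB α β) - (b : ℝ))) ^ k)

/-- The constant `C_{α,β,b,t,u}` of the error bound, which depends on `u` through `k = |u|` only. -/
def constC (α β b t k : ℕ) : ℝ :=
  (b : ℝ) ^ (constA α β * (t : ℝ) + constB α β * (⌈(t : ℝ) / (β : ℝ)⌉₊ : ℝ)) *
    constD α b ^ ((k : ℝ) / 2) * constG α β b k ^ (1 / 2 : ℝ) *
    (3 / Real.log b) ^ (((k : ℝ) - 1) / 2)

end HigherOrderNet

end

/-! Averaging over the digital shift turns the bound into a weighted count of words in a linear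
code. The squared worst-case error of a point set is, up to normalization, the double sum of `K - γ
∅` over its points (`worstCaseError_sq`). Its mean over all shifts is therefore a sum over nonempty
`u` of `γ u` times `meanSq`, a double sum over net points of products of one-dimensional shift
averages (`integrable_integral_shiftSq`). Each such average is the limit of truncated Walsh series
whose coefficients are the diagonal Walsh coefficients of the one-dimensional kernel
(`tendsto_sum_walCoeff`). Summing the characters over the net leaves only the indices of the dual
net (`sum_sum_prod_eq`, `tendsto_meanSq`).

Decay. The diagonal coefficient at `k ≠ 0` is at most `D b^(-2 μ_α(k))`, where `μ_α` adds the `α`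
largest digit positions of `k` (`norm_walCoeff_kernelOne_le`). The source is integration by parts
against a Walsh function: each derivative gains the leading position and a factor `cosec b * growth
b` (`norm_walT_step`). Bernoulli polynomials of degree `τ` have no Walsh coefficients with more than
`τ` digits. The periodic part of the kernel is a Fourier series; all its frequencies are treated
together as one Hilbert-space valued function, started by Bessel's inequality
(`norm_walT_trigVec_one_le`).

Counting. Positions are ordered decreasingly, so `μ_α ≥ A μ_β + B μ_1` (`mu_interpolation`). On the
dual net the sum of `μ_β` exceeds `β m - t` (`lt_sum_mu_of_dual`), which extracts the factor
`b^(-2A(βm - t))`. What remains is the sum of `q^(-μ_1)` with `q = b^(2B)`. Since `μ_β ≤ β μ_1`, the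
dual net is a code of minimum distance larger than `M = m - ⌈t/β⌉` in the metric `μ_1`. The number
of its words with prescribed leading positions is bounded in `card_code_le`, and the weighted sum
converges because `β ≥ 2α` forces `q > b` (`sum_code_le`). It is at most `(M+2)^(|u|-1) q^(-M) G`,
with `M + 2 ≤ 3m`. The identity `A β + B = α` assembles the powers of `b` into `N^(-2α)`, and a sum
of squares is at most the square of the sum. -/

namespace HigherOrderNet

/-! ### Leading positions of a finite set of digit positions -/

/-- The largest element of `S`, counted from one, and zero for the empty set. -/
def top (S : Finset ℕ) : ℕ := S.sup (· + 1)

/-- The set `S` without its largest element. -/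
def del (S : Finset ℕ) : Finset ℕ := S.erase (top S - 1)

/-- The `(i+1)`-th largest element of `S`, counted from one, and zero if there is none. -/
def pos (S : Finset ℕ) (i : ℕ) : ℕ := top (del^[i] S)

/-- The sum of the `τ` largest elements of `S`, counted from one. -/
def mu (τ : ℕ) (S : Finset ℕ) : ℕ := ∑ i ∈ Finset.range τ, pos S i

/-- The sum of the `τ` largest elements of `S`, counted from one, where the smallest element is
repeated if there are less than `τ` elements. -/
def muPer : ℕ → Finset ℕ → ℕ
  | 0, _ => 0
  | τ + 1, S => top S + muPer τ (if del S = ∅ then S else del S)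

theorem top_empty : top ∅ = 0 := rfl

theorem del_empty : del ∅ = ∅ := rfl

theorem lt_top_of_mem {S : Finset ℕ} {i : ℕ} (h : i ∈ S) : i < top S :=
  Finset.le_sup (f := fun j : ℕ => j + 1) h

theorem top_le_iff {S : Finset ℕ} {n : ℕ} : top S ≤ n ↔ ∀ i ∈ S, i < n := by
  simp only [top, Finset.sup_le_iff, Nat.succ_le_iff]

theorem top_pos {S : Finset ℕ} (h : S.Nonempty) : 0 < top S := by
  obtain ⟨i, hi⟩ := h
  have := lt_top_of_mem hi
  omega

theorem top_eq_zero {S : Finset ℕ} : top S = 0 ↔ S = ∅ := by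
  constructor
  · intro h
    by_contra hS
    have := top_pos (Finset.nonempty_iff_ne_empty.2 hS)
    omega
  · rintro rfl; rfl

theorem top_sub_one_mem {S : Finset ℕ} (h : S.Nonempty) : top S - 1 ∈ S := by
  obtain ⟨i, hi, he⟩ := Finset.exists_mem_eq_sup S h (· + 1)
  rw [top, he]
  simpa using hi

theorem top_mono {S T : Finset ℕ} (h : S ⊆ T) : top S ≤ top T := Finset.sup_mono h

theorem del_subset (S : Finset ℕ) : del S ⊆ S := Finset.erase_subset _ _

theorem top_del_lt {S : Finset ℕ} (h : S.Nonempty) : top (del S) < top S := by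
  have h0 := top_pos h
  have : top (del S) ≤ top S - 1 := by
    rw [top_le_iff]
    intro i hi
    rw [del, Finset.mem_erase] at hi
    have := lt_top_of_mem hi.2
    omega
  omega

theorem top_del_le (S : Finset ℕ) : top (del S) ≤ top S := top_mono (del_subset S)

theorem card_del_add_one {S : Finset ℕ} (h : S.Nonempty) : (del S).card + 1 = S.card :=
  Finset.card_erase_add_one (top_sub_one_mem h)

theorem pos_zero (S : Finset ℕ) : pos S 0 = top S := rfl

theorem pos_succ (S : Finset ℕ) (i : ℕ) : pos S (i + 1) = pos (del S) i := rfl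

theorem pos_antitone (S : Finset ℕ) : Antitone (pos S) := by
  refine antitone_nat_of_succ_le fun i => ?_
  rw [pos, Function.iterate_succ_apply', pos]
  exact top_del_le _

theorem mu_one (S : Finset ℕ) : mu 1 S = top S := by simp [mu, pos_zero]

theorem mu_succ (τ : ℕ) (S : Finset ℕ) : mu (τ + 1) S = top S + mu τ (del S) := by
  rw [mu, Finset.sum_range_succ', add_comm]
  rfl

theorem mu_empty (τ : ℕ) : mu τ ∅ = 0 := by
  induction τ with
  | zero => rfl
  | succ τ ih => rw [mu_succ, del_empty, ih, top_empty]

theorem mu_le_mul_top (τ : ℕ) (S : Finset ℕ) : mu τ S ≤ τ * top S := by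
  have := Finset.sum_le_card_nsmul (Finset.range τ) (pos S) (top S)
    fun i _ => pos_antitone S (Nat.zero_le i)
  simpa [mu] using this

theorem top_le_mu {τ : ℕ} (hτ : 1 ≤ τ) (S : Finset ℕ) : top S ≤ mu τ S := by
  obtain ⟨σ, rfl⟩ := Nat.exists_eq_add_of_le' hτ
  rw [mu_succ]
  omega

/-- Interpolation of `mu α` between `mu 1` and `mu β`. -/
theorem mu_interpolation {α β : ℕ} (hα : 1 ≤ α) (hαβ : α ≤ β) (S : Finset ℕ) :
    (α - 1) * mu β S + (β - α) * mu 1 S ≤ (β - 1) * mu α S := by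
  obtain ⟨a, rfl⟩ := Nat.exists_eq_add_of_le' hα
  obtain ⟨d, rfl⟩ := Nat.exists_eq_add_of_le hαβ
  have hb : mu (a + 1 + d) S = mu (a + 1) S + ∑ i ∈ Finset.range d, pos S (a + 1 + i) :=
    Finset.sum_range_add _ _ _
  -- The `α`-th largest position is the pivot: the positions after it are at most the pivot, those
  -- between the first and it are at least the pivot.
  have hS2 : ∑ i ∈ Finset.range d, pos S (a + 1 + i) ≤ d * pos S a := by
    have := Finset.sum_le_card_nsmul (Finset.range d) (fun i => pos S (a + 1 + i)) (pos S a)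
      fun i _ => pos_antitone S (by omega)
    simpa using this
  have hS1 : top S + a * pos S a ≤ mu (a + 1) S := by
    rw [mu, Finset.sum_range_succ', pos_zero]
    have := Finset.card_nsmul_le_sum (Finset.range a) (fun i => pos S (i + 1)) (pos S a)
      fun i hi => pos_antitone S (by have := Finset.mem_range.1 hi; omega)
    simp only [Finset.card_range, smul_eq_mul] at this
    omega
  rw [mu_one, hb]
  have e1 : a + 1 - 1 = a := by omega
  have e2 : a + 1 + d - (a + 1) = d := by omega
  have e3 : a + 1 + d - 1 = a + d := by omega
  rw [e1, e2, e3]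
  nlinarith

/-- Entries of a decreasing sequence in `S` are bounded by the largest elements of `S`. -/
theorem succ_le_pos_of_strictAntiOn {S : Finset ℕ} (l : ℕ) (i : ℕ → ℕ) (hi : ∀ j ≤ l, i j ∈ S)
    (hanti : ∀ j < l, i (j + 1) < i j) : i l + 1 ≤ pos S l := by
  induction l generalizing S i with
  | zero => exact lt_top_of_mem (hi 0 le_rfl)
  | succ l ih =>
    rw [pos_succ]
    have hlt : ∀ j ≤ l, i (j + 1) < i 0 := by
      intro j hj
      induction j with
      | zero => exact hanti 0 (by omega)
      | succ j ihj => exact (hanti (j + 1) (by omega)).trans (ihj (by omega))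
    refine ih (fun j => i (j + 1)) (fun j hj => ?_) fun j hj => hanti (j + 1) (by omega)
    refine Finset.mem_erase.2 ⟨?_, hi _ (by omega)⟩
    have h0 := lt_top_of_mem (hi 0 (by omega))
    have := hlt j hj
    omega

theorem muPer_succ (τ : ℕ) (S : Finset ℕ) :
    muPer (τ + 1) S = top S + muPer τ (if del S = ∅ then S else del S) := rfl

theorem muPer_succ_of_del_eq_empty {τ : ℕ} {S : Finset ℕ} (h : del S = ∅) :
    muPer (τ + 1) S = top S + muPer τ S := by rw [muPer_succ, if_pos h]

theorem muPer_succ_of_del_ne_empty {τ : ℕ} {S : Finset ℕ} (h : del S ≠ ∅) :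
    muPer (τ + 1) S = top S + muPer τ (del S) := by rw [muPer_succ, if_neg h]

theorem muPer_one (S : Finset ℕ) : muPer 1 S = top S := rfl

theorem muPer_of_del_eq_empty {S : Finset ℕ} (h : del S = ∅) (τ : ℕ) :
    muPer τ S = τ * top S := by
  induction τ with
  | zero => simp [muPer]
  | succ τ ih => rw [muPer_succ_of_del_eq_empty h, ih]; ring

theorem muPer_del_le (τ : ℕ) (S : Finset ℕ) : muPer τ (del S) ≤ muPer τ S := by
  induction τ generalizing S with
  | zero => exact le_rfl
  | succ τ ih =>
    by_cases h : del S = ∅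
    · rw [h, muPer_of_del_eq_empty del_empty, top_empty]
      simp
    · rw [muPer_succ_of_del_ne_empty h, muPer_succ]
      have h1 := top_del_le S
      split_ifs with h2
      · omega
      · have := ih (del S)
        omega

/-- The gain of one is a factor `1 / b`; it produces the summand `1 / b` of `growth b` in
`norm_walT_step`. -/
theorem muPer_del_lt {τ : ℕ} (hτ : 1 ≤ τ) {S : Finset ℕ} (h : del S ≠ ∅) :
    muPer τ (del S) + 1 ≤ muPer τ S := by
  obtain ⟨τ, rfl⟩ := Nat.exists_eq_add_of_le' hτ
  have hS : S.Nonempty := (Finset.nonempty_iff_ne_empty.2 h).mono (del_subset S)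
  rw [muPer_succ_of_del_ne_empty h, muPer_succ]
  have h1 := top_del_lt hS
  split_ifs with h2
  · omega
  · have := muPer_del_le τ (del S)
    omega

/-- The exponent on the right is the one reached by the tail of the digit expansion; the gain of one
turns its `1 / (b + 1)` into the summand `1 / (b (b + 1))` of `growth b`. -/
theorem muPer_add_two_lt (τ : ℕ) {S : Finset ℕ} (h : del S ≠ ∅) :
    muPer (τ + 2) S + 1 ≤ 2 * top S + muPer τ S := by
  have hS : S.Nonempty := (Finset.nonempty_iff_ne_empty.2 h).mono (del_subset S)
  rw [muPer_succ_of_del_ne_empty h, muPer_succ]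
  have h1 := top_del_lt hS
  have h3 := muPer_del_le τ S
  split_ifs with h2
  · omega
  · have := muPer_del_le τ (del S)
    omega

/-- Positions are counted from one, so each of the `τ - S.card` repetitions of the smallest position
contributes at least one. These extra powers of `b` are the denominators in `constD`. -/
theorem mu_add_sub_card_le_muPer (τ : ℕ) {S : Finset ℕ} (hS : S.Nonempty) :
    mu τ S + (τ - S.card) ≤ muPer τ S := by
  induction τ generalizing S with
  | zero => simp [mu]
  | succ τ ih =>
    have hc := card_del_add_one hS
    rw [mu_succ]
    by_cases h : del S = ∅
    · rw [muPer_of_del_eq_empty h, h, mu_empty]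
      rw [h, Finset.card_empty] at hc
      have := top_pos hS
      have : τ ≤ τ * top S := Nat.le_mul_of_pos_right _ this
      rw [← hc, add_mul]
      omega
    · rw [muPer_succ_of_del_ne_empty h]
      have := ih (Finset.nonempty_iff_ne_empty.2 h)
      omega

theorem del_insert_of_top_le {S : Finset ℕ} {p : ℕ} (h : top S ≤ p) :
    top (insert p S) = p + 1 ∧ del (insert p S) = S := by
  have ht : top (insert p S) = p + 1 := by
    refine le_antisymm (top_le_iff.2 fun i hi => ?_) (lt_top_of_mem (Finset.mem_insert_self p S))
    rcases Finset.mem_insert.1 hi with rfl | hi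
    · omega
    · have := lt_top_of_mem hi
      omega
  refine ⟨ht, ?_⟩
  rw [del, ht, Nat.add_sub_cancel, Finset.erase_insert]
  intro hp
  have := lt_top_of_mem hp
  omega

/-- Indices with one new leading digit arise when the fractional remainder of `walJ` is expanded
into Walsh functions. -/
theorem muPer_succ_insert {S : Finset ℕ} (hS : S.Nonempty) {p : ℕ} (h : top S ≤ p) (τ : ℕ) :
    muPer (τ + 1) (insert p S) = p + 1 + muPer τ S := by
  obtain ⟨h1, h2⟩ := del_insert_of_top_le h
  rw [muPer_succ_of_del_ne_empty (by rw [h2]; exact hS.ne_empty), h1, h2]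

section Walsh

/-! ### Walsh functions -/

/-- The `(i+1)`-st digit of the `b`-adic expansion of `x`. -/
noncomputable def digit (b i : ℕ) (x : ℝ) : ZMod b := ((⌊(b : ℝ) ^ (i + 1) * x⌋ : ℤ) : ZMod b)

/-- The Walsh function in base `b` whose index has the digits `k`. -/
noncomputable def wal {b : ℕ} [NeZero b] (k : ℕ →₀ ZMod b) (x : ℝ) : ℂ :=
  ZMod.stdAddChar (k.sum fun i c => c * digit b i x)

theorem floor_eq_floor_mul_ediv (b : ℕ) [NeZero b] (x : ℝ) : ⌊x⌋ = ⌊(b : ℝ) * x⌋ / (b : ℤ) := by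
  have hb : (0 : ℝ) < b := by exact_mod_cast Nat.pos_of_ne_zero (NeZero.ne b)
  have hb' : (0 : ℤ) < b := by exact_mod_cast Nat.pos_of_ne_zero (NeZero.ne b)
  rw [eq_comm, Int.ediv_eq_iff_of_pos hb']
  constructor
  · rw [Int.le_floor]
    push_cast
    rw [mul_comm]
    exact mul_le_mul_of_nonneg_left (Int.floor_le x) hb.le
  · rw [Int.floor_lt]
    push_cast
    have := Int.lt_floor_add_one x
    nlinarith

theorem floor_pow_mul_eq_of_le {b : ℕ} [NeZero b] {a c : ℕ} {x y : ℝ} (hac : a ≤ c)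
    (h : ⌊(b : ℝ) ^ c * x⌋ = ⌊(b : ℝ) ^ c * y⌋) : ⌊(b : ℝ) ^ a * x⌋ = ⌊(b : ℝ) ^ a * y⌋ := by
  induction c, hac using Nat.le_induction with
  | base => exact h
  | succ c hc ih =>
    apply ih
    rw [floor_eq_floor_mul_ediv b, floor_eq_floor_mul_ediv b ((b : ℝ) ^ c * y), ← mul_assoc,
      ← mul_assoc, ← pow_succ', h]

theorem measurable_digit (b i : ℕ) : Measurable (digit b i) := by
  have : Measurable fun n : ℤ => (n : ZMod b) := measurable_of_countable _
  exact this.comp (Int.measurable_floor.comp (measurable_const.mul measurable_id))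

theorem support_erase_top {b : ℕ} (k : ℕ →₀ ZMod b) :
    (k.erase (top k.support - 1)).support = del k.support := by
  rw [Finsupp.support_erase, del]

variable {b : ℕ} [NeZero b]

theorem digit_eq_of_floor_eq {i a : ℕ} {x y : ℝ} (hi : i < a)
    (h : ⌊(b : ℝ) ^ a * x⌋ = ⌊(b : ℝ) ^ a * y⌋) : digit b i x = digit b i y := by
  rw [digit, floor_pow_mul_eq_of_le (Nat.succ_le_of_lt hi) h, digit]

theorem wal_eq_of_floor_eq {k : ℕ →₀ ZMod b} {a : ℕ} {x y : ℝ} (hk : top k.support ≤ a)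
    (h : ⌊(b : ℝ) ^ a * x⌋ = ⌊(b : ℝ) ^ a * y⌋) : wal k x = wal k y := by
  rw [wal, wal]
  congr 1
  refine Finset.sum_congr rfl fun i hi => ?_
  simp only
  rw [digit_eq_of_floor_eq ((lt_top_of_mem hi).trans_le hk) h]

@[simp]
theorem wal_zero (x : ℝ) : wal (0 : ℕ →₀ ZMod b) x = 1 := by simp [wal]

theorem wal_add (k l : ℕ →₀ ZMod b) (x : ℝ) : wal (k + l) x = wal k x * wal l x := by
  rw [wal, Finsupp.sum_add_index' (by simp) (by intros; ring), AddChar.map_add_eq_mul, wal, wal]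

theorem wal_single (i : ℕ) (c : ZMod b) (x : ℝ) :
    wal (Finsupp.single i c) x = ZMod.stdAddChar (c * digit b i x) := by
  rw [wal, Finsupp.sum_single_index (by simp)]

theorem norm_wal (k : ℕ →₀ ZMod b) (x : ℝ) : ‖wal k x‖ = 1 := AddChar.norm_apply _ _

theorem wal_neg (k : ℕ →₀ ZMod b) (x : ℝ) : wal (-k) x = (starRingEnd ℂ) (wal k x) := by
  rw [wal, wal, ← AddChar.map_neg_eq_conj, Finsupp.sum_neg_index (by simp), Finsupp.sum,
    Finsupp.sum, ← Finset.sum_neg_distrib]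
  simp

theorem measurable_wal (k : ℕ →₀ ZMod b) : Measurable (wal k) := by
  have h : Measurable fun x => k.sum fun i c => c * digit b i x := by
    refine Finset.measurable_sum _ fun i _ => ?_
    exact (measurable_of_countable fun d : ZMod b => k i * d).comp (measurable_digit b i)
  exact (measurable_of_countable _).comp h

theorem wal_eq_erase_mul (k : ℕ →₀ ZMod b) (i : ℕ) (x : ℝ) :
    wal k x = wal (k.erase i) x * ZMod.stdAddChar (k i * digit b i x) := by
  conv_lhs => rw [← Finsupp.erase_add_single i k]
  rw [wal_add, wal_single]

theorem digit_div_pow (l a : ℕ) : digit b a ((l : ℝ) / (b : ℝ) ^ (a + 1)) = l := by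
  have hb : (b : ℝ) ^ (a + 1) ≠ 0 := pow_ne_zero _ (by exact_mod_cast NeZero.ne b)
  rw [digit, mul_div_cancel₀ _ hb]
  simp

theorem floor_pow_mul_div (l a : ℕ) :
    ⌊(b : ℝ) ^ a * ((l : ℝ) / (b : ℝ) ^ (a + 1))⌋ = (l : ℤ) / b := by
  have hb : (b : ℝ) ≠ 0 := by exact_mod_cast NeZero.ne b
  have : (b : ℝ) * ((b : ℝ) ^ a * ((l : ℝ) / (b : ℝ) ^ (a + 1))) = l := by
    field_simp
    ring
  rw [floor_eq_floor_mul_ediv b, this]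
  simp

theorem stdAddChar_ne_one {κ : ZMod b} (hκ : κ ≠ 0) : ZMod.stdAddChar κ ≠ (1 : ℂ) := by
  have h := ZMod.injective_stdAddChar (N := b)
  rw [← AddChar.map_zero_eq_one (ZMod.stdAddChar (N := b))]
  exact fun he => hκ (h he)

/-- The coefficient `1 / (1 - ω^κ)`. -/
noncomputable def invOneSub (κ : ZMod b) : ℂ := (1 - ZMod.stdAddChar κ)⁻¹

theorem invOneSub_mul {κ : ZMod b} (hκ : κ ≠ 0) : invOneSub κ * (1 - ZMod.stdAddChar κ) = 1 :=
  inv_mul_cancel₀ (sub_ne_zero.2 (stdAddChar_ne_one hκ).symm)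

/-- Partial sums of the values of a Walsh function. -/
theorem walsh_partial_sum_step {k : ℕ →₀ ZMod b} {a : ℕ} (ha : top k.support = a + 1) (l : ℕ) :
    invOneSub (k a) * (wal (k.erase a) ((l + 1 : ℕ) / (b : ℝ) ^ (a + 1)) -
        wal k ((l + 1 : ℕ) / (b : ℝ) ^ (a + 1))) =
      invOneSub (k a) * (wal (k.erase a) (l / (b : ℝ) ^ (a + 1)) -
        wal k (l / (b : ℝ) ^ (a + 1))) + wal k (l / (b : ℝ) ^ (a + 1)) := by
  have hka : k a ≠ 0 := by
    have h := top_sub_one_mem (S := k.support)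
      (Finset.nonempty_iff_ne_empty.2 fun h => by rw [h, top_empty] at ha; omega)
    rw [ha, Nat.add_sub_cancel] at h
    exact Finsupp.mem_support_iff.1 h
  have hA := invOneSub_mul hka
  have hd1 := wal_eq_erase_mul k a ((l + 1 : ℕ) / (b : ℝ) ^ (a + 1))
  have hd0 := wal_eq_erase_mul k a ((l : ℝ) / (b : ℝ) ^ (a + 1))
  rw [digit_div_pow] at hd0 hd1
  -- If `b` divides `l + 1`, the last digit returns to zero, both Walsh functions agree at the right
  -- endpoint, and the digit of `l` is `-1`. Otherwise there is no carry: the lower-order function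
  -- is unchanged and `wal k` is multiplied by `ω^κ`.
  by_cases hl : (b : ℕ) ∣ l + 1
  · have h1 : ((l + 1 : ℕ) : ZMod b) = 0 := (ZMod.natCast_eq_zero_iff _ _).2 hl
    rw [h1, mul_zero, AddChar.map_zero_eq_one, mul_one] at hd1
    have h2 : wal (k.erase a) ((l : ℝ) / (b : ℝ) ^ (a + 1)) =
        wal k ((l : ℝ) / (b : ℝ) ^ (a + 1)) * ZMod.stdAddChar (k a) := by
      rw [hd0, mul_assoc, ← AddChar.map_add_eq_mul]
      have : k a * (l : ZMod b) + k a = 0 := by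
        push_cast at h1
        linear_combination k a * h1
      rw [this, AddChar.map_zero_eq_one, mul_one]
    rw [hd1, h2]
    linear_combination wal k ((l : ℝ) / (b : ℝ) ^ (a + 1)) * hA
  · have htop : top (k.erase a).support ≤ a := by
      have h := support_erase_top k
      rw [ha, Nat.add_sub_cancel] at h
      have := top_del_lt (S := k.support)
        (Finset.nonempty_iff_ne_empty.2 fun h => by rw [h, top_empty] at ha; omega)
      rw [h]
      omega
    have h3 : wal (k.erase a) ((l + 1 : ℕ) / (b : ℝ) ^ (a + 1)) =
        wal (k.erase a) ((l : ℝ) / (b : ℝ) ^ (a + 1)) := by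
      refine wal_eq_of_floor_eq htop ?_
      rw [floor_pow_mul_div, floor_pow_mul_div]
      norm_cast
      exact Nat.succ_div_of_not_dvd hl
    rw [hd1, h3, hd0]
    have h4 : (ZMod.stdAddChar (k a * ((l + 1 : ℕ) : ZMod b)) : ℂ) =
        ZMod.stdAddChar (k a * (l : ZMod b)) * ZMod.stdAddChar (k a) := by
      rw [← AddChar.map_add_eq_mul]
      congr 1
      push_cast
      ring
    rw [h4]
    linear_combination (wal (k.erase a) ((l : ℝ) / (b : ℝ) ^ (a + 1)) *
      ZMod.stdAddChar (k a * (l : ZMod b))) * hA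

theorem wal_erase_eq_of_dvd {k : ℕ →₀ ZMod b} {a l : ℕ} (hl : b ∣ l) :
    wal (k.erase a) ((l : ℝ) / (b : ℝ) ^ (a + 1)) = wal k ((l : ℝ) / (b : ℝ) ^ (a + 1)) := by
  rw [wal_eq_erase_mul k a, digit_div_pow, (ZMod.natCast_eq_zero_iff _ _).2 hl, mul_zero,
    AddChar.map_zero_eq_one, mul_one]

/-- The integral `∫_0^x wal k`. -/
noncomputable def walJ (k : ℕ →₀ ZMod b) (x : ℝ) : ℂ :=
  ((b : ℂ) ^ top k.support)⁻¹ *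
    (invOneSub (k (top k.support - 1)) * (wal (k.erase (top k.support - 1)) x - wal k x) +
      wal k x * (Int.fract ((b : ℝ) ^ top k.support * x) : ℝ))

variable {E : Type*} [NormedAddCommGroup E] [NormedSpace ℂ E]

theorem intervalIntegrable_bdd_smul {g : ℝ → ℂ} {C : ℝ} (hg : Measurable g) (hC : ∀ x, ‖g x‖ ≤ C)
    {F : ℝ → E} (hF : Continuous F) (u v : ℝ) :
    IntervalIntegrable (fun x => g x • F x) volume u v := by
  rw [intervalIntegrable_iff]
  exact Integrable.bdd_smul (intervalIntegrable_iff.1 (hF.intervalIntegrable u v)) C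
    hg.aestronglyMeasurable (Filter.Eventually.of_forall hC)

theorem measurable_walJ (k : ℕ →₀ ZMod b) : Measurable (walJ k) := by
  have := measurable_wal k
  have := measurable_wal (k.erase (top k.support - 1))
  have : Measurable fun x : ℝ => ((Int.fract ((b : ℝ) ^ top k.support * x) : ℝ) : ℂ) :=
    Complex.measurable_ofReal.comp (measurable_fract.comp (measurable_const.mul measurable_id))
  unfold walJ
  fun_prop

theorem norm_walJ_le (k : ℕ →₀ ZMod b) (x : ℝ) :
    ‖walJ k x‖ ≤ ‖((b : ℂ) ^ top k.support)⁻¹‖ *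
      (‖invOneSub (k (top k.support - 1))‖ * 2 + 1) := by
  rw [walJ, norm_mul]
  gcongr
  refine (norm_add_le _ _).trans (add_le_add ?_ ?_)
  · rw [norm_mul]
    gcongr
    refine (norm_sub_le _ _).trans ?_
    rw [norm_wal, norm_wal]
    norm_num
  · rw [norm_mul, norm_wal, one_mul, Complex.norm_real, Real.norm_of_nonneg (Int.fract_nonneg _)]
    exact (Int.fract_lt_one _).le

/-- Integration by parts against a Walsh function. -/
theorem integral_wal_smul [CompleteSpace E] {k : ℕ →₀ ZMod b} (hk : k ≠ 0) {F F' : ℝ → E}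
    (hF : ∀ x, HasDerivAt F (F' x) x) (hF' : Continuous F') :
    ∫ x in (0 : ℝ)..1, wal k x • F x = -∫ x in (0 : ℝ)..1, walJ k x • F' x := by
  obtain ⟨a, ha⟩ : ∃ a, top k.support = a + 1 :=
    Nat.exists_eq_succ_of_ne_zero fun h => hk (Finsupp.support_eq_empty.1 (top_eq_zero.1 h))
  have hb : (0 : ℝ) < b := by exact_mod_cast Nat.pos_of_ne_zero (NeZero.ne b)
  have hbC : (b : ℂ) ≠ 0 := by exact_mod_cast NeZero.ne b
  set N : ℝ := (b : ℝ) ^ (a + 1) with hN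
  have hN0 : 0 < N := by positivity
  have hFc : Continuous F := continuous_iff_continuousAt.2 fun x => (hF x).continuousAt
  set p : ℕ → ℝ := fun l => (l : ℝ) / N with hp
  -- `G l` is the sum of `wal k` over the first `l` left endpoints, in closed form. It vanishes at
  -- both ends of the unit interval, so no boundary term survives.
  set G : ℕ → ℂ := fun l => invOneSub (k a) * (wal (k.erase a) (p l) - wal k (p l)) with hG
  have hstep : ∀ l, G (l + 1) = G l + wal k (p l) := fun l => walsh_partial_sum_step ha l
  have hple : ∀ l, p l ≤ p (l + 1) := fun l => by
    simp only [hp]; gcongr; simp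
  have hp0 : p 0 = 0 := by simp [hp]
  have hp1 : p (b ^ (a + 1)) = 1 := by
    simp only [hp, hN]; push_cast; exact div_self hN0.ne'
  have hG0 : G 0 = 0 := by
    simp only [hG, hp, hN]
    rw [wal_erase_eq_of_dvd (dvd_zero b), sub_self, mul_zero]
  have hG1 : G (b ^ (a + 1)) = 0 := by
    simp only [hG, hp, hN]
    rw [wal_erase_eq_of_dvd (dvd_pow_self b (Nat.succ_ne_zero a)), sub_self, mul_zero]
  have hfloor : ∀ l : ℕ, ∀ x ∈ Set.Ioo (p l) (p (l + 1)), ⌊N * x⌋ = l := by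
    intro l x hx
    simp only [hp, Set.mem_Ioo, div_lt_iff₀ hN0, lt_div_iff₀ hN0] at hx
    rw [Int.floor_eq_iff]
    push_cast at hx ⊢
    constructor <;> nlinarith
  have hfp : ∀ l : ℕ, ⌊N * p l⌋ = l := by
    intro l
    simp only [hp]
    rw [mul_div_cancel₀ _ hN0.ne']
    simp
  -- On one cell `wal k` is constant and `walJ k` is an affine primitive of it, so ordinary
  -- integration by parts applies; the boundary terms telescope over the cells.
  have hcell : ∀ l : ℕ, (∫ x in p l..p (l + 1), wal k x • F x) +
      (∫ x in p l..p (l + 1), walJ k x • F' x) =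
      (N : ℂ)⁻¹ • (G (l + 1) • F (p (l + 1)) - G l • F (p l)) := by
    intro l
    have h1 : ∫ x in p l..p (l + 1), wal k x • F x = ∫ x in p l..p (l + 1), wal k (p l) • F x := by
      refine intervalIntegral.integral_congr_ae ?_
      have hne : ∀ᵐ x : ℝ, x ≠ p (l + 1) := by
        simp [ae_iff]
      filter_upwards [hne] with x hx hx'
      rw [Set.uIoc_of_le (hple l)] at hx'
      rw [wal_eq_of_floor_eq (y := p l) ha.le]
      rw [← hN, hfloor l x ⟨hx'.1, lt_of_le_of_ne hx'.2 hx⟩, hfp]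
    have h2 : ∫ x in p l..p (l + 1), walJ k x • F' x =
        ∫ x in p l..p (l + 1), ((N : ℂ)⁻¹ * (G l + wal k (p l) * ((N * x - l : ℝ) : ℂ))) • F' x := by
      refine intervalIntegral.integral_congr_ae ?_
      have hne : ∀ᵐ x : ℝ, x ≠ p (l + 1) := by
        simp [ae_iff]
      filter_upwards [hne] with x hx hx'
      rw [Set.uIoc_of_le (hple l)] at hx'
      have hfl := hfloor l x ⟨hx'.1, lt_of_le_of_ne hx'.2 hx⟩
      have htop : top (k.erase a).support ≤ a + 1 := by
        rw [Finsupp.support_erase, ← ha]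
        exact top_mono (Finset.erase_subset _ _)
      have e1 : wal k x = wal k (p l) := wal_eq_of_floor_eq ha.le (by rw [← hN, hfl, hfp])
      have e2 : wal (k.erase a) x = wal (k.erase a) (p l) :=
        wal_eq_of_floor_eq htop (by rw [← hN, hfl, hfp])
      rw [walJ, ha, Nat.add_sub_cancel, e1, e2, ← hN, Int.fract, hfl]
      simp only [hG, hN]
      push_cast
      rfl
    rw [h1, h2]
    have hu : ∀ x ∈ Set.uIcc (p l) (p (l + 1)),
        HasDerivAt (fun x : ℝ => (N : ℂ)⁻¹ * (G l + wal k (p l) * ((N * x - l : ℝ) : ℂ)))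
          (wal k (p l)) x := by
      intro x _
      have h3 : HasDerivAt (fun x : ℝ => N * x - l) N x := by
        simpa using ((hasDerivAt_id x).const_mul N).sub_const (l : ℝ)
      have h4 := ((h3.ofReal_comp.const_mul (wal k (p l))).const_add (G l)).const_mul (N : ℂ)⁻¹
      have hN1 : (N : ℂ) ≠ 0 := by exact_mod_cast hN0.ne'
      have h5 : (N : ℂ)⁻¹ * (wal k (p l) * (N : ℂ)) = wal k (p l) := by
        rw [mul_comm, mul_assoc, mul_inv_cancel₀ hN1, mul_one]
      rw [h5] at h4
      exact h4
    have h5 := intervalIntegral.integral_smul_deriv_eq_deriv_smul (a := p l) (b := p (l + 1)) hu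
      (fun x _ => hF x) (by simp) (hF'.intervalIntegrable _ _)
    rw [h5]
    have e3 : (N * p (l + 1) - l : ℝ) = 1 := by
      simp only [hp]; rw [mul_div_cancel₀ _ hN0.ne']; push_cast; ring
    have e4 : (N * p l - l : ℝ) = 0 := by
      simp only [hp]; rw [mul_div_cancel₀ _ hN0.ne']; ring
    rw [e3, e4, hstep]
    simp only [Complex.ofReal_one, Complex.ofReal_zero, mul_one, mul_zero, add_zero, mul_smul,
      smul_sub]
    abel
  have hI1 : ∀ u v, IntervalIntegrable (fun x => wal k x • F x) volume u v :=
    intervalIntegrable_bdd_smul (measurable_wal k) (fun x => (norm_wal k x).le) hFc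
  have hI2 : ∀ u v, IntervalIntegrable (fun x => walJ k x • F' x) volume u v :=
    intervalIntegrable_bdd_smul (measurable_walJ k) (norm_walJ_le k) hF'
  have hs := Finset.sum_congr (rfl : Finset.range (b ^ (a + 1)) = _) fun l _ => hcell l
  rw [Finset.sum_add_distrib, intervalIntegral.sum_integral_adjacent_intervals fun l _ => hI1 _ _,
    intervalIntegral.sum_integral_adjacent_intervals fun l _ => hI2 _ _, ← Finset.smul_sum,
    Finset.sum_range_sub fun l => G l • F (p l), hp0, hp1, hG0, hG1] at hs
  simp only [zero_smul, sub_self, smul_zero] at hs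
  exact eq_neg_of_add_eq_zero_left hs

end Walsh

section Recursion

/-! ### Decay of Walsh coefficients -/

/-- The constant `1 / (2 sin (π / b))`. -/
noncomputable def cosec (b : ℕ) : ℝ := 1 / (2 * Real.sin (Real.pi / b))

/-- The constant `1 + 1 / b + 1 / (b (b + 1))`. -/
noncomputable def growth (b : ℕ) : ℝ := 1 + 1 / (b : ℝ) + 1 / ((b : ℝ) * ((b : ℝ) + 1))

theorem cosec_nonneg (b : ℕ) [NeZero b] : 0 ≤ cosec b := by
  have hb : (1 : ℝ) ≤ b := by exact_mod_cast Nat.one_le_iff_ne_zero.2 (NeZero.ne b)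
  have : 0 ≤ Real.sin (Real.pi / b) := Real.sin_nonneg_of_nonneg_of_le_pi (by positivity)
    (div_le_self Real.pi_pos.le hb)
  unfold cosec
  positivity

theorem growth_pos (b : ℕ) : 0 < growth b := by unfold growth; positivity

theorem support_add_single {b : ℕ} {k : ℕ →₀ ZMod b} {p : ℕ} (hp : top k.support ≤ p) {θ : ZMod b}
    (hθ : θ ≠ 0) : (k + Finsupp.single p θ).support = insert p k.support := by
  have : p ∉ k.support := fun h => by
    have := lt_top_of_mem h
    omega
  rw [add_comm, Finsupp.support_single_add this hθ, Finset.cons_eq_insert]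

variable {b : ℕ} [NeZero b]

/-- The distance from `1` to `ω^j` is `2 sin(π j / b)`. It is smallest at `j = 1` and, by the
reflection `x ↦ π - x`, at `j = b - 1`. -/
theorem two_mul_sin_le_norm_one_sub {κ : ZMod b} (hκ : κ ≠ 0) :
    2 * Real.sin (Real.pi / b) ≤ ‖(1 : ℂ) - ZMod.stdAddChar κ‖ := by
  have hb : (0 : ℝ) < b := by exact_mod_cast Nat.pos_of_ne_zero (NeZero.ne b)
  have hj0 : (1 : ℝ) ≤ κ.val := by
    exact_mod_cast Nat.one_le_iff_ne_zero.2 fun h => hκ ((ZMod.val_eq_zero κ).1 h)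
  have hjb : (κ.val : ℝ) + 1 ≤ b := by exact_mod_cast ZMod.val_lt κ
  have h1 : (ZMod.stdAddChar κ : ℂ) =
      Complex.exp (Complex.I * ((2 * Real.pi * κ.val / b : ℝ) : ℂ)) := by
    have := ZMod.stdAddChar_coe (N := b) (κ.val : ℤ)
    rw [Int.cast_natCast, ZMod.natCast_zmod_val] at this
    rw [this]
    congr 1
    push_cast
    ring
  rw [norm_sub_rev, h1, Complex.norm_exp_I_mul_ofReal_sub_one, norm_mul, Real.norm_ofNat]
  refine mul_le_mul_of_nonneg_left ((?_ : _ ≤ _).trans (le_abs_self _)) (by norm_num)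
  have e : 2 * Real.pi * κ.val / b / 2 = Real.pi / b * κ.val := by ring
  rw [e]
  have hpb : 0 < Real.pi / b := by positivity
  have hpi : Real.pi / b * b = Real.pi := by field_simp
  have hpi0 := Real.pi_pos
  rcases le_total (Real.pi / b * κ.val) (Real.pi / 2) with h | h
  · exact Real.sin_le_sin_of_le_of_le_pi_div_two (by linarith) h (by nlinarith)
  · rw [← Real.sin_pi_sub (Real.pi / b * κ.val)]
    exact Real.sin_le_sin_of_le_of_le_pi_div_two (by linarith) (by linarith) (by nlinarith)

theorem norm_invOneSub_le (κ : ZMod b) : ‖invOneSub κ‖ ≤ cosec b := by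
  by_cases hκ : κ = 0
  -- At `κ = 0` the coefficient is the inverse of zero, hence zero.
  · simp [hκ, invOneSub, cosec_nonneg]
  have h := two_mul_sin_le_norm_one_sub hκ
  have hb : (1 : ℝ) < b := by
    have hb0 : b ≠ 0 := NeZero.ne b
    have : b ≠ 1 := by
      rintro rfl
      exact hκ (Subsingleton.elim _ _)
    exact_mod_cast (by omega : 1 < b)
  have hs : 0 < Real.sin (Real.pi / b) := Real.sin_pos_of_pos_of_lt_pi
    (div_pos Real.pi_pos (by linarith)) (div_lt_self Real.pi_pos hb)
  rw [invOneSub, norm_inv, cosec, ← one_div]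
  exact one_div_le_one_div_of_le (by positivity) h

/-- The map `z ↦ 1 / (1 - z)` sends the unit circle to the line of real part `1/2`. -/
theorem invOneSub_add_conj {κ : ZMod b} (hκ : κ ≠ 0) :
    invOneSub κ + (starRingEnd ℂ) (invOneSub κ) = 1 := by
  have h1 := invOneSub_mul hκ
  have h2 : (starRingEnd ℂ) (invOneSub κ) =
      invOneSub (-κ) := by
    rw [invOneSub, invOneSub, map_inv₀, map_sub, map_one, AddChar.map_neg_eq_conj]
  have h3 := invOneSub_mul (neg_ne_zero.2 hκ)
  have h4 : (ZMod.stdAddChar (-κ) : ℂ) * ZMod.stdAddChar κ = 1 := by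
    rw [← AddChar.map_add_eq_mul, neg_add_cancel, AddChar.map_zero_eq_one]
  rw [h2]
  have h5 : (1 - (ZMod.stdAddChar κ : ℂ)) ≠ 0 := sub_ne_zero.2 (stdAddChar_ne_one hκ).symm
  refine mul_right_cancel₀ h5 ?_
  linear_combination h1 - (ZMod.stdAddChar κ : ℂ) * h3 - invOneSub (-κ) * h4

theorem normSq_sub_invOneSub {κ : ZMod b} (hκ : κ ≠ 0) (y : ℝ) :
    ‖(y : ℂ) - invOneSub κ‖ ^ 2 = ‖invOneSub κ‖ ^ 2 + y ^ 2 - y := by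
  have h := congrArg Complex.re (invOneSub_add_conj hκ)
  simp only [Complex.add_re, Complex.conj_re, Complex.one_re] at h
  rw [Complex.sq_norm, Complex.sq_norm, Complex.normSq_apply, Complex.normSq_apply]
  simp only [Complex.sub_re, Complex.ofReal_re, Complex.sub_im, Complex.ofReal_im]
  linear_combination (-y) * h

/-- A point of real part `1/2` is equally far from `0` and `1`, and no farther from the points
between them. -/
theorem norm_sub_invOneSub_le {κ : ZMod b} (hκ : κ ≠ 0) {y : ℝ} (h0 : 0 ≤ y) (h1 : y ≤ 1) :
    ‖(y : ℂ) - invOneSub κ‖ ≤ ‖invOneSub κ‖ := by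
  refine le_of_sq_le_sq ?_ (norm_nonneg _)
  rw [normSq_sub_invOneSub hκ]
  nlinarith

/-- The Fourier expansion of a digit. -/
theorem val_eq_sum_invOneSub (d : ZMod b) :
    (d.val : ℂ) = ((b : ℂ) - 1) / 2 - ∑ θ : ZMod b, invOneSub (-θ) * ZMod.stdAddChar (θ * d) := by
  have hprim := ZMod.isPrimitive_stdAddChar b
  set f : ZMod b → ℂ := fun d => ∑ θ : ZMod b, invOneSub (-θ) * ZMod.stdAddChar (θ * d) with hf
  have hb : (b : ℂ) ≠ 0 := by exact_mod_cast NeZero.ne b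
  -- The character sum `f` is determined by two facts: it drops by one whenever the digit grows
  -- without wrapping, and its mean over all digits is zero. The term `θ = 0` contributes nothing
  -- because `invOneSub 0 = 0`.
  have hstep : ∀ d : ZMod b, d + 1 ≠ 0 → f (d + 1) = f d - 1 := by
    intro d hd
    have h1 : ∀ θ : ZMod b, invOneSub (-θ) * ZMod.stdAddChar (θ * (d + 1)) -
        invOneSub (-θ) * ZMod.stdAddChar (θ * d) =
        ZMod.stdAddChar (θ * (d + 1)) - if θ = 0 then 1 else 0 := by
      intro θ
      split_ifs with hθ
      · simp [hθ, invOneSub]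
      · have h3 := invOneSub_mul (neg_ne_zero.2 hθ)
        have h4 : (ZMod.stdAddChar (-θ) : ℂ) * ZMod.stdAddChar (θ * (d + 1)) =
            ZMod.stdAddChar (θ * d) := by
          rw [← AddChar.map_add_eq_mul]
          congr 1
          ring
        linear_combination (ZMod.stdAddChar (θ * (d + 1)) : ℂ) * h3 + invOneSub (-θ) * h4
    have h2 := Finset.sum_congr (rfl : (Finset.univ : Finset (ZMod b)) = _) fun θ _ => h1 θ
    rw [Finset.sum_sub_distrib, Finset.sum_sub_distrib, AddChar.sum_mulShift _ hprim,
      if_neg hd] at h2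
    simp only [Finset.sum_ite_eq', Finset.mem_univ, if_true] at h2
    push_cast at h2
    linear_combination h2
  have hind : ∀ j : ℕ, j < b → f (j : ZMod b) = f 0 - j := by
    intro j hj
    induction j with
    | zero => simp
    | succ j ih =>
      have hne : (j : ZMod b) + 1 ≠ 0 := by
        have := (ZMod.natCast_eq_zero_iff (j + 1) b).not.2 (Nat.not_dvd_of_pos_of_lt (by omega) hj)
        push_cast at this
        exact this
      push_cast
      rw [hstep _ hne, ih (by omega)]
      ring
  have hval : ∀ d : ZMod b, f d = f 0 - d.val := by
    intro d
    have := hind d.val (ZMod.val_lt d)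
    rwa [ZMod.natCast_zmod_val] at this
  have hsum0 : ∑ d : ZMod b, f d = 0 := by
    simp only [hf]
    rw [Finset.sum_comm]
    refine Finset.sum_eq_zero fun θ _ => ?_
    rw [← Finset.mul_sum]
    simp only [mul_comm θ]
    rw [AddChar.sum_mulShift _ hprim]
    split_ifs with h
    · simp [h, invOneSub]
    · simp
  have hsum1 : ∑ d : ZMod b, (d.val : ℂ) = b * (b - 1) / 2 := by
    have h1 : ∑ d : ZMod b, (d.val : ℂ) = ∑ j ∈ Finset.range b, (j : ℂ) := by
      refine Finset.sum_nbij' ZMod.val (fun j => (j : ZMod b)) ?_ ?_ ?_ ?_ ?_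
      · intro d _; exact Finset.mem_range.2 (ZMod.val_lt d)
      · intro j _; exact Finset.mem_univ _
      · intro d _; exact ZMod.natCast_zmod_val d
      · intro j hj; exact ZMod.val_cast_of_lt (Finset.mem_range.1 hj)
      · intro d _; rfl
    rw [h1, eq_div_iff two_ne_zero, ← Nat.cast_sum]
    have h2 := Finset.sum_range_id_mul_two b
    have h3 : ((b - 1 : ℕ) : ℂ) = b - 1 := by
      rw [Nat.cast_sub (Nat.one_le_iff_ne_zero.2 (NeZero.ne b)), Nat.cast_one]
    rw [← h3]
    exact_mod_cast h2
  rw [Finset.sum_congr rfl fun d _ => hval d, Finset.sum_sub_distrib, Finset.sum_const,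
    Finset.card_univ, ZMod.card, hsum1, nsmul_eq_mul] at hsum0
  have h0 : f 0 = ((b : ℂ) - 1) / 2 := by
    refine mul_left_cancel₀ hb ?_
    linear_combination hsum0
  have hd : f d = ((b : ℂ) - 1) / 2 - d.val := by rw [hval d, h0]
  change (d.val : ℂ) = ((b : ℂ) - 1) / 2 - f d
  rw [hd]
  ring

/-- Multiplying a fractional part by `b` splits off one digit and leaves the next fractional part.
Centering by `1/2` absorbs the constant term `(b - 1) / 2` of the digit's Fourier expansion. -/
theorem fract_pow_mul_sub_half (a : ℕ) (x : ℝ) :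
    ((Int.fract ((b : ℝ) ^ a * x) - 1 / 2 : ℝ) : ℂ) =
      (b : ℂ)⁻¹ * ((Int.fract ((b : ℝ) ^ (a + 1) * x) - 1 / 2 : ℝ) : ℂ) -
      (b : ℂ)⁻¹ * ∑ θ : ZMod b, invOneSub (-θ) * wal (Finsupp.single a θ) x := by
  have hb : (b : ℝ) ≠ 0 := by exact_mod_cast NeZero.ne b
  have hbC : (b : ℂ) ≠ 0 := by exact_mod_cast NeZero.ne b
  have h1 := val_eq_sum_invOneSub (digit b a x)
  have h2 : (((digit b a x).val : ℤ) : ℝ) =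
      b * Int.fract ((b : ℝ) ^ a * x) - Int.fract ((b : ℝ) ^ (a + 1) * x) := by
    have h3 := floor_eq_floor_mul_ediv b ((b : ℝ) ^ a * x)
    rw [← mul_assoc, ← pow_succ'] at h3
    have h4 := Int.emod_add_mul_ediv ⌊(b : ℝ) ^ (a + 1) * x⌋ b
    rw [← h3] at h4
    rw [digit, ZMod.val_intCast, Int.fract, Int.fract]
    have h5 : ((⌊(b : ℝ) ^ (a + 1) * x⌋ % (b : ℤ) : ℤ) : ℝ) + b * ⌊(b : ℝ) ^ a * x⌋ =
        ⌊(b : ℝ) ^ (a + 1) * x⌋ := by exact_mod_cast h4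
    rw [pow_succ' (b : ℝ) a] at *
    linear_combination h5
  have h6 : ((digit b a x).val : ℂ) = b * (Int.fract ((b : ℝ) ^ a * x) : ℝ) -
      (Int.fract ((b : ℝ) ^ (a + 1) * x) : ℝ) := by exact_mod_cast h2
  rw [h6] at h1
  simp only [wal_single]
  refine mul_left_cancel₀ hbC ?_
  push_cast
  have h7 : ∀ z : ℂ, (b : ℂ) * ((b : ℂ)⁻¹ * z) = z := fun z => mul_inv_cancel_left₀ hbC z
  rw [mul_sub, mul_sub, h7, h7]
  linear_combination h1

variable {E : Type*} [NormedAddCommGroup E] [NormedSpace ℂ E]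

/-- The Walsh coefficient of `F` for the conjugate of the Walsh function `wal k`. -/
noncomputable def walT (F : ℝ → E) (k : ℕ →₀ ZMod b) : E := ∫ x in (0 : ℝ)..1, wal k x • F x

theorem norm_fract_sub_half_le (t : ℝ) : ‖((Int.fract t - 1 / 2 : ℝ) : ℂ)‖ ≤ 1 := by
  rw [Complex.norm_real, Real.norm_eq_abs, abs_le]
  have h0 := Int.fract_nonneg t
  have h1 := Int.fract_lt_one t
  constructor <;> linarith

/-- The Walsh coefficient of `F` times the centered remainder of the digit expansion. -/
noncomputable def walY (F : ℝ → E) (k : ℕ →₀ ZMod b) (a : ℕ) : E :=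
  ∫ x in (0 : ℝ)..1, (wal k x * ((Int.fract ((b : ℝ) ^ a * x) - 1 / 2 : ℝ) : ℂ)) • F x

theorem measurable_wal_mul_fract (k : ℕ →₀ ZMod b) (a : ℕ) : Measurable fun x : ℝ =>
    wal k x * ((Int.fract ((b : ℝ) ^ a * x) - 1 / 2 : ℝ) : ℂ) :=
  (measurable_wal k).mul (Complex.measurable_ofReal.comp
    ((measurable_fract.comp (measurable_const.mul measurable_id)).sub measurable_const))

theorem norm_wal_mul_fract_le (k : ℕ →₀ ZMod b) (a : ℕ) (x : ℝ) :
    ‖wal k x * ((Int.fract ((b : ℝ) ^ a * x) - 1 / 2 : ℝ) : ℂ)‖ ≤ 1 := by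
  rw [norm_mul, norm_wal, one_mul]
  exact norm_fract_sub_half_le _

/-- The remainder is pushed one digit deeper at the price of a factor `1 / b`; the digit that is
split off turns into Walsh coefficients with a new leading position. -/
theorem walY_succ {F : ℝ → E} (hF : Continuous F) (k : ℕ →₀ ZMod b) (a : ℕ) :
    walY F k a = (b : ℂ)⁻¹ • walY F k (a + 1) -
      (b : ℂ)⁻¹ • ∑ θ : ZMod b, invOneSub (-θ) • walT F (k + Finsupp.single a θ) := by
  have hT : ∀ l : ℕ →₀ ZMod b, IntervalIntegrable (fun x => wal l x • F x) volume 0 1 :=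
    fun l => intervalIntegrable_bdd_smul (measurable_wal l) (fun x => (norm_wal l x).le) hF 0 1
  have hTs : ∀ (c : ℂ) (l : ℕ →₀ ZMod b),
      IntervalIntegrable (fun x => c • wal l x • F x) volume 0 1 := fun c l => (hT l).smul c
  have hY : IntervalIntegrable (fun x => (b : ℂ)⁻¹ •
      (wal k x * ((Int.fract ((b : ℝ) ^ (a + 1) * x) - 1 / 2 : ℝ) : ℂ)) • F x) volume 0 1 :=
    (intervalIntegrable_bdd_smul (measurable_wal_mul_fract k (a + 1))
      (norm_wal_mul_fract_le k (a + 1)) hF 0 1).smul _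
  simp only [walY, walT]
  simp_rw [← intervalIntegral.integral_smul]
  have hS : IntervalIntegrable (fun x => (b : ℂ)⁻¹ • ∑ θ : ZMod b,
      invOneSub (-θ) • wal (k + Finsupp.single a θ) x • F x) volume 0 1 := by
    have := (IntervalIntegrable.sum (μ := volume) (a := 0) (b := 1) Finset.univ
      (f := fun θ : ZMod b => fun x => invOneSub (-θ) • wal (k + Finsupp.single a θ) x • F x)
      fun θ _ => hTs _ _).smul (b : ℂ)⁻¹
    refine this.congr fun x _ => ?_
    simp
  rw [← intervalIntegral.integral_finsetSum fun θ _ => hTs _ _,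
    ← intervalIntegral.integral_smul, ← intervalIntegral.integral_sub hY hS]
  refine intervalIntegral.integral_congr fun x _ => ?_
  simp only [fract_pow_mul_sub_half a x, wal_add, smul_smul, Finset.smul_sum, mul_sub, sub_smul,
    Finset.mul_sum, Finset.sum_smul]
  congr 1
  · congr 1
    ring
  · refine Finset.sum_congr rfl fun θ _ => ?_
    congr 1
    ring

theorem norm_walY_le_of_bound {F : ℝ → E} {M : ℝ} (hM : ∀ x ∈ Set.uIoc (0 : ℝ) 1, ‖F x‖ ≤ M)
    (k : ℕ →₀ ZMod b) (a : ℕ) : ‖walY F k a‖ ≤ M := by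
  have h := intervalIntegral.norm_integral_le_of_norm_le_const (a := 0) (b := 1) (C := M)
    (f := fun x => (wal k x * ((Int.fract ((b : ℝ) ^ a * x) - 1 / 2 : ℝ) : ℂ)) • F x) ?_
  · rwa [sub_zero, abs_one, mul_one] at h
  · intro x hx
    rw [norm_smul]
    exact (mul_le_of_le_one_left (norm_nonneg _) (norm_wal_mul_fract_le k a x)).trans (hM x hx)

/-- Iterating `walY_succ` and using the decay hypothesis leaves a geometric series with ratio `b⁻²`,
whose sum gives `1 / (b + 1)`. The last remainder tends to zero since `F` is bounded on the unit
interval. -/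
theorem norm_walY_le {F : ℝ → E} (hF : Continuous F) (k : ℕ →₀ ZMod b) (a : ℕ) {B : ℝ}
    (hb : 1 < b)
    (hB : ∀ j, ∀ θ : ZMod b, θ ≠ 0 →
      ‖walT F (k + Finsupp.single (a + j) θ)‖ ≤ B * ((b : ℝ)⁻¹) ^ (j + 1)) :
    ‖walY F k a‖ ≤ cosec b * B / (b + 1) := by
  have hb1 : (1 : ℝ) < b := by exact_mod_cast hb
  have hc := cosec_nonneg b
  set x : ℝ := (b : ℝ)⁻¹ with hx
  have hx0 : 0 < x := by positivity
  have hx1 : x < 1 := inv_lt_one_of_one_lt₀ hb1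
  have hbx : (b : ℝ) * x = 1 := mul_inv_cancel₀ (by linarith)
  have hnx : ‖(b : ℂ)⁻¹‖ = x := by rw [norm_inv, Complex.norm_natCast]
  have hstep : ∀ j, ‖walY F k (a + j)‖ ≤ x * ‖walY F k (a + (j + 1))‖ +
      x * (((b : ℝ) - 1) * (cosec b * (B * x ^ (j + 1)))) := by
    intro j
    rw [walY_succ hF k (a + j)]
    refine (norm_sub_le _ _).trans ?_
    rw [norm_smul, norm_smul, hnx]
    refine add_le_add le_rfl (mul_le_mul_of_nonneg_left ?_ hx0.le)
    rw [← Finset.sum_erase (a := (0 : ZMod b)) _ (by simp [invOneSub])]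
    refine (norm_sum_le_of_le _ (n := fun _ => cosec b * (B * x ^ (j + 1))) fun θ hθ => ?_).trans ?_
    · rw [norm_smul]
      exact mul_le_mul (norm_invOneSub_le _) (hB j θ (Finset.ne_of_mem_erase hθ)) (norm_nonneg _) hc
    · rw [Finset.sum_const, Finset.card_erase_of_mem (Finset.mem_univ _), Finset.card_univ,
        ZMod.card, nsmul_eq_mul, Nat.cast_sub hb.le, Nat.cast_one]
  obtain ⟨M, hM⟩ : ∃ M, ∀ y ∈ Set.uIoc (0 : ℝ) 1, ‖F y‖ ≤ M := by
    obtain ⟨M, hM⟩ := (isCompact_uIcc (a := (0 : ℝ)) (b := 1)).exists_bound_of_continuousOn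
      hF.continuousOn
    exact ⟨M, fun y hy => hM y (Set.uIoc_subset_uIcc hy)⟩
  have hiter : ∀ C : ℕ, ‖walY F k a‖ ≤ cosec b * B * (((b : ℝ) - 1) * x) *
      (∑ j ∈ Finset.range C, x ^ (2 * j + 1)) + x ^ C * ‖walY F k (a + C)‖ := by
    intro C
    induction C with
    | zero => simp
    | succ C ih =>
      have h1 := mul_le_mul_of_nonneg_left (hstep C) (pow_nonneg hx0.le C)
      rw [Finset.sum_range_succ]
      refine ih.trans ?_
      have e : x ^ C * (x * ‖walY F k (a + (C + 1))‖ +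
          x * (((b : ℝ) - 1) * (cosec b * (B * x ^ (C + 1))))) =
          cosec b * B * (((b : ℝ) - 1) * x) * x ^ (2 * C + 1) +
          x ^ (C + 1) * ‖walY F k (a + (C + 1))‖ := by
        ring
      rw [e] at h1
      linarith
  have hlim : Filter.Tendsto (fun C : ℕ => cosec b * B * (((b : ℝ) - 1) * x) *
      (∑ j ∈ Finset.range C, x ^ (2 * j + 1)) + x ^ C * M) Filter.atTop
      (nhds (cosec b * B * (((b : ℝ) - 1) * x) * (x * (1 - x ^ 2)⁻¹) + 0 * M)) := by
    refine Filter.Tendsto.add (Filter.Tendsto.const_mul _ ?_)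
      ((tendsto_pow_atTop_nhds_zero_of_lt_one hx0.le hx1).mul_const M)
    have hx2 : x ^ 2 < 1 := by nlinarith
    have := ((hasSum_geometric_of_lt_one (sq_nonneg x) hx2).mul_left x).tendsto_sum_nat
    refine this.congr fun C => Finset.sum_congr rfl fun j _ => ?_
    rw [pow_succ x (2 * j), pow_mul, mul_comm]
  have h := ge_of_tendsto' hlim fun C => (hiter C).trans (add_le_add le_rfl
    (mul_le_mul_of_nonneg_left (norm_walY_le_of_bound hM k (a + C)) (pow_nonneg hx0.le C)))
  refine h.trans (le_of_eq ?_)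
  have hbx' : x = 1 / b := by rw [hx, one_div]
  have h3 : (b : ℝ) ^ 2 - 1 ≠ 0 := by nlinarith
  have h4 : (b : ℝ) + 1 ≠ 0 := by linarith
  rw [hbx', zero_mul, add_zero]
  have h5 : (1 - (1 / (b : ℝ)) ^ 2) = ((b : ℝ) - 1) * (b + 1) / b ^ 2 := by
    field_simp
    ring
  have h6 : (b : ℝ) - 1 ≠ 0 := by linarith
  rw [h5]
  field_simp

theorem walT_zero (F : ℝ → E) : walT F (0 : ℕ →₀ ZMod b) = ∫ x in (0 : ℝ)..1, F x := by
  simp [walT]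

theorem walT_const [CompleteSpace E] {k : ℕ →₀ ZMod b} (hk : k ≠ 0) (v : E) :
    walT (fun _ => v) k = 0 := by
  rw [walT, integral_wal_smul hk (F' := fun _ => 0) (fun x => hasDerivAt_const x v)
    continuous_const]
  simp

/-- Integration by parts with the primitive `walJ`. Its fractional part is centered by `1/2`, which
changes the coefficient of `wal k` from `-A` to `1/2 - A`; both coefficients have norm at most
`cosec b`. -/
theorem norm_walT_le [CompleteSpace E] {k : ℕ →₀ ZMod b} (hk : k ≠ 0) {F F' : ℝ → E}
    (hF : ∀ x, HasDerivAt F (F' x) x) (hF' : Continuous F') :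
    ‖walT F k‖ ≤ ((b : ℝ)⁻¹) ^ top k.support *
      (cosec b * ‖walT F' (k.erase (top k.support - 1))‖ + cosec b * ‖walT F' k‖ +
        ‖walY F' k (top k.support)‖) := by
  set a := top k.support with ha
  set k' := k.erase (a - 1) with hk'
  have hκ : k (a - 1) ≠ 0 := by
    have h := top_sub_one_mem (Finsupp.support_nonempty_iff.2 hk)
    exact Finsupp.mem_support_iff.1 h
  set A := invOneSub (k (a - 1)) with hA
  have hT : ∀ l : ℕ →₀ ZMod b, IntervalIntegrable (fun x => wal l x • F' x) volume 0 1 :=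
    fun l => intervalIntegrable_bdd_smul (measurable_wal l) (fun x => (norm_wal l x).le) hF' 0 1
  have hTs : ∀ (c : ℂ) (l : ℕ →₀ ZMod b),
      IntervalIntegrable (fun x => c • wal l x • F' x) volume 0 1 := fun c l => (hT l).smul c
  have hY := intervalIntegrable_bdd_smul (measurable_wal_mul_fract k a)
    (norm_wal_mul_fract_le k a) hF' 0 1
  have key : walT F k = -(((b : ℂ) ^ a)⁻¹ •
      (A • walT F' k' + (((1 / 2 : ℝ) : ℂ) - A) • walT F' k + walY F' k a)) := by
    rw [walT, integral_wal_smul hk hF hF']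
    simp only [walT, walY]
    rw [← intervalIntegral.integral_smul, ← intervalIntegral.integral_smul,
      ← intervalIntegral.integral_add (hTs _ _) (hTs _ _),
      ← intervalIntegral.integral_add ((hTs _ _).add (hTs _ _)) hY,
      ← intervalIntegral.integral_smul]
    congr 1
    refine intervalIntegral.integral_congr fun x _ => ?_
    simp only [walJ, smul_smul, ← add_smul, ← ha, ← hk', ← hA]
    congr 1
    push_cast
    ring
  rw [key, norm_neg, norm_smul, norm_inv, norm_pow, Complex.norm_natCast, ← inv_pow]
  refine mul_le_mul_of_nonneg_left ?_ (by positivity)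
  refine (norm_add_le _ _).trans (add_le_add ((norm_add_le _ _).trans (add_le_add ?_ ?_)) le_rfl)
  · rw [norm_smul]
    exact mul_le_mul_of_nonneg_right (norm_invOneSub_le _) (norm_nonneg _)
  · rw [norm_smul]
    refine mul_le_mul_of_nonneg_right ?_ (norm_nonneg _)
    exact (norm_sub_invOneSub_le hκ (by norm_num) (by norm_num)).trans (norm_invOneSub_le _)

/-- Decay of Walsh coefficients: one more derivative. -/
theorem norm_walT_step [CompleteSpace E] (hb : 1 < b) {F F' : ℝ → E}
    (hF : ∀ x, HasDerivAt F (F' x) x) (hF' : Continuous F') {τ : ℕ} (hτ : 1 ≤ τ) {B : ℝ}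
    (h0 : walT F' (0 : ℕ →₀ ZMod b) = 0)
    (hB : ∀ k : ℕ →₀ ZMod b, k ≠ 0 → ‖walT F' k‖ ≤ B * ((b : ℝ)⁻¹) ^ muPer τ k.support)
    {k : ℕ →₀ ZMod b} (hk : k ≠ 0) :
    ‖walT F k‖ ≤ cosec b * growth b * B * ((b : ℝ)⁻¹) ^ muPer (τ + 1) k.support := by
  obtain ⟨τ, rfl⟩ := Nat.exists_eq_add_of_le' hτ
  have hb1 : (1 : ℝ) < b := by exact_mod_cast hb
  have hc := cosec_nonneg b
  have hS := Finsupp.support_nonempty_iff.2 hk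
  have hB0 : 0 ≤ B := by
    have := (norm_nonneg _).trans (hB k hk)
    exact nonneg_of_mul_nonneg_left this (by positivity)
  set S := k.support with hSdef
  set a := top S with ha
  set x : ℝ := (b : ℝ)⁻¹ with hx
  have hx0 : 0 < x := by positivity
  have hx1 : x ≤ 1 := (inv_lt_one_of_one_lt₀ hb1).le
  -- The index `k + θ e_(a+j)` has leading position `a + j + 1`, which gives the geometric decay in
  -- `j` required by `norm_walY_le`.
  have hY : ‖walY F' k a‖ ≤ cosec b * (B * x ^ (a + muPer τ S)) / (b + 1) := by
    refine norm_walY_le hF' k a hb fun j θ hθ => ?_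
    have hsup := support_add_single (k := k) (p := a + j) (Nat.le_add_right a j) hθ
    refine (hB _ fun h => ?_).trans (le_of_eq ?_)
    · rw [h, Finsupp.support_zero] at hsup
      exact Finset.insert_ne_empty _ _ hsup.symm
    · rw [hsup, muPer_succ_insert hS (Nat.le_add_right a j), mul_assoc B, ← pow_add]
      congr 2
      ring
  have hmain := norm_walT_le hk hF hF'
  have hk1 := hB k hk
  refine hmain.trans ?_
  have hsupp := support_erase_top k
  rw [← hSdef, ← ha] at hsupp ⊢
  set P := x ^ muPer (τ + 1 + 1) S with hP
  have hP0 : 0 ≤ P := by positivity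
  have hbp : (0 : ℝ) < b + 1 := by positivity
  have hxb : x = 1 / b := by rw [hx, one_div]
  -- For a one-digit index the shortened index is zero and its coefficient vanishes by `h0`; the
  -- other two terms give only `1 + 1 / (b + 1)`. Otherwise the shortened index gives the main term
  -- and the other two each gain a factor `1 / b`.
  by_cases hd : del S = ∅
  · have hk0 : k.erase (a - 1) = 0 := Finsupp.support_eq_empty.1 (hsupp.trans hd)
    rw [hk0, h0, norm_zero, mul_zero, zero_add]
    have e1 : x ^ a * x ^ muPer (τ + 1) S = P := by
      rw [hP, ← pow_add, muPer_of_del_eq_empty hd, muPer_of_del_eq_empty hd]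
      congr 1
      ring
    have e2 : x ^ a * x ^ (a + muPer τ S) = P := by
      rw [hP, ← pow_add, muPer_of_del_eq_empty hd, muPer_of_del_eq_empty hd]
      congr 1
      ring
    calc x ^ a * (cosec b * ‖walT F' k‖ + ‖walY F' k a‖)
        ≤ x ^ a * (cosec b * (B * x ^ muPer (τ + 1) S) +
          cosec b * (B * x ^ (a + muPer τ S)) / (b + 1)) := by gcongr
      _ = cosec b * B * (x ^ a * x ^ muPer (τ + 1) S) +
          cosec b * B * (x ^ a * x ^ (a + muPer τ S)) / (b + 1) := by ring
      _ = cosec b * (1 + 1 / (b + 1)) * B * P := by rw [e1, e2]; ring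
      _ ≤ cosec b * growth b * B * P := by
        have : 1 + 1 / ((b : ℝ) + 1) ≤ growth b := by
          unfold growth
          have : 1 / ((b : ℝ) + 1) ≤ 1 / b := one_div_le_one_div_of_le (by linarith) (by linarith)
          have : 0 ≤ 1 / ((b : ℝ) * (b + 1)) := by positivity
          linarith
        gcongr
  · have hk0 : k.erase (a - 1) ≠ 0 := fun h => hd (hsupp.symm.trans (by rw [h]; rfl))
    have hk2 := hB _ hk0
    rw [hsupp] at hk2
    have e1 : x ^ a * x ^ muPer (τ + 1) (del S) = P := by
      rw [hP, ← pow_add, muPer_succ_of_del_ne_empty hd]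
    have e2 : x ^ a * x ^ muPer (τ + 1) S ≤ x * P := by
      rw [hP, ← pow_add, ← pow_succ']
      refine pow_le_pow_of_le_one hx0.le hx1 ?_
      have := muPer_del_lt (Nat.le_add_left 1 τ) hd
      rw [muPer_succ_of_del_ne_empty hd]
      omega
    have e3 : x ^ a * x ^ (a + muPer τ S) ≤ x * P := by
      rw [hP, ← pow_add, ← pow_succ']
      refine pow_le_pow_of_le_one hx0.le hx1 ?_
      have h := muPer_add_two_lt τ hd
      rw [show τ + 1 + 1 = τ + 2 from rfl, ha]
      omega
    calc x ^ a * (cosec b * ‖walT F' (k.erase (a - 1))‖ + cosec b * ‖walT F' k‖ +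
          ‖walY F' k a‖)
        ≤ x ^ a * (cosec b * (B * x ^ muPer (τ + 1) (del S)) +
          cosec b * (B * x ^ muPer (τ + 1) S) +
          cosec b * (B * x ^ (a + muPer τ S)) / (b + 1)) := by gcongr
      _ = cosec b * B * (x ^ a * x ^ muPer (τ + 1) (del S)) +
          cosec b * B * (x ^ a * x ^ muPer (τ + 1) S) +
          cosec b * B * (x ^ a * x ^ (a + muPer τ S)) / (b + 1) := by ring
      _ ≤ cosec b * B * P + cosec b * B * (x * P) + cosec b * B * (x * P) / (b + 1) := by
        rw [e1]; gcongr
      _ = cosec b * growth b * B * P := by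
        rw [growth, hxb]
        field_simp
        

end Recursion

section Bernoulli

/-! ### Walsh coefficients of Bernoulli polynomials -/

theorem constW_one (b : ℕ) : constW 1 b = cosec b := by simp [constW, cosec]

theorem constW_of_two_le {b τ : ℕ} (hτ : 2 ≤ τ) :
    constW τ b = growth b ^ (τ - 2) * cosec b ^ τ := by
  rw [constW, if_neg (by omega), growth, cosec, div_pow, one_pow, ← div_eq_mul_one_div]

variable {b : ℕ} [NeZero b]

/-- The normalized Bernoulli polynomial `B_τ / τ!`. -/
noncomputable def bernoulliC (τ : ℕ) (x : ℝ) : ℂ := ((bernoulliFun τ x / (τ ! : ℝ) : ℝ) : ℂ)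

theorem continuous_bernoulliC (τ : ℕ) : Continuous (bernoulliC τ) :=
  Complex.continuous_ofReal.comp ((continuous_bernoulliFun τ).div_const _)

theorem hasDerivAt_bernoulliC (τ : ℕ) (x : ℝ) :
    HasDerivAt (bernoulliC (τ + 1)) (bernoulliC τ x) x := by
  have h := ((hasDerivAt_bernoulliFun (τ + 1) x).div_const ((τ + 1)! : ℝ)).ofReal_comp
  have he : ((τ + 1 : ℕ) : ℝ) * bernoulliFun (τ + 1 - 1) x / ((τ + 1)! : ℝ) =
      bernoulliFun τ x / (τ ! : ℝ) := by
    have h1 : (τ ! : ℝ) ≠ 0 := by positivity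
    have h2 : ((τ + 1 : ℕ) : ℝ) ≠ 0 := by positivity
    rw [Nat.factorial_succ, Nat.cast_mul, Nat.add_sub_cancel]
    field_simp
  rw [he] at h
  exact h

theorem bernoulliC_zero : bernoulliC 0 = fun _ => 1 := by
  funext x
  simp [bernoulliC]

theorem walT_bernoulliC_zero {τ : ℕ} (hτ : τ ≠ 0) : walT (bernoulliC τ) (0 : ℕ →₀ ZMod b) = 0 := by
  rw [walT_zero]
  simp only [bernoulliC]
  rw [intervalIntegral.integral_ofReal, intervalIntegral.integral_div,
    integral_bernoulliFun_eq_zero hτ]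
  simp

/-- In the bound of `norm_walT_le` the index loses at most one digit while the degree drops by one,
so by induction all three terms vanish. The base case is a constant function. -/
theorem walT_bernoulliC_eq_zero (hb : 1 < b) {τ : ℕ} {k : ℕ →₀ ZMod b}
    (hk : τ < k.support.card) : walT (bernoulliC τ) k = 0 := by
  have hk0 : k ≠ 0 := by
    rintro rfl
    simp at hk
  induction τ generalizing k with
  | zero => rw [bernoulliC_zero]; exact walT_const hk0 1
  | succ τ ih =>
    have h := norm_walT_le hk0 (hasDerivAt_bernoulliC τ) (continuous_bernoulliC τ)
    have hY : ‖walY (bernoulliC τ) k (top k.support)‖ ≤ cosec b * 0 / (b + 1) := by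
      refine norm_walY_le (continuous_bernoulliC τ) k _ hb fun j θ hθ => ?_
      have hs := support_add_single (k := k) (Nat.le_add_right _ j) hθ
      have hc : τ < (k + Finsupp.single (top k.support + j) θ).support.card := by
        rw [hs]
        have := Finset.card_le_card (Finset.subset_insert (top k.support + j) k.support)
        omega
      rw [ih hc fun h0 => by rw [h0] at hc; simp at hc]
      simp
    have h1 : walT (bernoulliC τ) (k.erase (top k.support - 1)) = 0 := by
      have hc : τ < (k.erase (top k.support - 1)).support.card := by
        rw [support_erase_top]
        have := card_del_add_one (Finsupp.support_nonempty_iff.2 hk0)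
        omega
      exact ih hc fun h0 => by rw [h0] at hc; simp at hc
    rw [h1, ih (by omega) hk0, norm_zero] at h
    have h2 : ‖walT (bernoulliC (τ + 1)) k‖ ≤ 0 := by
      refine h.trans ?_
      have : ‖walY (bernoulliC τ) k (top k.support)‖ ≤ 0 := by simpa using hY
      have h3 : (0 : ℝ) ≤ ((b : ℝ)⁻¹) ^ top k.support := by positivity
      nlinarith
    exact norm_le_zero_iff.1 h2

theorem constW_nonneg {τ : ℕ} (hτ : 1 ≤ τ) : 0 ≤ constW τ b := by
  have := cosec_nonneg b
  have := (growth_pos b).le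
  rcases hτ.eq_or_lt with rfl | h
  · rwa [constW_one]
  · rw [constW_of_two_le h]
    positivity

/-- For `τ = 1` and `τ = 2` at most one of the three terms of `norm_walT_le` survives, because a
polynomial of degree `τ - 1` has no coefficient with `τ` or more digits. So `growth b` enters only
from the third step on, which explains the exponent `τ - 2`. -/
theorem norm_walT_bernoulliC_le (hb : 1 < b) {τ : ℕ} (hτ : 1 ≤ τ) {k : ℕ →₀ ZMod b}
    (hk : k ≠ 0) :
    ‖walT (bernoulliC τ) k‖ ≤ constW τ b * ((b : ℝ)⁻¹) ^ muPer τ k.support := by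
  have hc := cosec_nonneg b
  have hx : (0 : ℝ) ≤ (b : ℝ)⁻¹ := by positivity
  have hY : ∀ τ, ∀ {k : ℕ →₀ ZMod b}, k ≠ 0 → τ ≤ k.support.card →
      ‖walY (bernoulliC τ) k (top k.support)‖ ≤ 0 := by
    intro τ k hk hτ
    have h0 : cosec b * 0 / ((b : ℝ) + 1) = 0 := by simp
    rw [← h0]
    refine norm_walY_le (continuous_bernoulliC τ) k _ hb fun j θ hθ => ?_
    rw [walT_bernoulliC_eq_zero hb]
    · simp
    · rw [support_add_single (Nat.le_add_right _ j) hθ, Finset.card_insert_of_notMem]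
      · omega
      · intro h
        have := lt_top_of_mem h
        omega
  have hcard : ∀ {k : ℕ →₀ ZMod b}, k ≠ 0 → 1 ≤ k.support.card := fun {k} hk =>
    Finset.card_pos.2 (Finsupp.support_nonempty_iff.2 hk)
  have h1 : ∀ {k : ℕ →₀ ZMod b}, k ≠ 0 →
      ‖walT (bernoulliC 1) k‖ ≤ constW 1 b * ((b : ℝ)⁻¹) ^ muPer 1 k.support := by
    intro k hk
    refine (norm_walT_le hk (hasDerivAt_bernoulliC 0) (continuous_bernoulliC 0)).trans ?_
    rw [muPer_one, constW_one, mul_comm (cosec b) (_ ^ _)]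
    refine mul_le_mul_of_nonneg_left ?_ (by positivity)
    have e1 : ‖walT (bernoulliC 0) k‖ = 0 := by
      rw [bernoulliC_zero, walT_const hk, norm_zero]
    have e2 : ‖walT (bernoulliC 0) (k.erase (top k.support - 1))‖ ≤ 1 := by
      by_cases h0 : k.erase (top k.support - 1) = 0
      · rw [h0, walT_zero, bernoulliC_zero]
        simp
      · rw [bernoulliC_zero, walT_const h0, norm_zero]
        norm_num
    have e3 := hY 0 hk (Nat.zero_le _)
    rw [e1]
    nlinarith
  have h2 : ∀ {k : ℕ →₀ ZMod b}, k ≠ 0 →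
      ‖walT (bernoulliC 2) k‖ ≤ constW 2 b * ((b : ℝ)⁻¹) ^ muPer 2 k.support := by
    intro k hk
    refine (norm_walT_le hk (hasDerivAt_bernoulliC 1) (continuous_bernoulliC 1)).trans ?_
    have e3 := hY 1 hk (hcard hk)
    have hcd := card_del_add_one (Finsupp.support_nonempty_iff.2 hk)
    rw [constW_of_two_le le_rfl, Nat.sub_self, pow_zero, one_mul]
    by_cases hd : del k.support = ∅
    · have e1 := h1 hk
      have hk' : k.erase (top k.support - 1) = 0 :=
        Finsupp.support_eq_empty.1 ((support_erase_top k).trans hd)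
      rw [hk', walT_bernoulliC_zero one_ne_zero, norm_zero, muPer_succ_of_del_eq_empty hd, pow_add]
      rw [constW_one] at e1
      calc _ ≤ ((b : ℝ)⁻¹) ^ top k.support * (cosec b * 0 +
            cosec b * (cosec b * ((b : ℝ)⁻¹) ^ muPer 1 k.support) + 0) := by gcongr
        _ = _ := by ring
    · have hk' : k.erase (top k.support - 1) ≠ 0 := fun h =>
        hd ((support_erase_top k).symm.trans (by rw [h]; rfl))
      have e1 := h1 hk'
      have e2 : walT (bernoulliC 1) k = 0 := by
        refine walT_bernoulliC_eq_zero hb ?_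
        have := Finset.card_pos.2 (Finset.nonempty_iff_ne_empty.2 hd)
        omega
      rw [constW_one, support_erase_top] at e1
      rw [e2, norm_zero, muPer_succ_of_del_ne_empty hd, pow_add]
      calc _ ≤ ((b : ℝ)⁻¹) ^ top k.support * (cosec b * (cosec b *
            ((b : ℝ)⁻¹) ^ muPer 1 (del k.support)) + cosec b * 0 + 0) := by gcongr
        _ = _ := by ring
  induction τ, hτ using Nat.le_induction generalizing k with
  | base => exact h1 hk
  | succ τ hτ ih =>
    rcases hτ.eq_or_lt with rfl | hτ2
    · exact h2 hk
    · have h := norm_walT_step hb (hasDerivAt_bernoulliC τ) (continuous_bernoulliC τ) hτ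
        (walT_bernoulliC_zero (by omega)) (fun k hk => ih hk) hk
      refine h.trans (le_of_eq ?_)
      rw [constW_of_two_le (by omega), constW_of_two_le (by omega),
        show τ + 1 - 2 = (τ - 2) + 1 by omega]
      ring

/-! ### Walsh coefficients of trigonometric functions -/

/-- The constant function has no Walsh coefficients at nonzero indices, so every term in the
expansion of the remainder vanishes. -/
theorem walY_one_single (hb : 1 < b) (a : ℕ) {κ : ZMod b} (hκ : κ ≠ 0) :
    walY (fun _ => (1 : ℂ)) (Finsupp.single a κ) (a + 1) = 0 := by
  have h0 : cosec b * 0 / ((b : ℝ) + 1) = 0 := by simp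
  rw [← norm_le_zero_iff, ← h0]
  refine norm_walY_le continuous_const _ _ hb fun j θ hθ => ?_
  rw [walT_const]
  · simp
  · intro h
    have := DFunLike.congr_fun h a
    simp [Finsupp.single_apply] at this
    rw [if_neg (by omega), add_zero] at this
    exact hκ this

/-- The left side is the squared norm of `A + z (y - A)`, whose second summand is no longer than
`A`. The cross term is kept, since it integrates to zero in the application. -/
theorem normSq_add_mul_le {A z : ℂ} {y : ℝ} (hz : ‖z‖ = 1) (hy : ‖(y : ℂ) - A‖ ≤ ‖A‖) :
    ‖A * (1 - z) + z * y‖ ^ 2 ≤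
      2 * ‖A‖ ^ 2 + 2 * ((starRingEnd ℂ) A * (z * (y - A))).re := by
  have h1 : A * (1 - z) + z * y = A + z * (y - A) := by ring
  have h2 := Complex.normSq_add A (z * (y - A))
  have h3 : ‖z * ((y : ℂ) - A)‖ ^ 2 ≤ ‖A‖ ^ 2 := by
    rw [norm_mul, hz, one_mul]
    gcongr
  have h4 : (A * (starRingEnd ℂ) (z * (y - A))).re = ((starRingEnd ℂ) A * (z * (y - A))).re := by
    rw [← Complex.conj_re, map_mul, Complex.conj_conj]
  rw [← Complex.sq_norm, ← Complex.sq_norm, ← Complex.sq_norm, h4] at h2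
  rw [h1, h2]
  linarith

theorem intervalIntegrable_of_bdd {f : ℝ → ℂ} {C : ℝ} (hf : Measurable f) (hC : ∀ x, ‖f x‖ ≤ C)
    (u v : ℝ) : IntervalIntegrable f volume u v := by
  have := intervalIntegrable_bdd_smul hf hC (continuous_const (y := (1 : ℂ))) u v
  simpa using this

/-- A pointwise estimate alone would give the constant `4`. The cross term is a combination of the
one-digit Walsh function and its product with the centered remainder; both have integral zero, so
the constant is `2`. This is the factor `2` in front of `c_(2α)` in `constD`. -/
theorem integral_normSq_walJ_le (hb : 1 < b) {k : ℕ →₀ ZMod b} (hk : k ≠ 0) :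
    ∫ x in (0 : ℝ)..1, ‖walJ k x‖ ^ 2 ≤ 2 * cosec b ^ 2 * (((b : ℝ)⁻¹) ^ top k.support) ^ 2 := by
  obtain ⟨a, ha⟩ : ∃ a, top k.support = a + 1 :=
    Nat.exists_eq_succ_of_ne_zero fun h => hk (Finsupp.support_eq_empty.1 (top_eq_zero.1 h))
  have hκ : k a ≠ 0 := by
    have h := top_sub_one_mem (Finsupp.support_nonempty_iff.2 hk)
    rw [ha, Nat.add_sub_cancel] at h
    exact Finsupp.mem_support_iff.1 h
  set A := invOneSub (k a) with hA
  set X := (((b : ℝ)⁻¹) ^ (a + 1)) ^ 2 with hX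
  set s : ℕ →₀ ZMod b := Finsupp.single a (k a) with hs
  have hs0 : s ≠ 0 := by simpa [hs] using hκ
  set g : ℝ → ℂ := fun x => (starRingEnd ℂ) A *
    (wal s x * ((Int.fract ((b : ℝ) ^ (a + 1) * x) : ℝ) - A)) with hg
  have hgeq : ∀ x, g x = (starRingEnd ℂ) A *
      ((wal s x * ((Int.fract ((b : ℝ) ^ (a + 1) * x) - 1 / 2 : ℝ) : ℂ)) +
        (1 / 2 - A) * wal s x) := by
    intro x
    simp only [hg]
    push_cast
    ring
  have hi1 : IntervalIntegrable (fun x => wal s x *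
      ((Int.fract ((b : ℝ) ^ (a + 1) * x) - 1 / 2 : ℝ) : ℂ)) volume 0 1 :=
    intervalIntegrable_of_bdd (measurable_wal_mul_fract s (a + 1))
      (norm_wal_mul_fract_le s (a + 1)) 0 1
  have hi2 : IntervalIntegrable (wal s) volume 0 1 :=
    intervalIntegrable_of_bdd (measurable_wal s) (fun x => (norm_wal s x).le) 0 1
  have hgi : IntervalIntegrable g volume 0 1 := by
    rw [show g = _ from funext hgeq]
    exact (hi1.add (hi2.const_mul _)).const_mul _
  have hg0 : ∫ x in (0 : ℝ)..1, g x = 0 := by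
    simp_rw [hgeq]
    rw [intervalIntegral.integral_const_mul, intervalIntegral.integral_add hi1 (hi2.const_mul _),
      intervalIntegral.integral_const_mul]
    have h1 := walY_one_single hb a hκ
    have h2 := walT_const hs0 (1 : ℂ)
    simp only [walY, walT, smul_eq_mul, mul_one] at h1 h2
    rw [h1, h2]
    simp
  -- The Walsh function of the shortened index is a common factor of modulus one, so only the
  -- leading digit `s` matters.
  have hpt : ∀ x, ‖walJ k x‖ ^ 2 ≤ X * (2 * ‖A‖ ^ 2 + 2 * (g x).re) := by
    intro x
    have h1 : walJ k x = ((b : ℂ) ^ (a + 1))⁻¹ * (wal (k.erase a) x *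
        (A * (1 - wal s x) + wal s x * (Int.fract ((b : ℝ) ^ (a + 1) * x) : ℝ))) := by
      rw [walJ, ha, Nat.add_sub_cancel, wal_eq_erase_mul k a x, hs, wal_single]
      ring
    rw [h1, norm_mul, norm_mul, norm_wal, one_mul, mul_pow, norm_inv, norm_pow,
      Complex.norm_natCast, ← inv_pow]
    refine mul_le_mul_of_nonneg_left ?_ (by positivity)
    exact normSq_add_mul_le (norm_wal s x)
      (norm_sub_invOneSub_le hκ (Int.fract_nonneg _) (Int.fract_lt_one _).le)
  have hgre : IntervalIntegrable (fun x => (g x).re) volume 0 1 := by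
    rw [intervalIntegrable_iff] at hgi ⊢
    exact hgi.re
  have hgre0 : ∫ x in (0 : ℝ)..1, (g x).re = 0 := by
    have := (Complex.reCLM.intervalIntegral_comp_comm hgi)
    simp only [Complex.reCLM_apply] at this
    rw [this, hg0, Complex.zero_re]
  have hJ : IntervalIntegrable (fun x => ‖walJ k x‖ ^ 2) volume 0 1 := by
    have h : IntervalIntegrable (fun x => walJ k x * (starRingEnd ℂ) (walJ k x)) volume 0 1 := by
      refine intervalIntegrable_of_bdd (f := fun x => walJ k x * (starRingEnd ℂ) (walJ k x))
        (C := (‖((b : ℂ) ^ top k.support)⁻¹‖ *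
        (‖invOneSub (k (top k.support - 1))‖ * 2 + 1)) ^ 2)
        ((measurable_walJ k).mul (Complex.continuous_conj.measurable.comp (measurable_walJ k)))
        (fun x => ?_) 0 1
      rw [norm_mul, RCLike.norm_conj, ← sq]
      exact pow_le_pow_left₀ (norm_nonneg _) (norm_walJ_le k x) 2
    have h2 := h.norm
    simpa only [norm_mul, RCLike.norm_conj, ← sq] using h2
  have hmono := intervalIntegral.integral_mono_on (zero_le_one (α := ℝ)) hJ
    ((((intervalIntegrable_const (c := 2 * ‖A‖ ^ 2)).add (hgre.const_mul 2))).const_mul X)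
    fun x _ => hpt x
  refine hmono.trans ?_
  rw [intervalIntegral.integral_const_mul, intervalIntegral.integral_add
    intervalIntegrable_const (hgre.const_mul 2), intervalIntegral.integral_const_mul 2 fun x => (g x).re,
    hgre0, intervalIntegral.integral_const, ha, sub_zero, one_smul, mul_zero, add_zero, ← hX,
    mul_comm X]
  have := norm_invOneSub_le (k a)
  gcongr

/-- The trigonometric function `exp (2 π i h x)`. -/
noncomputable def trig (h : ℤ) (x : ℝ) : ℂ := Complex.exp (2 * Real.pi * Complex.I * h * x)

theorem continuous_trig (h : ℤ) : Continuous (trig h) := by unfold trig; fun_prop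

theorem norm_trig (h : ℤ) (x : ℝ) : ‖trig h x‖ = 1 := by
  rw [trig, show (2 * Real.pi * Complex.I * h * x : ℂ) = ((2 * Real.pi * h * x : ℝ) : ℂ) *
    Complex.I by push_cast; ring, Complex.norm_exp_ofReal_mul_I]

theorem trig_add (g h : ℤ) (x : ℝ) : trig (g + h) x = trig g x * trig h x := by
  rw [trig, trig, trig, ← Complex.exp_add]
  congr 1
  push_cast
  ring

theorem trig_neg (h : ℤ) (x : ℝ) : trig (-h) x = (starRingEnd ℂ) (trig h x) := by
  rw [trig, trig, ← Complex.exp_conj]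
  congr 1
  simp only [map_mul, Complex.conj_ofReal, Complex.conj_I, map_ofNat, map_intCast]
  push_cast
  ring

theorem freq_ne_zero {h : ℤ} (hh : h ≠ 0) : (2 * Real.pi * Complex.I * h : ℂ) ≠ 0 := by
  have : (Real.pi : ℂ) ≠ 0 := by exact_mod_cast Real.pi_ne_zero
  have : (h : ℂ) ≠ 0 := by exact_mod_cast hh
  simp [*]

theorem integral_trig (h : ℤ) : ∫ x in (0 : ℝ)..1, trig h x = if h = 0 then 1 else 0 := by
  split_ifs with hh
  · simp [hh, trig]
  · simp only [trig]
    rw [integral_exp_mul_complex (freq_ne_zero hh)]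
    have := Complex.exp_int_mul_two_pi_mul_I h
    have e : (2 * Real.pi * Complex.I * h * (1 : ℝ) : ℂ) = h * (2 * Real.pi * Complex.I) := by
      push_cast
      ring
    rw [e, this]
    simp

theorem hasDerivAt_trig (h : ℤ) (x : ℝ) :
    HasDerivAt (trig h) (2 * Real.pi * Complex.I * h * trig h x) x := by
  have h1 : HasDerivAt (fun z : ℂ => 2 * Real.pi * Complex.I * h * z)
      (2 * Real.pi * Complex.I * h) (x : ℂ) := by
    simpa using (hasDerivAt_id (x : ℂ)).const_mul (2 * Real.pi * Complex.I * h : ℂ)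
  have h2 := h1.cexp.comp_ofReal
  rw [mul_comm (Complex.exp _)] at h2
  exact h2

/-- Bessel's inequality for finitely many trigonometric functions. -/
theorem bessel_trig (H : Finset ℤ) {f : ℝ → ℂ} {C : ℝ} (hf : Measurable f)
    (hC : ∀ x, ‖f x‖ ≤ C) :
    ∑ h ∈ H, ‖∫ x in (0 : ℝ)..1, f x * trig h x‖ ^ 2 ≤ ∫ x in (0 : ℝ)..1, ‖f x‖ ^ 2 := by
  have hC0 : 0 ≤ C := (norm_nonneg _).trans (hC 0)
  set c : ℤ → ℂ := fun h => ∫ x in (0 : ℝ)..1, f x * trig h x with hc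
  have hft : ∀ h, IntervalIntegrable (fun x => f x * trig h x) volume 0 1 := fun h =>
    intervalIntegrable_of_bdd (f := fun x => f x * trig h x) (hf.mul (continuous_trig h).measurable)
      (fun x => by rw [norm_mul, norm_trig, mul_one]; exact hC x) 0 1
  have hff : IntervalIntegrable (fun x => f x * (starRingEnd ℂ) (f x)) volume 0 1 :=
    intervalIntegrable_of_bdd (f := fun x => f x * (starRingEnd ℂ) (f x)) (C := C ^ 2) (hf.mul (Complex.continuous_conj.measurable.comp hf))
      (fun x => by
        rw [norm_mul, RCLike.norm_conj, ← sq]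
        exact pow_le_pow_left₀ (norm_nonneg _) (hC x) 2) 0 1
  have hfc : ∀ h, IntervalIntegrable (fun x => (starRingEnd ℂ) (f x * trig h x)) volume 0 1 :=
    fun h => intervalIntegrable_of_bdd (f := fun x => (starRingEnd ℂ) (f x * trig h x)) (C := C)
      (Complex.continuous_conj.measurable.comp (hf.mul (continuous_trig h).measurable))
      (fun x => by rw [RCLike.norm_conj, norm_mul, norm_trig, mul_one]; exact hC x) 0 1
  have hconj : ∀ h, ∫ x in (0 : ℝ)..1, (starRingEnd ℂ) (f x * trig h x) =
      (starRingEnd ℂ) (c h) := by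
    intro h
    have := Complex.conjCLE.toContinuousLinearMap.intervalIntegral_comp_comm (hft h)
    simpa using this
  have hpt : ∀ x, ((‖f x - ∑ h ∈ H, c h * (starRingEnd ℂ) (trig h x)‖ ^ 2 : ℝ) : ℂ) =
      f x * (starRingEnd ℂ) (f x) - ∑ h ∈ H, (starRingEnd ℂ) (c h) * (f x * trig h x) -
      ∑ h ∈ H, c h * (starRingEnd ℂ) (f x * trig h x) +
      ∑ h ∈ H, ∑ g ∈ H, c h * (starRingEnd ℂ) (c g) * trig (g - h) x := by
    intro x
    rw [Complex.ofReal_pow, ← Complex.mul_conj']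
    have e0 : (starRingEnd ℂ) (∑ h ∈ H, c h * (starRingEnd ℂ) (trig h x)) =
        ∑ h ∈ H, (starRingEnd ℂ) (c h) * trig h x := by
      simp only [map_sum, map_mul, Complex.conj_conj]
    have e1 : f x * ∑ h ∈ H, (starRingEnd ℂ) (c h) * trig h x =
        ∑ h ∈ H, (starRingEnd ℂ) (c h) * (f x * trig h x) := by
      rw [Finset.mul_sum]
      exact Finset.sum_congr rfl fun h _ => by ring
    have e2 : (∑ h ∈ H, c h * (starRingEnd ℂ) (trig h x)) * (starRingEnd ℂ) (f x) =
        ∑ h ∈ H, c h * (starRingEnd ℂ) (f x * trig h x) := by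
      rw [Finset.sum_mul]
      exact Finset.sum_congr rfl fun h _ => by rw [map_mul]; ring
    have e3 : (∑ h ∈ H, c h * (starRingEnd ℂ) (trig h x)) *
        (∑ g ∈ H, (starRingEnd ℂ) (c g) * trig g x) =
        ∑ h ∈ H, ∑ g ∈ H, c h * (starRingEnd ℂ) (c g) * trig (g - h) x := by
      rw [Finset.sum_mul_sum]
      refine Finset.sum_congr rfl fun h _ => Finset.sum_congr rfl fun g _ => ?_
      rw [sub_eq_add_neg, trig_add, trig_neg]
      ring
    rw [map_sub, e0]
    linear_combination -e1 - e2 + e3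
  have hts : ∀ g h, IntervalIntegrable (fun x => c h * (starRingEnd ℂ) (c g) * trig (g - h) x)
      volume 0 1 := fun g h =>
    ((continuous_trig (g - h)).intervalIntegrable 0 1).const_mul _
  have hI1 : IntervalIntegrable (fun x => ∑ h ∈ H, (starRingEnd ℂ) (c h) * (f x * trig h x))
      volume 0 1 := by
    simpa only [Finset.sum_fn] using
      IntervalIntegrable.sum H fun h _ => (hft h).const_mul ((starRingEnd ℂ) (c h))
  have hI2 : IntervalIntegrable (fun x => ∑ h ∈ H, c h * (starRingEnd ℂ) (f x * trig h x))
      volume 0 1 := by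
    simpa only [Finset.sum_fn] using
      IntervalIntegrable.sum H fun h _ => (hfc h).const_mul (c h)
  have hI3h : ∀ h, IntervalIntegrable (fun x => ∑ g ∈ H,
      c h * (starRingEnd ℂ) (c g) * trig (g - h) x) volume 0 1 := by
    intro h
    simpa only [Finset.sum_fn] using IntervalIntegrable.sum H fun g _ => hts g h
  have hI3 : IntervalIntegrable (fun x => ∑ h ∈ H, ∑ g ∈ H,
      c h * (starRingEnd ℂ) (c g) * trig (g - h) x) volume 0 1 := by
    simpa only [Finset.sum_fn] using IntervalIntegrable.sum H fun h _ => hI3h h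
  have hinteg : ((∫ x in (0 : ℝ)..1, ‖f x - ∑ h ∈ H, c h * (starRingEnd ℂ) (trig h x)‖ ^ 2 : ℝ) : ℂ)
      = (∫ x in (0 : ℝ)..1, f x * (starRingEnd ℂ) (f x)) -
        ∑ h ∈ H, c h * (starRingEnd ℂ) (c h) := by
    rw [← intervalIntegral.integral_ofReal]
    simp_rw [hpt]
    rw [intervalIntegral.integral_add ((hff.sub hI1).sub hI2) hI3,
      intervalIntegral.integral_sub (hff.sub hI1) hI2, intervalIntegral.integral_sub hff hI1,
      intervalIntegral.integral_finsetSum fun h _ => (hft h).const_mul _,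
      intervalIntegral.integral_finsetSum fun h _ => (hfc h).const_mul _,
      intervalIntegral.integral_finsetSum fun h _ => hI3h h]
    simp_rw [intervalIntegral.integral_finsetSum fun g (_ : g ∈ H) => hts g _,
      intervalIntegral.integral_const_mul, integral_trig, hconj, sub_eq_zero]
    have e : ∀ h ∈ H, ∑ g ∈ H, c h * (starRingEnd ℂ) (c g) * (if g = h then (1 : ℂ) else 0) =
        c h * (starRingEnd ℂ) (c h) := by
      intro h hh
      simp [hh]
    rw [Finset.sum_congr rfl e]
    have e2 : ∑ h ∈ H, (starRingEnd ℂ) (c h) * (∫ x in (0 : ℝ)..1, f x * trig h x) =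
        ∑ h ∈ H, c h * (starRingEnd ℂ) (c h) :=
      Finset.sum_congr rfl fun h _ => mul_comm _ _
    rw [e2]
    ring
  have hnn : 0 ≤ ∫ x in (0 : ℝ)..1, ‖f x - ∑ h ∈ H, c h * (starRingEnd ℂ) (trig h x)‖ ^ 2 :=
    intervalIntegral.integral_nonneg zero_le_one fun x _ => by positivity
  simp only [Complex.mul_conj'] at hinteg
  have hfin : (∫ x in (0 : ℝ)..1, ‖f x - ∑ h ∈ H, c h * (starRingEnd ℂ) (trig h x)‖ ^ 2 : ℝ) =
      (∫ x in (0 : ℝ)..1, ‖f x‖ ^ 2) - ∑ h ∈ H, ‖c h‖ ^ 2 := by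
    have e : ∫ x in (0 : ℝ)..1, (‖f x‖ : ℂ) ^ 2 = ((∫ x in (0 : ℝ)..1, ‖f x‖ ^ 2 : ℝ) : ℂ) := by
      rw [← intervalIntegral.integral_ofReal]
      simp
    rw [e] at hinteg
    exact_mod_cast hinteg
  rw [hfin] at hnn
  linarith

end Bernoulli

/-! ### Trigonometric functions as one vector-valued function, and the diagonal coefficients of the
kernel -/

section Coefficients

theorem mu_of_card_le {S : Finset ℕ} {σ τ : ℕ} (h1 : S.card ≤ σ) (h2 : σ ≤ τ) :
    mu τ S = mu σ S := by
  induction σ generalizing τ S with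
  | zero =>
    have : S = ∅ := Finset.card_eq_zero.1 (by omega)
    rw [this, mu_empty, mu_empty]
  | succ σ ih =>
    obtain ⟨τ, rfl⟩ := Nat.exists_eq_add_of_le' (show 1 ≤ τ by omega)
    rw [mu_succ, mu_succ]
    rcases S.eq_empty_or_nonempty with rfl | hS
    · rw [del_empty, mu_empty, mu_empty]
    · have := card_del_add_one hS
      rw [ih (by omega) (by omega)]

variable {b : ℕ} [NeZero b]

/-- The trigonometric functions with frequencies in `H`, integrated `τ` times. -/
noncomputable def trigVec (H : Finset ℤ) (τ : ℕ) (x : ℝ) : EuclideanSpace ℂ H :=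
  ∑ h : H, (((2 * Real.pi * Complex.I * (h : ℤ)) ^ τ)⁻¹ * trig h x) • EuclideanSpace.single h 1

theorem continuous_trigVec (H : Finset ℤ) (τ : ℕ) : Continuous (trigVec H τ) := by
  have := fun h => continuous_trig h
  unfold trigVec
  fun_prop

/-- Collecting the frequencies in one Euclidean-space valued function lets `norm_walT_step` act on
the square sum over all frequencies at once, with constants independent of `H`. Frequency zero is
excluded because it has no periodic primitive. -/
theorem hasDerivAt_trigVec {H : Finset ℤ} (hH : 0 ∉ H) (τ : ℕ) (x : ℝ) :
    HasDerivAt (trigVec H (τ + 1)) (trigVec H τ x) x := by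
  have h1 : ∀ h : H, HasDerivAt (fun x => (((2 * Real.pi * Complex.I * (h : ℤ)) ^ (τ + 1))⁻¹ *
      trig h x) • (EuclideanSpace.single h 1 : EuclideanSpace ℂ H))
      ((((2 * Real.pi * Complex.I * (h : ℤ)) ^ τ)⁻¹ * trig h x) • EuclideanSpace.single h 1) x := by
    intro h
    have hne : (2 * Real.pi * Complex.I * (h : ℤ) : ℂ) ≠ 0 :=
      freq_ne_zero fun h0 => hH (h0 ▸ h.2)
    have h2 := ((hasDerivAt_trig h x).const_mul
      (((2 * Real.pi * Complex.I * (h : ℤ)) ^ (τ + 1) : ℂ)⁻¹)).smul_const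
        (EuclideanSpace.single h 1 : EuclideanSpace ℂ H)
    have h3 : ((2 * Real.pi * Complex.I * (h : ℤ)) ^ (τ + 1) : ℂ)⁻¹ *
        (2 * Real.pi * Complex.I * (h : ℤ) * trig h x) =
        ((2 * Real.pi * Complex.I * (h : ℤ)) ^ τ)⁻¹ * trig h x := by
      rw [← mul_assoc]
      congr 1
      rw [pow_succ, mul_inv, mul_assoc, inv_mul_cancel₀ hne, mul_one]
    rw [h3] at h2
    exact h2
  have h4 := HasDerivAt.fun_sum (u := Finset.univ) fun h _ => h1 h
  exact h4

theorem trigVec_apply (H : Finset ℤ) (τ : ℕ) (x : ℝ) (h : H) :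
    trigVec H τ x h = ((2 * Real.pi * Complex.I * (h : ℤ)) ^ τ)⁻¹ * trig h x := by
  simp [trigVec, Pi.single_apply]

theorem integral_smul_trigVec_apply {g : ℝ → ℂ} {C : ℝ} (hg : Measurable g) (hC : ∀ x, ‖g x‖ ≤ C)
    (H : Finset ℤ) (τ : ℕ) (h : H) :
    (∫ x in (0 : ℝ)..1, g x • trigVec H τ x) h =
      ((2 * Real.pi * Complex.I * (h : ℤ)) ^ τ)⁻¹ * ∫ x in (0 : ℝ)..1, g x * trig h x := by
  have hi := intervalIntegrable_bdd_smul hg hC (continuous_trigVec H τ) 0 1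
  have h1 := (EuclideanSpace.proj h : EuclideanSpace ℂ H →L[ℂ] ℂ).intervalIntegral_comp_comm hi
  have h2 : (∫ x in (0 : ℝ)..1, g x • trigVec H τ x) h =
      (EuclideanSpace.proj h : EuclideanSpace ℂ H →L[ℂ] ℂ)
        (∫ x in (0 : ℝ)..1, g x • trigVec H τ x) := rfl
  rw [h2, ← h1, ← intervalIntegral.integral_const_mul]
  refine intervalIntegral.integral_congr fun x _ => ?_
  change (g x • trigVec H τ x) h = _
  rw [PiLp.smul_apply, trigVec_apply, smul_eq_mul]
  ring

theorem walT_trigVec_apply (H : Finset ℤ) (τ : ℕ) (h : H) (k : ℕ →₀ ZMod b) :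
    walT (trigVec H τ) k h = ((2 * Real.pi * Complex.I * (h : ℤ)) ^ τ)⁻¹ * walT (trig h) k :=
  integral_smul_trigVec_apply (measurable_wal k) (fun x => (norm_wal k x).le) H τ h

theorem walT_trig_zero (h : ℤ) :
    walT (trig h) (0 : ℕ →₀ ZMod b) = if h = 0 then 1 else 0 := by
  rw [walT_zero, integral_trig]

theorem walT_trigVec_zero {H : Finset ℤ} (hH : 0 ∉ H) (τ : ℕ) :
    walT (trigVec H τ) (0 : ℕ →₀ ZMod b) = 0 := by
  ext h
  rw [walT_trigVec_apply, walT_trig_zero, if_neg fun h0 : (h : ℤ) = 0 => hH (h0 ▸ h.2)]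
  simp

/-- The general step would start from `trigVec H 0`, whose norm grows with the size of `H`. Instead,
one integration by parts turns the square sum into squared Fourier coefficients of `walJ k`, and
Bessel's inequality bounds them by its square integral. -/
theorem norm_walT_trigVec_one_le (hb : 1 < b) {H : Finset ℤ} (hH : 0 ∉ H) {k : ℕ →₀ ZMod b}
    (hk : k ≠ 0) :
    ‖walT (trigVec H 1) k‖ ≤ √2 * cosec b * ((b : ℝ)⁻¹) ^ muPer 1 k.support := by
  have hc := cosec_nonneg b
  refine le_of_sq_le_sq ?_ (by positivity)
  have h1 : ‖walT (trigVec H 1) k‖ ^ 2 =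
      ∑ h ∈ H, ‖∫ x in (0 : ℝ)..1, walJ k x * trig h x‖ ^ 2 := by
    rw [walT, integral_wal_smul hk (hasDerivAt_trigVec hH 0) (continuous_trigVec H 0), norm_neg,
      EuclideanSpace.norm_sq_eq,
      ← Finset.sum_coe_sort H fun h => ‖∫ x in (0 : ℝ)..1, walJ k x * trig h x‖ ^ 2]
    refine Finset.sum_congr rfl fun h _ => ?_
    rw [integral_smul_trigVec_apply (measurable_walJ k) (norm_walJ_le k), pow_zero, inv_one,
      one_mul]
  rw [h1, mul_pow, mul_pow, Real.sq_sqrt (by norm_num), muPer_one]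
  exact (bessel_trig H (measurable_walJ k) (norm_walJ_le k)).trans (integral_normSq_walJ_le hb hk)

theorem norm_walT_trigVec_le (hb : 1 < b) {H : Finset ℤ} (hH : 0 ∉ H) (τ : ℕ)
    {k : ℕ →₀ ZMod b} (hk : k ≠ 0) :
    ‖walT (trigVec H (τ + 1)) k‖ ≤
      √2 * growth b ^ τ * cosec b ^ (τ + 1) * ((b : ℝ)⁻¹) ^ muPer (τ + 1) k.support := by
  induction τ generalizing k with
  | zero =>
    have := norm_walT_trigVec_one_le hb hH hk
    simpa using this
  | succ τ ih =>
    refine (norm_walT_step hb (hasDerivAt_trigVec hH (τ + 1)) (continuous_trigVec H (τ + 1))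
      (Nat.le_add_left 1 τ) (walT_trigVec_zero hH _) (fun k hk => ih hk) hk).trans (le_of_eq ?_)
    ring

/-- The left side is the squared norm of the Walsh coefficient of `trigVec H α`; squaring `√2 *
growth b ^ (α - 1) * cosec b ^ α` gives `2 * constW (2 * α) b`. -/
theorem sum_normSq_walT_trig_le (hb : 1 < b) {H : Finset ℤ} (hH : 0 ∉ H) {α : ℕ} (hα : 1 ≤ α)
    {k : ℕ →₀ ZMod b} (hk : k ≠ 0) :
    ∑ h ∈ H, ‖walT (trig h) k‖ ^ 2 / (2 * Real.pi * |(h : ℝ)|) ^ (2 * α) ≤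
      2 * constW (2 * α) b * ((b : ℝ)⁻¹) ^ (2 * muPer α k.support) := by
  obtain ⟨τ, rfl⟩ := Nat.exists_eq_add_of_le' hα
  have h1 : ‖walT (trigVec H (τ + 1)) k‖ ^ 2 =
      ∑ h ∈ H, ‖walT (trig h) k‖ ^ 2 / (2 * Real.pi * |(h : ℝ)|) ^ (2 * (τ + 1)) := by
    rw [EuclideanSpace.norm_sq_eq, ← Finset.sum_coe_sort H]
    refine Finset.sum_congr rfl fun h _ => ?_
    rw [walT_trigVec_apply, norm_mul, norm_inv, norm_pow, mul_pow, inv_pow, ← pow_mul,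
      mul_comm (τ + 1) 2, div_eq_mul_inv, mul_comm]
    congr 3
    simp [abs_of_pos Real.pi_pos]
  rw [← h1]
  have hc := cosec_nonneg b
  have hg := (growth_pos b).le
  refine (pow_le_pow_left₀ (norm_nonneg _) (norm_walT_trigVec_le hb hH τ hk) 2).trans
    (le_of_eq ?_)
  rw [constW_of_two_le (by omega), mul_pow, mul_pow, mul_pow, Real.sq_sqrt (by norm_num),
    show 2 * (τ + 1) - 2 = 2 * τ by omega, ← pow_mul, ← pow_mul, ← pow_mul]
  ring

/-! ### Walsh coefficients of the kernel -/

/-- Lebesgue measure on `[0,1)`, as a measure on the real line. -/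
noncomputable def unitMeasure : Measure ℝ := volume.restrict (Set.Ico 0 1)

instance : IsProbabilityMeasure unitMeasure := ⟨by simp [unitMeasure]⟩

theorem integral_unitMeasure {E : Type*} [NormedAddCommGroup E] [NormedSpace ℝ E] (f : ℝ → E) :
    ∫ x, f x ∂unitMeasure = ∫ x in (0 : ℝ)..1, f x := by
  rw [unitMeasure, intervalIntegral.integral_of_le zero_le_one, integral_Ico_eq_integral_Ioc]

theorem ae_unitMeasure_mem : ∀ᵐ x ∂unitMeasure, x ∈ Set.Ico (0 : ℝ) 1 :=
  ae_restrict_mem measurableSet_Ico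

/-- The diagonal Walsh coefficient of a kernel. -/
noncomputable def walCoeff (K : ℝ → ℝ → ℂ) (k : ℕ →₀ ZMod b) : ℂ :=
  ∫ z : ℝ × ℝ, K z.1 z.2 * (wal (-k) z.1 * wal k z.2) ∂(unitMeasure.prod unitMeasure)

theorem walCoeff_mul (f g : ℝ → ℂ) (k : ℕ →₀ ZMod b) :
    walCoeff (fun x y => f x * g y) k = walT f (-k) * walT g k := by
  have h := integral_prod_mul (μ := unitMeasure) (ν := unitMeasure)
    (fun x => wal (-k) x * f x) fun y => wal k y * g y
  rw [integral_unitMeasure, integral_unitMeasure] at h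
  rw [walCoeff, walT, walT]
  simp only [smul_eq_mul]
  rw [← h]
  refine integral_congr_ae (Filter.Eventually.of_forall fun z => ?_)
  simp only
  ring

theorem ae_prod_mem : ∀ᵐ z : ℝ × ℝ ∂(unitMeasure.prod unitMeasure),
    z.1 ∈ Set.Ico (0 : ℝ) 1 ∧ z.2 ∈ Set.Ico (0 : ℝ) 1 := by
  have h1 := Measure.ae_prod_mem_iff_ae_ae_mem (μ := unitMeasure) (ν := unitMeasure)
    (s := Set.Ico (0 : ℝ) 1 ×ˢ Set.Ico (0 : ℝ) 1) (measurableSet_Ico.prod measurableSet_Ico)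
  exact h1.2 (by
    filter_upwards [ae_unitMeasure_mem] with x hx
    filter_upwards [ae_unitMeasure_mem] with y hy
    exact ⟨hx, hy⟩)

theorem integrable_walCoeff_of_bound {K : ℝ → ℝ → ℂ} {C : ℝ}
    (hK : Measurable fun z : ℝ × ℝ => K z.1 z.2)
    (hC : ∀ x ∈ Set.Ico (0 : ℝ) 1, ∀ y ∈ Set.Ico (0 : ℝ) 1, ‖K x y‖ ≤ C) (k : ℕ →₀ ZMod b) :
    Integrable (fun z : ℝ × ℝ => K z.1 z.2 * (wal (-k) z.1 * wal k z.2))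
      (unitMeasure.prod unitMeasure) := by
  refine Integrable.of_bound (C := C) (hK.mul (((measurable_wal (-k)).comp measurable_fst).mul
    ((measurable_wal k).comp measurable_snd))).aestronglyMeasurable ?_
  filter_upwards [ae_prod_mem] with z hz
  rw [norm_mul, norm_mul, norm_wal, norm_wal, mul_one, mul_one]
  exact hC _ hz.1 _ hz.2

theorem walT_trig_neg (h : ℤ) (k : ℕ →₀ ZMod b) :
    walT (trig (-h)) (-k) = (starRingEnd ℂ) (walT (trig h) k) := by
  have hi := intervalIntegrable_bdd_smul (measurable_wal k) (fun x => (norm_wal k x).le)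
    (continuous_trig h) 0 1
  have h1 := Complex.conjCLE.toContinuousLinearMap.intervalIntegral_comp_comm hi
  have h2 : (starRingEnd ℂ) (walT (trig h) k) =
      Complex.conjCLE.toContinuousLinearMap (∫ x in (0 : ℝ)..1, wal k x • trig h x) := rfl
  rw [h2, ← h1, walT]
  refine intervalIntegral.integral_congr fun x _ => ?_
  simp [wal_neg, trig_neg]

theorem cos_eq_trig (n : ℕ) (x y : ℝ) : (Real.cos (2 * Real.pi * n * |x - y|) : ℂ) =
    1 / 2 * (trig n x * trig (-n) y + trig (-n) x * trig n y) := by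
  have h1 : Real.cos (2 * Real.pi * n * |x - y|) = Real.cos (2 * Real.pi * n * (x - y)) := by
    rcases abs_cases (x - y) with ⟨h, _⟩ | ⟨h, _⟩
    · rw [h]
    · rw [h, ← Real.cos_neg]; ring_nf
  rw [h1, Complex.ofReal_cos, Complex.cos, trig, trig, trig, trig, ← Complex.exp_add,
    ← Complex.exp_add, div_eq_inv_mul, one_div]
  congr 3 <;> · push_cast; ring_nf

/-- The periodic part `(-1)^(α+1) B_{2α}(|x-y|) / (2α)!` of the kernel. -/
noncomputable def kernelPer (α : ℕ) (x y : ℝ) : ℝ :=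
  (-1 : ℝ) ^ (α + 1) * bernoulliFun (2 * α) |x - y| / ((2 * α)! : ℝ)

theorem continuous_kernelPer (α : ℕ) : Continuous fun z : ℝ × ℝ => kernelPer α z.1 z.2 := by
  have := continuous_bernoulliFun (2 * α)
  unfold kernelPer
  fun_prop

theorem continuous_kernelOne (α : ℕ) : Continuous fun z : ℝ × ℝ => kernelOne α z.1 z.2 := by
  have := fun r => continuous_bernoulliFun r
  unfold kernelOne
  fun_prop

theorem kernelOne_eq (α : ℕ) (x y : ℝ) : (kernelOne α x y : ℂ) =
    (∑ r ∈ Finset.Icc 1 α, bernoulliC r x * bernoulliC r y) + (kernelPer α x y : ℂ) := by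
  rw [kernelOne, kernelPer, Complex.ofReal_add, Complex.ofReal_sum]
  congr 1
  refine Finset.sum_congr rfl fun r _ => ?_
  rw [bernoulliC, bernoulliC, ← Complex.ofReal_mul]
  congr 1
  ring

/-- The term `n = 0` is zero, being a quotient by zero. -/
theorem hasSum_kernelPer {α : ℕ} (hα : α ≠ 0) {x y : ℝ} (hx : x ∈ Set.Ico (0 : ℝ) 1)
    (hy : y ∈ Set.Ico (0 : ℝ) 1) :
    HasSum (fun n : ℕ => 2 / (2 * Real.pi * n) ^ (2 * α) * Real.cos (2 * Real.pi * n * |x - y|))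
      (kernelPer α x y) := by
  have hmem : |x - y| ∈ Set.Icc (0 : ℝ) 1 :=
    ⟨abs_nonneg _, abs_le.2 ⟨by linarith [hx.1, hy.2], by linarith [hx.2, hy.1]⟩⟩
  have h := (hasSum_one_div_nat_pow_mul_cos hα hmem).mul_left (2 / (2 * Real.pi) ^ (2 * α))
  have hpi : (2 * Real.pi) ^ (2 * α) ≠ 0 := by positivity
  have he : kernelPer α x y = 2 / (2 * Real.pi) ^ (2 * α) *
      ((-1 : ℝ) ^ (α + 1) * (2 * Real.pi) ^ (2 * α) / 2 / ((2 * α)! : ℝ) *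
        bernoulliFun (2 * α) |x - y|) := by
    unfold kernelPer
    field_simp
  have hf : (fun n : ℕ => 2 / (2 * Real.pi * n) ^ (2 * α) *
      Real.cos (2 * Real.pi * n * |x - y|)) = fun n : ℕ => 2 / (2 * Real.pi) ^ (2 * α) *
        (1 / (n : ℝ) ^ (2 * α) * Real.cos (2 * Real.pi * n * |x - y|)) := by
    funext n
    rw [mul_pow (2 * Real.pi)]
    ring
  rw [he, hf]
  exact h

/-- Integrated term by term, the cosine series of the kernel makes this coefficient the sum over `h
≠ 0` of `‖walT (trig h) k‖ ^ 2 / (2π|h|)^(2α)`. Its partial sums fall under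
`sum_normSq_walT_trig_le`. -/
theorem norm_walCoeff_kernelPer_le (hb : 1 < b) {α : ℕ} (hα : 1 ≤ α) {k : ℕ →₀ ZMod b}
    (hk : k ≠ 0) :
    ‖walCoeff (fun x y => (kernelPer α x y : ℂ)) k‖ ≤
      2 * constW (2 * α) b * ((b : ℝ)⁻¹) ^ (2 * muPer α k.support) := by
  set c : ℕ → ℝ := fun n => 2 / (2 * Real.pi * n) ^ (2 * α) with hc
  have hc0 : ∀ n, 0 ≤ c n := fun n => by simp only [hc]; positivity
  set G : ℕ → ℝ → ℝ → ℂ := fun n x y =>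
    ((c n * Real.cos (2 * Real.pi * n * |x - y|) : ℝ) : ℂ) with hG
  have hGm : ∀ n, Measurable fun z : ℝ × ℝ => G n z.1 z.2 := by
    intro n
    simp only [hG]
    fun_prop
  have hGb : ∀ n x y, ‖G n x y‖ ≤ c n := by
    intro n x y
    rw [Complex.norm_real, norm_mul, Real.norm_of_nonneg (hc0 n)]
    exact mul_le_of_le_one_right (hc0 n) (Real.abs_cos_le_one _)
  have hsummable : Summable c := by
    have h := (Real.summable_one_div_nat_pow (p := 2 * α)).2 (by omega)
    refine (h.mul_left (2 / (2 * Real.pi) ^ (2 * α))).congr fun n => ?_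
    simp only [hc]
    rw [mul_pow (2 * Real.pi)]
    ring
  have hinteg : ∀ n, Integrable (fun z : ℝ × ℝ => G n z.1 z.2 * (wal (-k) z.1 * wal k z.2))
      (unitMeasure.prod unitMeasure) := fun n =>
    integrable_walCoeff_of_bound (hGm n) (fun x _ y _ => hGb n x y) k
  have hnorm : Summable fun n => ∫ z : ℝ × ℝ, ‖G n z.1 z.2 * (wal (-k) z.1 * wal k z.2)‖
      ∂(unitMeasure.prod unitMeasure) := by
    refine Summable.of_nonneg_of_le (fun n => integral_nonneg fun z => norm_nonneg _)
      (fun n => ?_) hsummable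
    have h1 := integral_mono (hinteg n).norm (integrable_const (c n)) fun z => by
      change ‖G n z.1 z.2 * (wal (-k) z.1 * wal k z.2)‖ ≤ c n
      rw [norm_mul, norm_mul, norm_wal, norm_wal, mul_one, mul_one]
      exact hGb n z.1 z.2
    simpa using h1
  have hsum := hasSum_integral_of_summable_integral_norm hinteg hnorm
  have heq : ∫ z : ℝ × ℝ, ∑' n, G n z.1 z.2 * (wal (-k) z.1 * wal k z.2)
      ∂(unitMeasure.prod unitMeasure) = walCoeff (fun x y => (kernelPer α x y : ℂ)) k := by
    refine integral_congr_ae ?_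
    filter_upwards [ae_prod_mem] with z hz
    have h1 := hasSum_kernelPer (α := α) (by omega) hz.1 hz.2
    have h2 := (Complex.hasSum_ofReal.2 h1).mul_right (wal (-k) z.1 * wal k z.2)
    exact h2.tsum_eq
  rw [heq] at hsum
  have hterm : ∀ n : ℕ, ∫ z : ℝ × ℝ, G n z.1 z.2 * (wal (-k) z.1 * wal k z.2)
      ∂(unitMeasure.prod unitMeasure) =
      ((c n / 2 * (‖walT (trig n) k‖ ^ 2 + ‖walT (trig (-n)) k‖ ^ 2) : ℝ) : ℂ) := by
    intro n
    have h1 : ∀ f g : ℝ → ℂ, Continuous f → Continuous g → (∀ x, ‖f x‖ = 1) → (∀ x, ‖g x‖ = 1) →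
        Integrable (fun z : ℝ × ℝ => f z.1 * g z.2 * (wal (-k) z.1 * wal k z.2))
          (unitMeasure.prod unitMeasure) := by
      intro f g hf hg hf1 hg1
      refine integrable_walCoeff_of_bound (K := fun x y => f x * g y) (C := 1)
        ((hf.measurable.comp measurable_fst).mul (hg.measurable.comp measurable_snd))
        (fun x _ y _ => by rw [norm_mul, hf1, hg1, mul_one]) k
    have h2 := h1 (trig n) (trig (-n)) (continuous_trig _) (continuous_trig _) (norm_trig _)
      (norm_trig _)
    have h3 := h1 (trig (-n)) (trig n) (continuous_trig _) (continuous_trig _) (norm_trig _)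
      (norm_trig _)
    have h4 : ∀ z : ℝ × ℝ, G n z.1 z.2 * (wal (-k) z.1 * wal k z.2) = ((c n / 2 : ℝ) : ℂ) *
        (trig n z.1 * trig (-n) z.2 * (wal (-k) z.1 * wal k z.2) +
          trig (-n) z.1 * trig n z.2 * (wal (-k) z.1 * wal k z.2)) := by
      intro z
      simp only [hG]
      rw [Complex.ofReal_mul, cos_eq_trig]
      push_cast
      ring
    have h5 := walCoeff_mul (trig n) (trig (-n)) k
    have h6 := walCoeff_mul (trig (-n)) (trig n) k
    have h7 := walT_trig_neg n k
    have h8 := walT_trig_neg (-n) k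
    rw [neg_neg] at h8
    simp_rw [h4]
    rw [integral_const_mul, integral_add h2 h3]
    rw [walCoeff] at h5 h6
    rw [h5, h6, h7, h8, mul_comm ((starRingEnd ℂ) _), mul_comm ((starRingEnd ℂ) _),
      Complex.mul_conj', Complex.mul_conj']
    push_cast
    ring
  refine le_of_tendsto' hsum.tendsto_sum_nat.norm fun N => ?_
  rw [Finset.sum_congr rfl fun n _ => hterm n, ← Complex.ofReal_sum, Complex.norm_real,
    Real.norm_of_nonneg (Finset.sum_nonneg fun n _ => by have := hc0 n; positivity)]
  -- A partial sum in `n` uses the frequencies `n` and `-n` with `1 ≤ n < N`, two disjoint sets that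
  -- avoid zero.
  set S := Finset.Ico 1 N
  set e1 : ℕ ↪ ℤ := ⟨fun n => (n : ℤ), Nat.cast_injective⟩
  set e2 : ℕ ↪ ℤ := ⟨fun n => -(n : ℤ), fun a b h => by simpa using h⟩
  have hdisj : Disjoint (S.map e1) (S.map e2) := by
    rw [Finset.disjoint_left]
    intro h h1 h2
    obtain ⟨n, hn, rfl⟩ := Finset.mem_map.1 h1
    obtain ⟨m, hm, hmn⟩ := Finset.mem_map.1 h2
    have := (Finset.mem_Ico.1 hn).1
    have := (Finset.mem_Ico.1 hm).1
    have hmn' : -(m : ℤ) = n := hmn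
    omega
  have hH : (0 : ℤ) ∉ (S.map e1).disjUnion (S.map e2) hdisj := by
    rw [Finset.mem_disjUnion]
    rintro (h | h)
    · obtain ⟨n, hn, h0⟩ := Finset.mem_map.1 h
      have := (Finset.mem_Ico.1 hn).1
      have h0' : (n : ℤ) = 0 := h0
      omega
    · obtain ⟨n, hn, h0⟩ := Finset.mem_map.1 h
      have := (Finset.mem_Ico.1 hn).1
      have h0' : -(n : ℤ) = 0 := h0
      omega
  refine le_trans (le_of_eq ?_) (sum_normSq_walT_trig_le hb hH hα hk)
  rw [Finset.sum_disjUnion, Finset.sum_map, Finset.sum_map, ← Finset.sum_add_distrib]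
  have h0 : ∀ n ∈ Finset.range N, n ∉ S →
      c n / 2 * (‖walT (trig n) k‖ ^ 2 + ‖walT (trig (-n)) k‖ ^ 2) = 0 := by
    intro n hn hnS
    have : n = 0 := by
      have := Finset.mem_range.1 hn
      by_contra h
      exact hnS (Finset.mem_Ico.2 ⟨by omega, this⟩)
    have hα2 : 2 * α ≠ 0 := by omega
    simp [hc, this, hα2]
  rw [← Finset.sum_subset (fun n hn => Finset.mem_range.2 (Finset.mem_Ico.1 hn).2) h0]
  refine Finset.sum_congr rfl fun n _ => ?_
  rw [show e1 n = (n : ℤ) from rfl, show e2 n = -(n : ℤ) from rfl]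
  simp only [hc]
  push_cast
  rw [abs_neg, abs_of_nonneg (Nat.cast_nonneg n : (0 : ℝ) ≤ n)]
  ring

theorem exists_bound_of_continuous {K : ℝ → ℝ → ℝ} (hK : Continuous fun z : ℝ × ℝ => K z.1 z.2) :
    ∃ C, ∀ x ∈ Set.Icc (0 : ℝ) 1, ∀ y ∈ Set.Icc (0 : ℝ) 1, |K x y| ≤ C := by
  obtain ⟨C, hC⟩ := (isCompact_Icc (a := (0 : ℝ)) (b := 1)).prod
    (isCompact_Icc (a := (0 : ℝ)) (b := 1)) |>.exists_bound_of_continuousOn hK.continuousOn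
  exact ⟨C, fun x hx y hy => hC (x, y) ⟨hx, hy⟩⟩

theorem walCoeff_kernelOne (α : ℕ) (k : ℕ →₀ ZMod b) :
    walCoeff (fun x y => (kernelOne α x y : ℂ)) k =
      (∑ r ∈ Finset.Icc 1 α, walT (bernoulliC r) (-k) * walT (bernoulliC r) k) +
        walCoeff (fun x y => (kernelPer α x y : ℂ)) k := by
  have hB : ∀ r, Integrable (fun z : ℝ × ℝ => bernoulliC r z.1 * bernoulliC r z.2 *
      (wal (-k) z.1 * wal k z.2)) (unitMeasure.prod unitMeasure) := by
    intro r
    have hm := (continuous_bernoulliC r).measurable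
    obtain ⟨C, hC⟩ := exists_bound_of_continuous (K := fun x y =>
      bernoulliFun r x / (r ! : ℝ) * (bernoulliFun r y / (r ! : ℝ)))
      (by have := continuous_bernoulliFun r; fun_prop)
    refine integrable_walCoeff_of_bound (K := fun x y => bernoulliC r x * bernoulliC r y) (C := C)
      ((hm.comp measurable_fst).mul (hm.comp measurable_snd)) (fun x hx y hy => ?_) k
    rw [bernoulliC, bernoulliC, ← Complex.ofReal_mul, Complex.norm_real]
    exact hC x (Set.Ico_subset_Icc_self hx) y (Set.Ico_subset_Icc_self hy)
  have hP : Integrable (fun z : ℝ × ℝ => (kernelPer α z.1 z.2 : ℂ) *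
      (wal (-k) z.1 * wal k z.2)) (unitMeasure.prod unitMeasure) := by
    obtain ⟨C, hC⟩ := exists_bound_of_continuous (continuous_kernelPer α)
    refine integrable_walCoeff_of_bound (K := fun x y => (kernelPer α x y : ℂ)) (C := C)
      (Complex.measurable_ofReal.comp (continuous_kernelPer α).measurable) (fun x hx y hy => ?_) k
    rw [Complex.norm_real]
    exact hC x (Set.Ico_subset_Icc_self hx) y (Set.Ico_subset_Icc_self hy)
  simp only [← walCoeff_mul]
  simp only [walCoeff]
  rw [← integral_finsetSum _ fun r _ => hB r,
    ← integral_add (integrable_finsetSum _ fun r _ => hB r) hP]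
  refine integral_congr_ae (Filter.Eventually.of_forall fun z => ?_)
  simp only [kernelOne_eq]
  rw [add_mul, Finset.sum_mul]

theorem bddAbove_constD (α b : ℕ) : BddAbove ((fun v : ℕ => (∑ τ ∈ Finset.Icc v α,
    constW τ b ^ 2 / (b : ℝ) ^ (2 * (τ - v))) + 2 * constW (2 * α) b /
      (b : ℝ) ^ (2 * (α - v))) '' Set.Icc 1 α) :=
  ((Set.finite_Icc 1 α).image _).bddAbove

/-- Decay of the diagonal Walsh coefficients of the kernel. -/
theorem norm_walCoeff_kernelOne_le (hb : 1 < b) {α : ℕ} (hα : 1 ≤ α) {k : ℕ →₀ ZMod b}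
    (hk : k ≠ 0) :
    ‖walCoeff (fun x y => (kernelOne α x y : ℂ)) k‖ ≤
      constD α b * ((b : ℝ)⁻¹) ^ (2 * mu α k.support) := by
  have hb1 : (1 : ℝ) < b := by exact_mod_cast hb
  set S := k.support with hS
  have hSne := Finsupp.support_nonempty_iff.2 hk
  set x : ℝ := (b : ℝ)⁻¹ with hx
  have hx0 : 0 < x := by positivity
  have hx1 : x ≤ 1 := (inv_lt_one_of_one_lt₀ hb1).le
  have hdiv : ∀ (c : ℝ) (n : ℕ), c / (b : ℝ) ^ n = c * x ^ n := fun c n => by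
    rw [hx, inv_pow, div_eq_mul_inv]
  have hcard : 1 ≤ S.card := Finset.card_pos.2 hSne
  -- The number of digits of `k`, cut off at `α`, selects the candidate in the maximum `constD`.
  -- Bernoulli terms of degree below the number of digits vanish.
  set v := min S.card α with hv
  have hv1 : v ∈ Set.Icc 1 α := ⟨by omega, by omega⟩
  have hD := le_csSup (bddAbove_constD α b) (Set.mem_image_of_mem _ hv1)
  refine le_trans ?_ (mul_le_mul_of_nonneg_right hD (by positivity))
  rw [walCoeff_kernelOne, add_mul]
  have hk' : -k ≠ 0 := neg_ne_zero.2 hk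
  refine (norm_add_le _ _).trans (add_le_add ?_ ?_)
  · refine (norm_sum_le _ _).trans ?_
    rw [Finset.sum_mul]
    have hsub : Finset.Icc v α ⊆ Finset.Icc 1 α := Finset.Icc_subset_Icc_left hv1.1
    rw [← Finset.sum_subset hsub]
    · refine Finset.sum_le_sum fun τ hτ => ?_
      have hτ' := Finset.mem_Icc.1 hτ
      have hc := constW_nonneg (b := b) (hv1.1.trans hτ'.1)
      rcases le_or_gt S.card τ with hle | hgt
      · have h1 := norm_walT_bernoulliC_le hb (hv1.1.trans hτ'.1) hk
        have h2 := norm_walT_bernoulliC_le hb (hv1.1.trans hτ'.1) hk'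
        rw [Finsupp.support_neg] at h2
        rw [← hx] at h1 h2
        change _ ≤ constW τ b * x ^ muPer τ S at h1 h2
        -- The degree is at least the number of digits, so `mu τ` and `mu α` agree and the repeated
        -- positions supply the surplus `τ - v`.
        have h3 := mu_add_sub_card_le_muPer (S := S) τ hSne
        rw [← mu_of_card_le hle hτ'.2] at h3
        rw [norm_mul, hdiv]
        calc _ ≤ (constW τ b * x ^ muPer τ S) * (constW τ b * x ^ muPer τ S) :=
              mul_le_mul h2 h1 (norm_nonneg _) (by positivity)
          _ = constW τ b ^ 2 * x ^ (2 * muPer τ S) := by rw [two_mul, pow_add]; ring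
          _ ≤ constW τ b ^ 2 * x ^ (2 * (τ - v) + 2 * mu α S) := by
              refine mul_le_mul_of_nonneg_left (pow_le_pow_of_le_one hx0.le hx1 ?_) (by positivity)
              omega
          _ = _ := by rw [pow_add]; ring
      · rw [walT_bernoulliC_eq_zero hb hgt, mul_zero, norm_zero]
        positivity
    · intro τ hτ hτ'
      have h1 := Finset.mem_Icc.1 hτ
      have hlt : τ < S.card := by
        by_contra h
        exact hτ' (Finset.mem_Icc.2 ⟨by omega, h1.2⟩)
      rw [walT_bernoulliC_eq_zero hb hlt, mul_zero, norm_zero]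
  · refine (norm_walCoeff_kernelPer_le hb hα hk).trans ?_
    have h3 := mu_add_sub_card_le_muPer (S := S) α hSne
    have hc := constW_nonneg (b := b) (τ := 2 * α) (by omega)
    change 2 * constW (2 * α) b * x ^ (2 * muPer α S) ≤ _
    rw [hdiv, mul_assoc _ (x ^ _), ← pow_add]
    refine mul_le_mul_of_nonneg_left (pow_le_pow_of_le_one hx0.le hx1 ?_) (by positivity)
    omega

end Coefficients

/-! ### The worst-case error in the weighted Sobolev space -/

theorem integral_unitInterval {E : Type*} [NormedAddCommGroup E] [NormedSpace ℝ E] (f : ℝ → E) :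
    ∫ x : Set.Ico (0 : ℝ) 1, f x = ∫ x in (0 : ℝ)..1, f x := by
  rw [← integral_unitMeasure]
  exact integral_subtype_comap measurableSet_Ico f

/-- Reflecting `y ↦ x - y` on `[0, x]`, and `y ↦ 1 + x - y` together with the symmetry of `B_(2α)`
on `[x, 1]`, removes the shift by `x`. What is left is the mean of a Bernoulli polynomial of
positive degree. -/
theorem integral_kernelPer {α : ℕ} (hα : α ≠ 0) (x : ℝ) (hx : x ∈ Set.Ico (0 : ℝ) 1) :
    ∫ y in (0 : ℝ)..1, kernelPer α y x = 0 := by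
  have hc : ∀ u v, IntervalIntegrable (fun y => bernoulliFun (2 * α) |y - x|) volume u v :=
    fun u v => ((continuous_bernoulliFun (2 * α)).comp
      ((continuous_id.sub continuous_const).abs)).intervalIntegrable u v
  have hi : ∀ u v, IntervalIntegrable (bernoulliFun (2 * α)) volume u v :=
    intervalIntegrable_bernoulliFun _
  have h1 : ∫ y in (0 : ℝ)..x, bernoulliFun (2 * α) |y - x| =
      ∫ y in (0 : ℝ)..x, bernoulliFun (2 * α) y := by
    have : ∫ y in (0 : ℝ)..x, bernoulliFun (2 * α) |y - x| =
        ∫ y in (0 : ℝ)..x, bernoulliFun (2 * α) (x - y) := by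
      refine intervalIntegral.integral_congr fun y hy => ?_
      rw [Set.uIcc_of_le hx.1] at hy
      rw [abs_of_nonpos (by linarith [hy.2]), neg_sub]
    rw [this, intervalIntegral.integral_comp_sub_left (fun y => bernoulliFun (2 * α) y) x]
    simp
  have h2 : ∫ y in x..(1 : ℝ), bernoulliFun (2 * α) |y - x| =
      ∫ y in x..(1 : ℝ), bernoulliFun (2 * α) y := by
    have : ∫ y in x..(1 : ℝ), bernoulliFun (2 * α) |y - x| =
        ∫ y in x..(1 : ℝ), bernoulliFun (2 * α) ((1 + x) - y) := by
      refine intervalIntegral.integral_congr fun y hy => ?_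
      rw [Set.uIcc_of_le hx.2.le] at hy
      rw [abs_of_nonneg (by linarith [hy.1]), show 1 + x - y = 1 - (y - x) by ring,
        bernoulliFun_eval_one_sub, pow_mul]
      simp
    rw [this, intervalIntegral.integral_comp_sub_left (fun y => bernoulliFun (2 * α) y) (1 + x)]
    simp
  simp only [kernelPer]
  rw [intervalIntegral.integral_div, intervalIntegral.integral_const_mul,
    ← intervalIntegral.integral_add_adjacent_intervals (hc 0 x) (hc x 1), h1, h2,
    intervalIntegral.integral_add_adjacent_intervals (hi 0 x) (hi x 1),
    integral_bernoulliFun_eq_zero (by omega)]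
  simp

theorem integral_kernelOne {α : ℕ} (hα : α ≠ 0) (x : ℝ) (hx : x ∈ Set.Ico (0 : ℝ) 1) :
    ∫ y in (0 : ℝ)..1, kernelOne α y x = 0 := by
  have hB : ∀ r, IntervalIntegrable (fun y => bernoulliFun r y * bernoulliFun r x / ((r ! : ℝ) ^ 2))
      volume 0 1 := fun r =>
    (((continuous_bernoulliFun r).mul continuous_const).div_const _).intervalIntegrable 0 1
  have hP : IntervalIntegrable (fun y => kernelPer α y x) volume 0 1 :=
    ((continuous_kernelPer α).comp (by fun_prop : Continuous fun y : ℝ => (y, x))).intervalIntegrable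
      0 1
  have hS : IntervalIntegrable (fun y => ∑ r ∈ Finset.Icc 1 α,
      bernoulliFun r y * bernoulliFun r x / ((r ! : ℝ) ^ 2)) volume 0 1 := by
    simpa only [Finset.sum_fn] using IntervalIntegrable.sum (Finset.Icc 1 α) fun r _ => hB r
  have he : ∀ y, kernelOne α y x = (∑ r ∈ Finset.Icc 1 α,
      bernoulliFun r y * bernoulliFun r x / ((r ! : ℝ) ^ 2)) + kernelPer α y x := fun y => rfl
  simp_rw [he]
  rw [intervalIntegral.integral_add hS hP, integral_kernelPer hα x hx, add_zero,
    intervalIntegral.integral_finsetSum fun r _ => hB r]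
  refine Finset.sum_eq_zero fun r hr => ?_
  rw [intervalIntegral.integral_div, intervalIntegral.integral_mul_const,
    integral_bernoulliFun_eq_zero (by have := (Finset.mem_Icc.1 hr).1; omega)]
  simp

theorem continuous_sobolevKernel {s : ℕ} (α : ℕ) (γ : Finset (Fin s) → ℝ≥0) :
    Continuous fun z : UnitCube s × UnitCube s => sobolevKernel α γ z.1 z.2 := by
  unfold sobolevKernel
  refine continuous_finsetSum _ fun u _ => continuous_const.mul
    (continuous_finsetProd _ fun j _ => ?_)
  exact (continuous_kernelOne α).comp (by fun_prop : Continuous fun z : UnitCube s × UnitCube s =>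
    (((z.1 j : ℝ), (z.2 j : ℝ)) : ℝ × ℝ))

theorem exists_bound_sobolevKernel {s : ℕ} (α : ℕ) (γ : Finset (Fin s) → ℝ≥0) :
    ∃ C, ∀ x y : UnitCube s, |sobolevKernel α γ x y| ≤ C := by
  obtain ⟨C, hC⟩ := exists_bound_of_continuous (continuous_kernelOne α)
  refine ⟨∑ u : Finset (Fin s), (γ u : ℝ) * ∏ _j ∈ u, C, fun x y => ?_⟩
  refine (Finset.abs_sum_le_sum_abs _ _).trans (Finset.sum_le_sum fun u _ => ?_)
  rw [abs_mul, abs_of_nonneg (γ u).coe_nonneg, Finset.abs_prod]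
  refine mul_le_mul_of_nonneg_left (Finset.prod_le_prod (fun j _ => abs_nonneg _) fun j _ => ?_)
    (γ u).coe_nonneg
  exact hC _ (Set.Ico_subset_Icc_self (x j).2) _ (Set.Ico_subset_Icc_self (y j).2)

theorem integral_prod_unitCube {s : ℕ} {𝕜 : Type*} [RCLike 𝕜] (u : Finset (Fin s))
    (f : Fin s → Set.Ico (0 : ℝ) 1 → 𝕜) :
    ∫ x : UnitCube s, ∏ j ∈ u, f j (x j) = ∏ j ∈ u, ∫ x : Set.Ico (0 : ℝ) 1, f j x := by
  have h := integral_fintype_prod_volume_eq_prod (𝕜 := 𝕜)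
    (E := fun _ : Fin s => Set.Ico (0 : ℝ) 1) fun j x => if j ∈ u then f j x else 1
  simp only [Finset.prod_ite_mem, Finset.univ_inter] at h
  rw [h, ← Finset.prod_subset (Finset.subset_univ u)]
  · exact Finset.prod_congr rfl fun j hj => by simp [hj]
  · intro j _ hj
    simp [hj]

/-- Every product over a nonempty `u` contains a factor of mean zero, so only the constant term is
left. -/
theorem integral_sobolevKernel {s α : ℕ} (hα : α ≠ 0) (γ : Finset (Fin s) → ℝ≥0)
    (x : UnitCube s) : ∫ y : UnitCube s, sobolevKernel α γ y x = γ ∅ := by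
  have hi : ∀ u : Finset (Fin s), Integrable fun y : UnitCube s =>
      (γ u : ℝ) * ∏ j ∈ u, kernelOne α (y j) (x j) := by
    intro u
    obtain ⟨C, hC⟩ := exists_bound_of_continuous (continuous_kernelOne α)
    refine Integrable.const_mul ?_ _
    refine Integrable.of_bound (C := ∏ _j ∈ u, C) ?_ (Filter.Eventually.of_forall fun y => ?_)
    · refine Continuous.aestronglyMeasurable (continuous_finsetProd _ fun j _ => ?_)
      exact (continuous_kernelOne α).comp (by fun_prop : Continuous fun y : UnitCube s =>
        (((y j : ℝ), (x j : ℝ)) : ℝ × ℝ))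
    · rw [Real.norm_eq_abs, Finset.abs_prod]
      exact Finset.prod_le_prod (fun j _ => abs_nonneg _) fun j _ =>
        hC _ (Set.Ico_subset_Icc_self (y j).2) _ (Set.Ico_subset_Icc_self (x j).2)
  simp only [sobolevKernel]
  rw [integral_finsetSum _ fun u _ => hi u, Finset.sum_eq_single ∅]
  · simp
  · intro u _ hu
    obtain ⟨j, hj⟩ := Finset.nonempty_iff_ne_empty.2 hu
    rw [integral_const_mul,
      integral_prod_unitCube u fun j (y : Set.Ico (0 : ℝ) 1) => kernelOne α (y : ℝ) (x j),
      Finset.prod_eq_zero hj, mul_zero]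
    rw [integral_unitInterval fun y : ℝ => kernelOne α y (x j)]
    exact integral_kernelOne hα _ (x j).2
  · simp

/-! ### The representer of the integration error -/

section RKHS

/-- The elements of a reproducing kernel Hilbert space are measurable if the kernel functions
are. -/
theorem measurable_of_measurable_kerFun {X H : Type*} [MeasurableSpace X] [NormedAddCommGroup H]
    [InnerProductSpace ℝ H] [CompleteSpace H] [RKHS ℝ H X ℝ]
    (hK : ∀ (y : X) (v : ℝ), Measurable fun x => RKHS.kerFun H y v x) (f : H) :
    Measurable fun x => f x := by
  have hspan : ∀ g ∈ Submodule.span ℝ {RKHS.kerFun H x v | (x) (v)}, Measurable fun x => g x := by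
    intro g hg
    induction hg using Submodule.span_induction with
    | mem g hg =>
      obtain ⟨y, v, rfl⟩ := hg
      exact hK y v
    | zero =>
      rw [RKHS.coe_zero]
      exact measurable_const
    | add f g _ _ hf hg =>
      rw [RKHS.coe_add]
      exact hf.add hg
    | smul c f _ hf =>
      rw [RKHS.coe_smul]
      exact hf.const_smul c
  -- The kernel functions span a dense subspace and evaluations are continuous, so `f` is a
  -- pointwise limit of measurable functions.
  have hmem : f ∈ closure (Submodule.span ℝ {RKHS.kerFun H x v | (x) (v)} : Set H) := by
    rw [← Submodule.topologicalClosure_coe, RKHS.kerFun_dense]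
    trivial
  obtain ⟨g, hg, hlim⟩ := mem_closure_iff_seq_limit.1 hmem
  refine measurable_of_tendsto_metrizable (fun n => hspan (g n) (hg n)) ?_
  rw [tendsto_pi_nhds]
  intro x
  exact ((RKHS.continuous_eval x).tendsto f).comp hlim

variable {s α : ℕ} [NeZero α] (γ : Finset (Fin s) → ℝ≥0)

/-- The kernel function at `x`. -/
noncomputable def kerVec (x : UnitCube s) : WeightedSobolevSpace α γ :=
  RKHS.kerFun (WeightedSobolevSpace α γ) x (1 : ℝ)

theorem inner_kerVec (x : UnitCube s) (f : WeightedSobolevSpace α γ) :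
    inner ℝ (kerVec γ x) f = f x := by
  rw [kerVec, RKHS.kerFun_inner]
  simp

theorem kerFun_eval (x y : UnitCube s) (v : ℝ) :
    RKHS.kerFun (WeightedSobolevSpace α γ) y v x = sobolevKernel α γ x y * v := by
  rw [RKHS.kerFun_apply, RKHS.OfKernel.kernel_ofKernel]
  simp [sobolevKernelOp]

theorem kerVec_apply (x y : UnitCube s) :
    (kerVec γ y : WeightedSobolevSpace α γ) x = sobolevKernel α γ x y := by
  rw [kerVec, kerFun_eval, mul_one]

theorem measurable_kerFun (y : UnitCube s) (v : ℝ) :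
    Measurable fun x => RKHS.kerFun (WeightedSobolevSpace α γ) y v x := by
  have hy : Continuous fun x : UnitCube s => sobolevKernel α γ x y :=
    Continuous.comp (g := fun z : UnitCube s × UnitCube s => sobolevKernel α γ z.1 z.2)
      (f := fun x => (x, y)) (continuous_sobolevKernel α γ) (continuous_id.prodMk continuous_const)
  have h : (fun x => RKHS.kerFun (WeightedSobolevSpace α γ) y v x) =
      fun x => sobolevKernel α γ x y * v := funext fun x => kerFun_eval γ x y v
  rw [h]
  exact hy.measurable.mul_const v

theorem measurable_coe (f : WeightedSobolevSpace α γ) : Measurable fun x => f x :=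
  measurable_of_measurable_kerFun (H := WeightedSobolevSpace α γ) (measurable_kerFun γ) f

/-- By Cauchy-Schwarz with the kernel function at `x`, whose squared norm is `K(x,x)`. The uniform
bound makes integration a continuous functional. -/
theorem exists_norm_apply_le : ∃ C, 0 ≤ C ∧ ∀ (f : WeightedSobolevSpace α γ) (x : UnitCube s),
    ‖f x‖ ≤ C * ‖f‖ := by
  obtain ⟨C, hC⟩ := exists_bound_sobolevKernel α γ
  refine ⟨√C, Real.sqrt_nonneg _, fun f x => ?_⟩
  rw [← inner_kerVec γ x f]
  refine (norm_inner_le_norm _ _).trans (mul_le_mul_of_nonneg_right ?_ (norm_nonneg _))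
  refine Real.le_sqrt_of_sq_le ?_
  rw [← real_inner_self_eq_norm_sq, inner_kerVec, kerVec_apply]
  exact (le_abs_self _).trans (hC x x)

theorem integrable_coe (f : WeightedSobolevSpace α γ) : Integrable fun x => f x := by
  obtain ⟨C, -, hC⟩ := exists_norm_apply_le (α := α) γ
  exact Integrable.of_bound (measurable_coe γ f).aestronglyMeasurable (C * ‖f‖)
    (Filter.Eventually.of_forall (hC f))

/-- Integration as a continuous linear functional. -/
noncomputable def integralCLM : WeightedSobolevSpace α γ →L[ℝ] ℝ :=
  LinearMap.mkContinuous
    { toFun := fun f => ∫ x, f x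
      map_add' := fun f g => by
        simp only [RKHS.coe_add, Pi.add_apply]
        exact integral_add (integrable_coe γ f) (integrable_coe γ g)
      map_smul' := fun c f => by
        simp only [RKHS.coe_smul, Pi.smul_apply]
        exact integral_smul c fun x => f x }
    (exists_norm_apply_le (α := α) γ).choose fun f => by
      have h := norm_integral_le_of_norm_le_const (μ := volume) (f := fun x => f x)
        (Filter.Eventually.of_forall ((exists_norm_apply_le (α := α) γ).choose_spec.2 f))
      simpa using h

theorem integralCLM_apply (f : WeightedSobolevSpace α γ) : integralCLM γ f = ∫ x, f x := rfl

/-- The representer of integration. -/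
noncomputable def integralVec : WeightedSobolevSpace α γ :=
  (InnerProductSpace.toDual ℝ (WeightedSobolevSpace α γ)).symm (integralCLM γ)

theorem inner_integralVec (f : WeightedSobolevSpace α γ) :
    inner ℝ (integralVec γ) f = ∫ x, f x := by
  rw [integralVec, InnerProductSpace.toDual_symm_apply, integralCLM_apply]

/-- The representer of integration is a constant function, since all nonconstant parts of the kernel
have mean zero. -/
theorem integralVec_apply (x : UnitCube s) :
    (integralVec γ : WeightedSobolevSpace α γ) x = γ ∅ := by
  rw [← inner_kerVec, real_inner_comm, inner_integralVec]
  simp_rw [kerVec_apply]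
  exact integral_sobolevKernel (NeZero.ne α) γ x

theorem iSup_abs_inner {V : Type*} [NormedAddCommGroup V] [InnerProductSpace ℝ V] (g : V) :
    ⨆ (f : V) (_ : ‖f‖ ≤ 1), ENNReal.ofReal |inner ℝ g f| = ENNReal.ofReal ‖g‖ := by
  refine le_antisymm (iSup₂_le fun f hf => ENNReal.ofReal_le_ofReal ?_) ?_
  · exact (abs_real_inner_le_norm g f).trans (mul_le_of_le_one_right (norm_nonneg _) hf)
  · by_cases hg : g = 0
    · simp [hg]
    have hg' : ‖g‖ ≠ 0 := norm_ne_zero_iff.2 hg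
    refine le_iSup₂_of_le (‖g‖⁻¹ • g) ?_ (ENNReal.ofReal_le_ofReal ?_)
    · rw [norm_smul, norm_inv, norm_norm, inv_mul_cancel₀ hg']
    · rw [inner_smul_right, real_inner_self_eq_norm_sq]
      refine le_of_eq_of_le ?_ (le_abs_self _)
      field_simp

/-- The worst-case error in terms of the kernel. -/
theorem worstCaseError_sq {ι : Type*} [Fintype ι] [Nonempty ι] (P : ι → UnitCube s) :
    0 ≤ (Fintype.card ι : ℝ)⁻¹ ^ 2 * ∑ i, ∑ j, (sobolevKernel α γ (P i) (P j) - γ ∅) ∧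
      worstCaseError (WeightedSobolevSpace α γ) P ^ 2 =
        ENNReal.ofReal ((Fintype.card ι : ℝ)⁻¹ ^ 2 *
          ∑ i, ∑ j, (sobolevKernel α γ (P i) (P j) - γ ∅)) := by
  set N : ℝ := (Fintype.card ι : ℝ) with hN
  have hN0 : N ≠ 0 := by rw [hN]; exact_mod_cast Fintype.card_ne_zero
  -- The representer of the error functional; the worst-case error is its norm.
  set g : WeightedSobolevSpace α γ := N⁻¹ • (∑ i, kerVec γ (P i)) - integralVec γ with hg
  have h1 : ∀ f : WeightedSobolevSpace α γ, qmc P f - ∫ x : UnitCube s, f x = inner ℝ g f := by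
    intro f
    rw [hg, inner_sub_left, inner_integralVec, inner_smul_left, sum_inner]
    simp [qmc, inner_kerVec, hN]
  have h2 : ∑ i, g (P i) = N⁻¹ * ∑ i, ∑ j, (sobolevKernel α γ (P i) (P j) - γ ∅) := by
    rw [Finset.mul_sum]
    refine Finset.sum_congr rfl fun i _ => ?_
    rw [← inner_kerVec, hg, inner_sub_right, inner_smul_right, inner_sum, inner_kerVec,
      integralVec_apply, Finset.sum_sub_distrib, mul_sub]
    simp_rw [inner_kerVec, kerVec_apply]
    rw [Finset.sum_const, Finset.card_univ, nsmul_eq_mul, ← hN, inv_mul_cancel_left₀ hN0]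
  have h3 : ∫ x : UnitCube s, g x = 0 := by
    rw [← inner_integralVec, hg, inner_sub_right, inner_smul_right, inner_sum]
    simp_rw [inner_integralVec, kerVec_apply, integral_sobolevKernel (NeZero.ne α),
      integralVec_apply]
    rw [Finset.sum_const, Finset.card_univ, nsmul_eq_mul, ← hN, inv_mul_cancel_left₀ hN0]
    simp
  -- The squared norm is the integration error of `g` itself, and `g` has mean zero.
  have h4 : ‖g‖ ^ 2 = N⁻¹ ^ 2 * ∑ i, ∑ j, (sobolevKernel α γ (P i) (P j) - γ ∅) := by
    rw [← real_inner_self_eq_norm_sq, ← h1, h3, sub_zero, qmc, h2, sq, mul_assoc, hN]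
  refine ⟨h4 ▸ sq_nonneg _, ?_⟩
  rw [worstCaseError]
  simp_rw [h1]
  rw [iSup_abs_inner, ← ENNReal.ofReal_pow (norm_nonneg _), h4]

end RKHS

/-! ### Elementary intervals -/

section Cells

/-- The first `R` digits of `x`. -/
noncomputable def digitFun (b R : ℕ) (x : ℝ) : Fin R → ZMod b := fun i => digit b i x

/-- A digit vector as a finitely supported function. -/
noncomputable def extend {b R : ℕ} (k : Fin R → ZMod b) : ℕ →₀ ZMod b :=
  (Finsupp.equivFunOnFinite.symm k).embDomain Fin.valEmbedding

theorem extend_apply {b R : ℕ} (k : Fin R → ZMod b) (i : Fin R) : extend k i = k i := by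
  rw [extend, show (i : ℕ) = Fin.valEmbedding i from rfl, Finsupp.embDomain_apply_self]
  rfl

theorem mem_support_extend {b R : ℕ} {k : Fin R → ZMod b} {i : ℕ} :
    i ∈ (extend k).support ↔ ∃ j : Fin R, k j ≠ 0 ∧ (j : ℕ) = i := by
  rw [extend, Finsupp.support_embDomain, Finset.mem_map]
  simp

theorem extend_eq_zero {b R : ℕ} {k : Fin R → ZMod b} : extend k = 0 ↔ k = 0 := by
  constructor
  · intro h
    funext i
    rw [← extend_apply k i, h]
    rfl
  · rintro rfl
    ext i
    by_contra hi
    obtain ⟨j, hj, -⟩ := mem_support_extend.1 (Finsupp.mem_support_iff.2 hi)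
    exact hj rfl

/-- The elementary interval of points with first digits `w`. -/
def cell {b R : ℕ} (w : Fin R → ZMod b) : Set ℝ := {x | digitFun b R x = w}

theorem measurable_digitFun (b R : ℕ) : Measurable (digitFun b R) :=
  measurable_pi_lambda _ fun i => measurable_digit b i

theorem measurableSet_cell {b R : ℕ} (w : Fin R → ZMod b) : MeasurableSet (cell w) :=
  measurable_digitFun b R (measurableSet_singleton w)

/-- Additive characters map sums to products. -/
theorem addChar_sum {A M ι : Type*} [AddCommMonoid A] [CommMonoid M] (ψ : AddChar A M)
    (t : Finset ι) (f : ι → A) : ψ (∑ i ∈ t, f i) = ∏ i ∈ t, ψ (f i) := by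
  classical
  induction t using Finset.induction_on with
  | empty => simp
  | insert i t hi ih => rw [Finset.sum_insert hi, Finset.prod_insert hi, AddChar.map_add_eq_mul, ih]

variable {b : ℕ} [NeZero b]

theorem wal_extend {R : ℕ} (k : Fin R → ZMod b) (x : ℝ) :
    wal (extend k) x = ZMod.stdAddChar (∑ i, k i * digitFun b R x i) := by
  rw [wal, extend, Finsupp.sum_embDomain, Finsupp.sum_fintype _ _ (by simp)]
  rfl

/-- Orthogonality of characters. -/
theorem sum_stdAddChar_pi {ι : Type*} [Fintype ι] [DecidableEq ι] (z : ι → ZMod b) :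
    ∑ k : ι → ZMod b, (ZMod.stdAddChar (∑ i, k i * z i) : ℂ) =
      if z = 0 then (b : ℂ) ^ Fintype.card ι else 0 := by
  have h1 : ∀ k : ι → ZMod b, (ZMod.stdAddChar (∑ i, k i * z i) : ℂ) =
      ∏ i, ZMod.stdAddChar (k i * z i) := fun k => addChar_sum _ _ _
  simp_rw [h1]
  have h2 := Finset.prod_univ_sum (fun _ : ι => (Finset.univ : Finset (ZMod b)))
    fun i c => (ZMod.stdAddChar (c * z i) : ℂ)
  rw [Fintype.piFinset_univ] at h2
  rw [← h2]
  simp_rw [AddChar.sum_mulShift _ (ZMod.isPrimitive_stdAddChar b), ZMod.card]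
  split_ifs with hz
  · simp [hz]
  · obtain ⟨i, hi⟩ := Function.ne_iff.1 hz
    exact Finset.prod_eq_zero (Finset.mem_univ i) (by
      have hi' : z i ≠ 0 := hi
      rw [if_neg hi', Nat.cast_zero])

/-- The indicator of a cell is an average of Walsh functions with unimodular coefficients, and only
the index zero has a nonzero integral. -/
theorem measureReal_cell {R : ℕ} (w : Fin R → ZMod b) :
    unitMeasure.real (cell w) = ((b : ℝ)⁻¹) ^ R := by
  have hb : (b : ℂ) ≠ 0 := by exact_mod_cast NeZero.ne b
  have h1 : ∀ x, (cell w).indicator (fun _ => (1 : ℂ)) x = ((b : ℂ)⁻¹) ^ R *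
      ∑ k : Fin R → ZMod b, ZMod.stdAddChar (-∑ i, k i * w i) * wal (extend k) x := by
    intro x
    have h2 : ∀ k : Fin R → ZMod b, (ZMod.stdAddChar (-∑ i, k i * w i) : ℂ) * wal (extend k) x =
        ZMod.stdAddChar (∑ i, k i * (digitFun b R x - w) i) := by
      intro k
      rw [wal_extend, ← AddChar.map_add_eq_mul, neg_add_eq_sub, ← Finset.sum_sub_distrib]
      congr 1
      exact Finset.sum_congr rfl fun i _ => by rw [Pi.sub_apply]; ring
    simp_rw [h2]
    rw [sum_stdAddChar_pi, Fintype.card_fin]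
    by_cases hx : digitFun b R x = w
    · rw [Set.indicator_of_mem (show x ∈ cell w from hx), if_pos (sub_eq_zero.2 hx), inv_pow,
        inv_mul_cancel₀ (pow_ne_zero _ hb)]
    · rw [Set.indicator_of_notMem (show x ∉ cell w from hx), if_neg (sub_ne_zero.2 hx), mul_zero]
  have hi : ∀ k : Fin R → ZMod b, Integrable (fun x =>
      (ZMod.stdAddChar (-∑ i, k i * w i) : ℂ) * wal (extend k) x) unitMeasure := fun k =>
    (Integrable.of_bound (C := 1) (measurable_wal _).aestronglyMeasurable
      (Filter.Eventually.of_forall fun x => (norm_wal _ x).le)).const_mul _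
  have h3 : ∫ x, (cell w).indicator (fun _ => (1 : ℂ)) x ∂unitMeasure = ((b : ℂ)⁻¹) ^ R := by
    simp_rw [h1]
    rw [integral_const_mul, integral_finsetSum _ fun k _ => hi k, Finset.sum_eq_single 0]
    · rw [integral_const_mul, integral_unitMeasure]
      have h0 : extend (0 : Fin R → ZMod b) = 0 := extend_eq_zero.2 rfl
      simp [h0]
    · intro k _ hk
      have := walT_const (mt extend_eq_zero.1 hk) (1 : ℂ)
      simp only [walT, smul_eq_mul, mul_one] at this
      rw [integral_const_mul, integral_unitMeasure, this, mul_zero]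
    · simp
  rw [integral_indicator (measurableSet_cell w)] at h3
  simp only [integral_const, MeasurableSet.univ, measureReal_restrict_apply, Set.univ_inter,
    Complex.real_smul, mul_one] at h3
  apply Complex.ofReal_injective
  push_cast
  exact h3

theorem floor_eq_of_digitFun_eq {R : ℕ} {x y : ℝ} (hx : x ∈ Set.Ico (0 : ℝ) 1)
    (hy : y ∈ Set.Ico (0 : ℝ) 1) (h : digitFun b R x = digitFun b R y) :
    ⌊(b : ℝ) ^ R * x⌋ = ⌊(b : ℝ) ^ R * y⌋ := by
  have h' : ∀ i < R, digit b i x = digit b i y := fun i hi => congrFun h ⟨i, hi⟩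
  clear h
  induction R with
  | zero =>
    rw [pow_zero, one_mul, one_mul, Int.floor_eq_zero_iff.2 hx, Int.floor_eq_zero_iff.2 hy]
  | succ R ih =>
    have h1 := ih fun i hi => h' i (by omega)
    have h2 := h' R (by omega)
    have hz : ∀ z : ℝ, ⌊(b : ℝ) ^ (R + 1) * z⌋ =
        ((digit b R z).val : ℤ) + b * ⌊(b : ℝ) ^ R * z⌋ := by
      intro z
      rw [digit, ZMod.val_intCast, floor_eq_floor_mul_ediv b ((b : ℝ) ^ R * z), ← mul_assoc,
        ← pow_succ', Int.emod_add_mul_ediv]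
    rw [hz, hz, h1, h2]

theorem abs_sub_le_of_digitFun_eq {R : ℕ} {x y : ℝ} (hx : x ∈ Set.Ico (0 : ℝ) 1)
    (hy : y ∈ Set.Ico (0 : ℝ) 1) (h : digitFun b R x = digitFun b R y) :
    |x - y| ≤ ((b : ℝ)⁻¹) ^ R := by
  have hb : (0 : ℝ) < (b : ℝ) ^ R :=
    pow_pos (by exact_mod_cast Nat.pos_of_ne_zero (NeZero.ne b)) _
  have h1 := (Int.abs_sub_lt_one_of_floor_eq_floor (floor_eq_of_digitFun_eq hx hy h)).le
  rw [← mul_sub, abs_mul, abs_of_pos hb] at h1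
  rw [inv_pow, ← one_div, le_div_iff₀ hb]
  linarith

theorem integral_eq_sum_cell (R : ℕ) {f : ℝ → ℝ} (hf : Integrable f unitMeasure) :
    ∫ x, f x ∂unitMeasure = ∑ w : Fin R → ZMod b, ∫ x in cell w, f x ∂unitMeasure := by
  have h1 : ∀ x, f x = ∑ w : Fin R → ZMod b, (cell w).indicator f x := by
    intro x
    rw [Finset.sum_eq_single (digitFun b R x)]
    · exact (Set.indicator_of_mem (show x ∈ cell (digitFun b R x) from rfl) f).symm
    · intro w _ hw
      exact Set.indicator_of_notMem (s := cell w) (fun h => hw (Eq.symm h)) f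
    · simp
  rw [integral_congr_ae (Filter.Eventually.of_forall h1),
    integral_finsetSum _ fun w _ => hf.indicator (measurableSet_cell w)]
  exact Finset.sum_congr rfl fun w _ => integral_indicator (measurableSet_cell w)

theorem integrable_kernel_prod {K : ℝ → ℝ → ℝ} (hK : Continuous fun z : ℝ × ℝ => K z.1 z.2) :
    Integrable (fun z : ℝ × ℝ => K z.1 z.2) (unitMeasure.prod unitMeasure) := by
  obtain ⟨C, hC⟩ := exists_bound_of_continuous hK
  refine Integrable.of_bound (C := C) hK.aestronglyMeasurable ?_
  filter_upwards [ae_prod_mem] with z hz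
  exact hC _ (Set.Ico_subset_Icc_self hz.1) _ (Set.Ico_subset_Icc_self hz.2)

/-- Truncated Walsh series of a kernel are averages over elementary intervals. -/
theorem sum_walCoeff_eq {K : ℝ → ℝ → ℝ} (hK : Continuous fun z : ℝ × ℝ => K z.1 z.2) {R : ℕ}
    (z z' : Fin R → ZMod b) :
    ∑ k : Fin R → ZMod b, walCoeff (fun x y => (K x y : ℂ)) (extend k) *
        ZMod.stdAddChar (∑ i, k i * (z i - z' i)) =
      (((b : ℝ) ^ R * ∑ w : Fin R → ZMod b, ∫ p in cell (w + z) ×ˢ cell (w + z'), K p.1 p.2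
        ∂(unitMeasure.prod unitMeasure) : ℝ) : ℂ) := by
  have hKi := integrable_kernel_prod hK
  obtain ⟨C, hC⟩ := exists_bound_of_continuous hK
  have hi : ∀ k : Fin R → ZMod b, Integrable (fun p : ℝ × ℝ => (K p.1 p.2 : ℂ) *
      (wal (-extend k) p.1 * wal (extend k) p.2)) (unitMeasure.prod unitMeasure) := fun k =>
    integrable_walCoeff_of_bound (K := fun x y => (K x y : ℂ)) (C := C)
      (Complex.measurable_ofReal.comp hK.measurable)
      (fun x hx y hy => by
        rw [Complex.norm_real]
        exact hC x (Set.Ico_subset_Icc_self hx) y (Set.Ico_subset_Icc_self hy)) _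
  -- Summing the characters over all `k` selects the pairs whose digit vectors coincide after
  -- removing `z` and `z'`; the common value is the cell label `w`.
  have hpt : ∀ p : ℝ × ℝ, ∑ k : Fin R → ZMod b, (K p.1 p.2 : ℂ) *
      (wal (-extend k) p.1 * wal (extend k) p.2) * ZMod.stdAddChar (∑ i, k i * (z i - z' i)) =
      (((b : ℝ) ^ R * ∑ w : Fin R → ZMod b,
        (cell (w + z) ×ˢ cell (w + z')).indicator (fun p => K p.1 p.2) p : ℝ) : ℂ) := by
    intro p
    have h1 : ∀ k : Fin R → ZMod b, (K p.1 p.2 : ℂ) *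
        (wal (-extend k) p.1 * wal (extend k) p.2) *
          ZMod.stdAddChar (∑ i, k i * (z i - z' i)) = K p.1 p.2 *
        ZMod.stdAddChar (∑ i, k i * ((digitFun b R p.2 - z') - (digitFun b R p.1 - z)) i) := by
      intro k
      rw [wal_neg, wal_extend, wal_extend, ← AddChar.map_neg_eq_conj, mul_assoc,
        ← AddChar.map_add_eq_mul, ← AddChar.map_add_eq_mul, ← Finset.sum_neg_distrib,
        ← Finset.sum_add_distrib, ← Finset.sum_add_distrib]
      congr 2
      refine Finset.sum_congr rfl fun i _ => ?_
      simp only [Pi.sub_apply]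
      ring
    simp_rw [h1]
    rw [← Finset.mul_sum, sum_stdAddChar_pi, Fintype.card_fin]
    have h2 : ∑ w : Fin R → ZMod b,
        (cell (w + z) ×ˢ cell (w + z')).indicator (fun p => K p.1 p.2) p =
        if (digitFun b R p.2 - z') - (digitFun b R p.1 - z) = 0 then K p.1 p.2 else 0 := by
      split_ifs with h
      · have h' := sub_eq_zero.1 h
        rw [Finset.sum_eq_single (digitFun b R p.1 - z)]
        · have hp : p ∈ cell (digitFun b R p.1 - z + z) ×ˢ cell (digitFun b R p.1 - z + z') := by
            refine ⟨(sub_add_cancel (digitFun b R p.1) z).symm, ?_⟩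
            rw [← h']
            exact (sub_add_cancel (digitFun b R p.2) z').symm
          exact Set.indicator_of_mem hp _
        · intro w _ hw
          refine Set.indicator_of_notMem (fun hp => hw ?_) _
          have : digitFun b R p.1 = w + z := hp.1
          rw [this, add_sub_cancel_right]
        · simp
      · refine Finset.sum_eq_zero fun w _ => Set.indicator_of_notMem (fun hp => h ?_) _
        have e1 : digitFun b R p.1 = w + z := hp.1
        have e2 : digitFun b R p.2 = w + z' := hp.2
        rw [e1, e2, add_sub_cancel_right, add_sub_cancel_right, sub_self]
    rw [h2]
    split_ifs
    · push_cast
      ring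
    · simp
  simp only [walCoeff]
  simp_rw [← integral_mul_const]
  rw [← integral_finsetSum _ fun k _ => (hi k).mul_const _,
    integral_congr_ae (Filter.Eventually.of_forall hpt)]
  refine (integral_ofReal (𝕜 := ℂ)).trans (congrArg Complex.ofReal ?_)
  refine (integral_const_mul _ _).trans (congrArg _ ?_)
  rw [integral_finsetSum _ fun w _ => hKi.indicator
      ((measurableSet_cell (w + z)).prod (measurableSet_cell (w + z')))]
  refine Finset.sum_congr rfl fun w _ => ?_
  exact integral_indicator ((measurableSet_cell (w + z)).prod (measurableSet_cell (w + z')))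

theorem abs_setIntegral_sub_le {X : Type*} [MeasurableSpace X] {μ : Measure X}
    [IsFiniteMeasure μ] {S : Set X} (hS : MeasurableSet S) {f : X → ℝ} (hf : Integrable f μ)
    {c ε : ℝ} (h : ∀ᵐ x ∂μ, x ∈ S → |f x - c| ≤ ε) :
    |(∫ x in S, f x ∂μ) - c * μ.real S| ≤ ε * μ.real S := by
  have h1 : (∫ x in S, f x ∂μ) - c * μ.real S = ∫ x in S, (f x - c) ∂μ := by
    rw [integral_sub hf.integrableOn (integrable_const c), integral_const]
    simp [mul_comm]
  rw [h1, ← Real.norm_eq_abs]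
  exact norm_setIntegral_le_of_norm_le_const_ae (measure_lt_top μ S)
    ((ae_restrict_iff' hS).2 h)

theorem exists_mem_cell {R : ℕ} (w : Fin R → ZMod b) : ∃ x ∈ Set.Ico (0 : ℝ) 1, x ∈ cell w := by
  by_contra! h
  have h1 : unitMeasure.real (cell w) = 0 := by
    rw [measureReal_eq_zero_iff, unitMeasure, Measure.restrict_apply (measurableSet_cell w)]
    have : cell w ∩ Set.Ico (0 : ℝ) 1 = ∅ := by
      ext x
      simp only [Set.mem_inter_iff, Set.mem_empty_iff_false, iff_false, not_and]
      exact fun hx hx' => h x hx' hx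
    rw [this, measure_empty]
  rw [measureReal_cell] at h1
  have : (b : ℝ)⁻¹ ≠ 0 := inv_ne_zero (by exact_mod_cast NeZero.ne b)
  exact pow_ne_zero _ this h1

/-- The truncated Walsh series of the digital shift invariant kernel converge. -/
theorem tendsto_sum_walCoeff (hb : 1 < b) {K : ℝ → ℝ → ℝ}
    (hK : Continuous fun z : ℝ × ℝ => K z.1 z.2) {f f' : ℝ → ℝ} (hf : Measurable f)
    (hf' : Measurable f') (hfm : ∀ x, f x ∈ Set.Ico (0 : ℝ) 1)
    (hfm' : ∀ x, f' x ∈ Set.Ico (0 : ℝ) 1) {z z' : ℕ → ZMod b}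
    (hz : ∀ x ∈ Set.Ico (0 : ℝ) 1, ∀ i, digit b i (f x) = digit b i x + z i)
    (hz' : ∀ x ∈ Set.Ico (0 : ℝ) 1, ∀ i, digit b i (f' x) = digit b i x + z' i) :
    Filter.Tendsto (fun R : ℕ => ∑ k : Fin R → ZMod b,
      walCoeff (fun x y => (K x y : ℂ)) (extend k) *
        ZMod.stdAddChar (∑ i, k i * (z i - z' i))) Filter.atTop
      (nhds ((∫ x, K (f x) (f' x) ∂unitMeasure : ℝ) : ℂ)) := by
  have hb1 : (1 : ℝ) < b := by exact_mod_cast hb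
  have hx0 : (0 : ℝ) < (b : ℝ)⁻¹ := by positivity
  have hx1 : (b : ℝ)⁻¹ < 1 := inv_lt_one_of_one_lt₀ hb1
  have hKi := integrable_kernel_prod hK
  have hfi : Integrable (fun x => K (f x) (f' x)) unitMeasure := by
    obtain ⟨C, hC⟩ := exists_bound_of_continuous hK
    refine Integrable.of_bound (C := C)
      (hK.measurable.comp (hf.prodMk hf')).aestronglyMeasurable
      (Filter.Eventually.of_forall fun x => ?_)
    exact hC _ (Set.Ico_subset_Icc_self (hfm x)) _ (Set.Ico_subset_Icc_self (hfm' x))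
  rw [Metric.tendsto_atTop]
  intro ε hε
  have hunif := ((isCompact_Icc (a := (0 : ℝ)) (b := 1)).prod
    (isCompact_Icc (a := (0 : ℝ)) (b := 1))).uniformContinuousOn_of_continuous hK.continuousOn
  rw [Metric.uniformContinuousOn_iff] at hunif
  obtain ⟨δ, hδ, hδK⟩ := hunif (ε / 4) (by positivity)
  obtain ⟨R0, hR0⟩ := ((tendsto_pow_atTop_nhds_zero_of_lt_one hx0.le hx1).eventually
    (gt_mem_nhds hδ)).exists_forall_of_atTop
  refine ⟨R0, fun R hR => ?_⟩
  have hRδ := hR0 R hR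
  rw [sum_walCoeff_eq hK, dist_eq_norm, ← Complex.ofReal_sub, Complex.norm_real, Real.norm_eq_abs,
    integral_eq_sum_cell (b := b) R hfi, Finset.mul_sum, ← Finset.sum_sub_distrib]
  set zR : Fin R → ZMod b := fun i => z i
  set zR' : Fin R → ZMod b := fun i => z' i
  have hbx : (b : ℝ) ^ R * ((b : ℝ)⁻¹) ^ R = 1 := by
    rw [← mul_pow, mul_inv_cancel₀ (by linarith), one_pow]
  -- For `x` in `cell w` the two shifted points lie in the cells `w + z` and `w + z'`. Both
  -- integrals are thus within `ε / 4` times the cell length of one value of `K` times the cell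
  -- length. Uniform continuity suffices; the Walsh series need not converge absolutely.
  have hw : ∀ w : Fin R → ZMod b, |(b : ℝ) ^ R * (∫ p in cell (w + zR) ×ˢ cell (w + zR'),
      K p.1 p.2 ∂(unitMeasure.prod unitMeasure)) -
      ∫ x in cell w, K (f x) (f' x) ∂unitMeasure| ≤ ε / 2 * ((b : ℝ)⁻¹) ^ R := by
    intro w
    obtain ⟨x0, hx0m, hx0c⟩ := exists_mem_cell (w + zR)
    obtain ⟨y0, hy0m, hy0c⟩ := exists_mem_cell (w + zR')
    have hclose : ∀ x ∈ Set.Ico (0 : ℝ) 1, ∀ y ∈ Set.Ico (0 : ℝ) 1, x ∈ cell (w + zR) →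
        y ∈ cell (w + zR') → |K x y - K x0 y0| ≤ ε / 4 := by
      intro x hx y hy hxc hyc
      have h1 := abs_sub_le_of_digitFun_eq hx hx0m (Eq.trans hxc (Eq.symm hx0c))
      have h2 := abs_sub_le_of_digitFun_eq hy hy0m (Eq.trans hyc (Eq.symm hy0c))
      have h3 := hδK (x, y) ⟨Set.Ico_subset_Icc_self hx, Set.Ico_subset_Icc_self hy⟩ (x0, y0)
        ⟨Set.Ico_subset_Icc_self hx0m, Set.Ico_subset_Icc_self hy0m⟩ (by
          rw [Prod.dist_eq, Real.dist_eq, Real.dist_eq]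
          exact max_lt (h1.trans_lt hRδ) (h2.trans_lt hRδ))
      rw [Real.dist_eq] at h3
      exact h3.le
    have hA := abs_setIntegral_sub_le (c := K x0 y0) (ε := ε / 4)
      ((measurableSet_cell (w + zR)).prod (measurableSet_cell (w + zR'))) hKi (by
        filter_upwards [ae_prod_mem] with p hp hpc
        exact hclose _ hp.1 _ hp.2 hpc.1 hpc.2)
    have hB := abs_setIntegral_sub_le (c := K x0 y0) (ε := ε / 4) (measurableSet_cell w) hfi (by
      filter_upwards [ae_unitMeasure_mem] with x hx hxc
      refine hclose _ (hfm x) _ (hfm' x) ?_ ?_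
      · funext i
        have : digitFun b R x = w := hxc
        rw [digitFun, hz x hx, Pi.add_apply, ← this]
        rfl
      · funext i
        have : digitFun b R x = w := hxc
        rw [digitFun, hz' x hx, Pi.add_apply, ← this]
        rfl)
    rw [measureReal_cell] at hB
    rw [measureReal_prod_prod, measureReal_cell, measureReal_cell] at hA
    have hA' := mul_le_mul_of_nonneg_left hA (pow_nonneg (by linarith : (0 : ℝ) ≤ b) R)
    rw [← abs_of_nonneg (pow_nonneg (by linarith : (0 : ℝ) ≤ b) R), ← abs_mul,
      abs_of_nonneg (pow_nonneg (by linarith : (0 : ℝ) ≤ b) R)] at hA'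
    set Ia := ∫ p in cell (w + zR) ×ˢ cell (w + zR'), K p.1 p.2 ∂(unitMeasure.prod unitMeasure)
    set Ib := ∫ x in cell w, K (f x) (f' x) ∂unitMeasure
    set X := ((b : ℝ)⁻¹) ^ R
    have e1 : (b : ℝ) ^ R * (Ia - K x0 y0 * (X * X)) = (b : ℝ) ^ R * Ia - K x0 y0 * X := by
      linear_combination (-K x0 y0 * X) * hbx
    have e2 : (b : ℝ) ^ R * (ε / 4 * (X * X)) = ε / 4 * X := by
      linear_combination (ε / 4 * X) * hbx
    rw [e1, e2] at hA'
    rw [abs_le] at hA' hB ⊢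
    constructor <;> linarith [hA'.1, hA'.2, hB.1, hB.2]
  refine ((Finset.abs_sum_le_sum_abs _ _).trans (Finset.sum_le_sum fun w _ => hw w)).trans_lt ?_
  rw [Finset.sum_const, Finset.card_univ, Fintype.card_fun, ZMod.card, Fintype.card_fin,
    nsmul_eq_mul]
  push_cast
  have : (b : ℝ) ^ R * (ε / 2 * ((b : ℝ)⁻¹) ^ R) = ε / 2 := by
    linear_combination (ε / 2) * hbx
  rw [this]
  linarith

end Cells

/-! ### Counting points of linear codes in the Niederreiter-Rosenbloom-Tsfasman metric -/

section Counting

variable {J : Type*} [Fintype J]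

theorem exists_le_sum_eq [DecidableEq J] (c : J → ℕ) {K : ℕ} (hK : K ≤ ∑ j, c j) :
    ∃ p : J → ℕ, (∀ j, p j ≤ c j) ∧ ∑ j, p j = K := by
  induction K with
  | zero => exact ⟨fun _ => 0, fun j => Nat.zero_le _, by simp⟩
  | succ K ih =>
    obtain ⟨p, hp, hs⟩ := ih (by omega)
    obtain ⟨j, -, hj⟩ : ∃ j ∈ Finset.univ, p j < c j :=
      Finset.exists_lt_of_sum_lt (by rw [hs]; omega)
    refine ⟨p + Pi.single j 1, fun i => ?_, ?_⟩
    · by_cases hi : i = j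
      · subst hi
        simpa using hj
      · simpa [hi] using hp i
    · simp [Finset.sum_add_distrib, hs]

/-- The prescribed sum determines one coordinate from the others, hence the exponent `card J - 1`.
This becomes the exponent of `log N`. -/
theorem card_filter_sum_eq_le [DecidableEq J] [Nonempty J] (K : ℕ) :
    ((Fintype.piFinset fun _ : J => Finset.range (K + 1)).filter fun l => ∑ j, l j = K).card ≤
      (K + 1) ^ (Fintype.card J - 1) := by
  obtain ⟨j0⟩ := ‹Nonempty J›
  have h := Finset.card_le_card_of_injOn
    (s := (Fintype.piFinset fun _ : J => Finset.range (K + 1)).filter fun l => ∑ j, l j = K)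
    (t := Fintype.piFinset fun _ : {j // j ≠ j0} => Finset.range (K + 1))
    (fun l j => l j) ?_ ?_
  · refine h.trans_eq ?_
    rw [Fintype.card_piFinset]
    simp
  · intro l hl
    have h1 := (Finset.mem_filter.1 hl).1
    rw [Fintype.mem_piFinset] at h1
    exact Finset.mem_coe.2 (Fintype.mem_piFinset.2 fun j => h1 j)
  · intro l hl l' hl' he
    have h1 := (Finset.mem_filter.1 hl).2
    have h2 := (Finset.mem_filter.1 hl').2
    have h3 : ∀ j, j ≠ j0 → l j = l' j := fun j hj => congrFun he ⟨j, hj⟩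
    have h4 : l j0 = l' j0 := by
      rw [← Finset.add_sum_erase _ _ (Finset.mem_univ j0)] at h1 h2
      have : ∑ j ∈ Finset.univ.erase j0, l j = ∑ j ∈ Finset.univ.erase j0, l' j :=
        Finset.sum_congr rfl fun j hj => h3 j (Finset.ne_of_mem_erase hj)
      omega
    funext j
    by_cases hj : j = j0
    · rw [hj, h4]
    · exact h3 j hj

theorem sum_piFinset_range_pow_le [DecidableEq J] {x : ℝ} (hx : 0 ≤ x) (hx1 : x < 1) (R : ℕ) :
    ∑ e ∈ Fintype.piFinset fun _ : J => Finset.range R, x ^ (∑ j, e j) ≤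
      ((1 - x)⁻¹) ^ Fintype.card J := by
  simp_rw [← Finset.prod_pow_eq_pow_sum]
  have h := Finset.prod_univ_sum (fun _ : J => Finset.range R) fun _ i => x ^ i
  rw [← h, Finset.prod_const, Finset.card_univ]
  refine pow_le_pow_left₀ (Finset.sum_nonneg fun i _ => pow_nonneg hx i) ?_ _
  rw [← tsum_geometric_of_lt_one hx hx1]
  exact (summable_geometric_of_lt_one hx hx1).sum_le_tsum _ fun i _ => pow_nonneg hx i

/-- Tails of a multidimensional geometric series. -/
theorem sum_pow_sum_tail_le [DecidableEq J] [Nonempty J] {x : ℝ} (hx : 0 ≤ x) (hx1 : x < 1)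
    (K : ℕ) {T : Finset (J → ℕ)} (hT : ∀ l ∈ T, K ≤ ∑ j, l j) :
    ∑ l ∈ T, x ^ (∑ j, l j) ≤
      ((K : ℝ) + 1) ^ (Fintype.card J - 1) * x ^ K * ((1 - x)⁻¹) ^ Fintype.card J := by
  -- Each `l` is split as `p + (l - p)` with `p` of sum exactly `K`. The splitting is injective, so
  -- the tail is at most the number of such `p` times a full geometric series.
  choose! p hp hs using fun l hl => exists_le_sum_eq l (hT l hl)
  obtain ⟨R, hR⟩ : ∃ R, ∀ l ∈ T, ∀ j, l j < R := by
    refine ⟨(T.sup fun l => ∑ j, l j) + 1, fun l hl j => Nat.lt_succ_of_le ?_⟩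
    exact (Finset.single_le_sum (fun i _ => Nat.zero_le (l i)) (Finset.mem_univ j)).trans
      (Finset.le_sup (f := fun l : J → ℕ => ∑ j, l j) hl)
  set S := (Fintype.piFinset fun _ : J => Finset.range (K + 1)).filter fun l => ∑ j, l j = K
    with hS
  set E := Fintype.piFinset fun _ : J => Finset.range R with hE
  have hsum : ∀ l ∈ T, K + ∑ j, (l j - p l j) = ∑ j, l j := by
    intro l hl
    rw [← hs l hl, ← Finset.sum_add_distrib]
    exact Finset.sum_congr rfl fun j _ => by have := hp l hl j; omega
  have hinj : Set.InjOn (fun l => (p l, fun j => l j - p l j)) (T : Set (J → ℕ)) := by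
    intro l hl l' hl' he
    have h1 : p l = p l' := congrArg Prod.fst he
    have h2 : (fun j => l j - p l j) = fun j => l' j - p l' j := congrArg Prod.snd he
    funext j
    have h3 := congrFun h1 j
    have h4 := congrFun h2 j
    have h5 := hp l hl j
    have h6 := hp l' hl' j
    omega
  have hsub : T.image (fun l => (p l, fun j => l j - p l j)) ⊆ S ×ˢ E := by
    intro z hz
    obtain ⟨l, hl, rfl⟩ := Finset.mem_image.1 hz
    rw [Finset.mem_product, hS, hE, Finset.mem_filter, Fintype.mem_piFinset,
      Fintype.mem_piFinset]
    refine ⟨⟨fun j => ?_, hs l hl⟩, fun j => ?_⟩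
    · rw [Finset.mem_range, Nat.lt_succ_iff, ← hs l hl]
      exact Finset.single_le_sum (fun i _ => Nat.zero_le (p l i)) (Finset.mem_univ j)
    · rw [Finset.mem_range]
      exact (Nat.sub_le _ _).trans_lt (hR l hl j)
  calc ∑ l ∈ T, x ^ (∑ j, l j)
      = ∑ l ∈ T, x ^ (K + ∑ j, (l j - p l j)) :=
        Finset.sum_congr rfl fun l hl => by rw [hsum l hl]
    _ = ∑ z ∈ T.image (fun l => (p l, fun j => l j - p l j)), x ^ (K + ∑ j, z.2 j) :=
        (Finset.sum_image (f := fun z : (J → ℕ) × (J → ℕ) => x ^ (K + ∑ j, z.2 j)) hinj).symm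
    _ ≤ ∑ z ∈ S ×ˢ E, x ^ (K + ∑ j, z.2 j) :=
        Finset.sum_le_sum_of_subset_of_nonneg hsub fun z _ _ => pow_nonneg hx _
    _ = S.card * (x ^ K * ∑ e ∈ E, x ^ (∑ j, e j)) := by
        rw [Finset.sum_product]
        simp only [pow_add, ← Finset.mul_sum]
        rw [Finset.sum_const, nsmul_eq_mul]
        ring
    _ ≤ ((K : ℝ) + 1) ^ (Fintype.card J - 1) * (x ^ K * ((1 - x)⁻¹) ^ Fintype.card J) := by
        refine mul_le_mul ?_ (mul_le_mul_of_nonneg_left (sum_piFinset_range_pow_le hx hx1 R)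
          (pow_nonneg hx K)) (mul_nonneg (pow_nonneg hx K)
            (Finset.sum_nonneg fun e _ => pow_nonneg hx _)) (by positivity)
        exact_mod_cast card_filter_sum_eq_le (J := J) K
    _ = _ := by ring

theorem extend_sub {b R : ℕ} (k l : Fin R → ZMod b) (i : ℕ) :
    extend (k - l) i = extend k i - extend l i := by
  by_cases hi : i < R
  · have h1 := extend_apply (k - l) ⟨i, hi⟩
    have h2 := extend_apply k ⟨i, hi⟩
    have h3 := extend_apply l ⟨i, hi⟩
    simp only at h1 h2 h3
    rw [h1, h2, h3, Pi.sub_apply]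
  · have h : ∀ k : Fin R → ZMod b, extend k i = 0 := by
      intro k
      by_contra h
      obtain ⟨j, -, hj⟩ := mem_support_extend.1 (Finsupp.mem_support_iff.2 h)
      exact hi (hj ▸ j.2)
    rw [h, h, h, sub_zero]

theorem top_support_extend_le {b R : ℕ} (k : Fin R → ZMod b) : top (extend k).support ≤ R := by
  rw [top_le_iff]
  intro i hi
  obtain ⟨j, -, rfl⟩ := mem_support_extend.1 hi
  exact j.2

variable {b : ℕ} [NeZero b]

/-- The number of code words with given weights `l` in a code of minimum distance larger
than `M`. -/
theorem card_code_le [DecidableEq J] {R M : ℕ} {D : Finset (J → Fin R → ZMod b)}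
    (hsub : ∀ κ ∈ D, ∀ κ' ∈ D, κ - κ' ∈ D)
    (hmin : ∀ κ ∈ D, κ ≠ 0 → M < ∑ j, top (extend (κ j)).support) {l : J → ℕ}
    (hl : ∀ j, 1 ≤ l j) :
    (D.filter fun κ => (fun j => top (extend (κ j)).support) = l).card ≤
      (b - 1) ^ Fintype.card J * b ^ (∑ j, (l j - 1) - M) := by
  -- In each coordinate `p j` low digits are left free, as many in total as the minimum distance
  -- permits. A code word is then determined by its nonzero leading digits and the digits from `p j`
  -- up to the leading one.
  obtain ⟨p, hp, hps⟩ := exists_le_sum_eq (fun j => l j - 1)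
    (min_le_right M (∑ j, (l j - 1)))
  have h := Finset.card_le_card_of_injOn
    (s := D.filter fun κ => (fun j => top (extend (κ j)).support) = l)
    (t := Fintype.piFinset fun j => (Finset.univ.erase (0 : ZMod b)) ×ˢ
      (Finset.univ : Finset (Fin (l j - 1 - p j) → ZMod b)))
    (fun κ j => (extend (κ j) (l j - 1), fun a => extend (κ j) (p j + a))) ?_ ?_
  · refine h.trans_eq ?_
    rw [Fintype.card_piFinset]
    simp only [Finset.card_product, Finset.card_univ, Fintype.card_fun, ZMod.card,
      Fintype.card_fin, Finset.card_erase_of_mem (Finset.mem_univ (0 : ZMod b))]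
    rw [Finset.prod_mul_distrib, Finset.prod_const, Finset.card_univ,
      Finset.prod_pow_eq_pow_sum]
    congr 2
    have h1 : ∑ j, (l j - 1 - p j) + ∑ j, p j = ∑ j, (l j - 1) := by
      rw [← Finset.sum_add_distrib]
      exact Finset.sum_congr rfl fun j _ => Nat.sub_add_cancel (hp j)
    omega
  · intro κ hκ
    have h1 := congrFun (Finset.mem_filter.1 hκ).2
    refine Finset.mem_coe.2 (Fintype.mem_piFinset.2 fun j => ?_)
    rw [Finset.mem_product]
    refine ⟨Finset.mem_erase.2 ⟨?_, Finset.mem_univ _⟩, Finset.mem_univ _⟩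
    have h2 : (extend (κ j)).support.Nonempty := by
      rw [Finset.nonempty_iff_ne_empty, Ne, ← top_eq_zero]
      have := h1 j
      have := hl j
      omega
    have h3 := Finsupp.mem_support_iff.1 (top_sub_one_mem h2)
    have h4 := h1 j
    rwa [h4] at h3
  · intro κ hκ κ' hκ' he
    have h1 := congrFun (Finset.mem_filter.1 hκ).2
    have h2 := congrFun (Finset.mem_filter.1 hκ').2
    by_contra hne
    have h3 := hmin _ (hsub κ (Finset.mem_filter.1 hκ).1 κ' (Finset.mem_filter.1 hκ').1)
      (sub_ne_zero.2 hne)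
    -- Two words with equal data differ only in the free digits, so their difference has weight at
    -- most `M` and must be zero.
    have h4 : ∀ j, top (extend ((κ - κ') j)).support ≤ p j := by
      intro j
      have e1 : extend (κ j) (l j - 1) = extend (κ' j) (l j - 1) :=
        congrArg Prod.fst (congrFun he j)
      have e2 : (fun a : Fin (l j - 1 - p j) => extend (κ j) (p j + a)) =
          fun a : Fin (l j - 1 - p j) => extend (κ' j) (p j + a) :=
        congrArg Prod.snd (congrFun he j)
      rw [top_le_iff]
      intro i hi
      by_contra hip
      rw [Finsupp.mem_support_iff, Pi.sub_apply, extend_sub, sub_ne_zero] at hi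
      rcases lt_trichotomy i (l j - 1) with hlt | rfl | hgt
      · have := congrFun e2 ⟨i - p j, by omega⟩
        simp only [Nat.add_sub_cancel' (not_lt.1 hip)] at this
        exact hi this
      · exact hi e1
      · have hz : ∀ k : ℕ →₀ ZMod b, top k.support = l j → k i = 0 := by
          intro k hk
          by_contra hki
          have := lt_top_of_mem (Finsupp.mem_support_iff.2 hki)
          omega
        exact hi (by rw [hz _ (h1 j), hz _ (h2 j)])
    have h5 := (Finset.sum_le_sum fun j (_ : j ∈ Finset.univ) => h4 j)
    have h6 := min_le_left M (∑ j, (l j - 1))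
    omega

/-- The weight enumerator of a code of minimum distance larger than `M`. -/
theorem sum_code_le [DecidableEq J] [Nonempty J] (hb : 1 ≤ b) {R M : ℕ}
    {D : Finset (J → Fin R → ZMod b)}
    (hsub : ∀ κ ∈ D, ∀ κ' ∈ D, κ - κ' ∈ D)
    (hmin : ∀ κ ∈ D, κ ≠ 0 → M < ∑ j, top (extend (κ j)).support) {q : ℝ} (hq : (b : ℝ) < q) :
    ∑ κ ∈ D.filter (fun κ => ∀ j, κ j ≠ 0), (q⁻¹) ^ (∑ j, top (extend (κ j)).support) ≤
      ((M : ℝ) + 2) ^ (Fintype.card J - 1) * (q⁻¹) ^ M * (((b : ℝ) - 1) ^ Fintype.card J *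
        ((q / (q - 1)) ^ Fintype.card J + b * (1 / (q - b)) ^ Fintype.card J)) := by
  have hb1 : (1 : ℝ) ≤ b := by exact_mod_cast hb
  have hq0 : 0 < q := by linarith
  have hq1 : 1 < q := by linarith
  set r := Fintype.card J with hr
  set x : ℝ := q⁻¹ with hx
  have hx0 : 0 < x := inv_pos.2 hq0
  have hx1 : x < 1 := inv_lt_one_of_one_lt₀ hq1
  set y : ℝ := b * x with hy
  have hy0 : 0 ≤ y := by positivity
  have hy1 : y < 1 := by
    rw [hy, hx, ← div_eq_mul_inv, div_lt_one hq0]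
    exact hq
  set L := (Fintype.piFinset fun _ : J => Finset.Icc 1 R).filter fun l => M + 1 ≤ ∑ j, l j
    with hL
  have hmaps : ∀ κ ∈ D.filter (fun κ => ∀ j, κ j ≠ 0),
      (fun j => top (extend (κ j)).support) ∈ L := by
    intro κ hκ
    obtain ⟨hκD, hκ0⟩ := Finset.mem_filter.1 hκ
    rw [hL, Finset.mem_filter, Fintype.mem_piFinset]
    refine ⟨fun j => Finset.mem_Icc.2 ⟨?_, top_support_extend_le _⟩, hmin κ hκD fun h => ?_⟩
    · refine top_pos (Finsupp.support_nonempty_iff.2 ?_)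
      exact mt extend_eq_zero.1 (hκ0 j)
    · obtain ⟨j⟩ := ‹Nonempty J›
      exact hκ0 j (by rw [h]; rfl)
  have hlpos : ∀ l ∈ L, ∀ j, 1 ≤ l j := by
    intro l hl j
    have := Fintype.mem_piFinset.1 (Finset.mem_filter.1 hl).1 j
    exact (Finset.mem_Icc.1 this).1
  have hlsum : ∀ l ∈ L, ∑ j, (l j - 1) + r = ∑ j, l j := by
    intro l hl
    rw [hr, Fintype.card_eq_sum_ones, ← Finset.sum_add_distrib]
    exact Finset.sum_congr rfl fun j _ => Nat.sub_add_cancel (hlpos l hl j)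
  have hterm : ∀ l ∈ L, ∑ κ ∈ (D.filter (fun κ => ∀ j, κ j ≠ 0)).filter
      (fun κ => (fun j => top (extend (κ j)).support) = l),
      x ^ (∑ j, top (extend (κ j)).support) ≤
      ((b : ℝ) - 1) ^ r * (b : ℝ) ^ (∑ j, (l j - 1) - M) * x ^ (∑ j, l j) := by
    intro l hl
    have h1 : ∀ κ ∈ (D.filter (fun κ => ∀ j, κ j ≠ 0)).filter
        (fun κ => (fun j => top (extend (κ j)).support) = l),
        x ^ (∑ j, top (extend (κ j)).support) = x ^ (∑ j, l j) := by
      intro κ hκ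
      rw [← (Finset.mem_filter.1 hκ).2]
    rw [Finset.sum_congr rfl h1, Finset.sum_const, nsmul_eq_mul]
    refine mul_le_mul_of_nonneg_right ?_ (pow_nonneg hx0.le _)
    have h2 := card_code_le hsub hmin (hlpos l hl)
    have h3 : ((D.filter (fun κ => ∀ j, κ j ≠ 0)).filter
        (fun κ => (fun j => top (extend (κ j)).support) = l)).card ≤
        (b - 1) ^ r * b ^ (∑ j, (l j - 1) - M) :=
      (Finset.card_le_card (Finset.filter_subset_filter _ (Finset.filter_subset _ _))).trans h2
    have h4 : ((b - 1 : ℕ) : ℝ) = (b : ℝ) - 1 := by rw [Nat.cast_sub hb, Nat.cast_one]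
    rw [← h4]
    exact_mod_cast h3
  have hbr : 0 ≤ ((b : ℝ) - 1) ^ r := pow_nonneg (by linarith) r
  -- The truncated exponent is zero unless the sum of `l j - 1` exceeds `M`. The two cases yield the
  -- two summands of `constG`, with series in `x = 1 / q` and `y = b / q`.
  have hsplit : ∀ l ∈ L, (b : ℝ) ^ (∑ j, (l j - 1) - M) * x ^ (∑ j, l j) ≤
      x ^ (∑ j, l j) + if M + 1 ≤ ∑ j, (l j - 1) then
        ((b : ℝ)⁻¹) ^ M * x ^ r * y ^ (∑ j, (l j - 1)) else 0 := by
    intro l hl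
    split_ifs with h
    · have h1 : (b : ℝ) ^ (∑ j, (l j - 1) - M) * x ^ (∑ j, l j) =
          ((b : ℝ)⁻¹) ^ M * x ^ r * y ^ (∑ j, (l j - 1)) := by
        have hb0 : (b : ℝ) ≠ 0 := by linarith
        rw [← hlsum l hl, hy, mul_pow, pow_add, inv_pow, pow_sub₀ _ hb0 (by omega)]
        ring
      rw [h1]
      linarith [pow_nonneg hx0.le (∑ j, l j)]
    · rw [show ∑ j, (l j - 1) - M = 0 by omega, pow_zero, one_mul, add_zero]
  have hfirst : ∑ l ∈ L, x ^ (∑ j, l j) ≤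
      ((M : ℝ) + 2) ^ (r - 1) * x ^ M * (q / (q - 1)) ^ r := by
    have h1 := sum_pow_sum_tail_le hx0.le hx1 (M + 1) (T := L)
      fun l hl => (Finset.mem_filter.1 hl).2
    refine h1.trans ?_
    have h2 : (1 - x)⁻¹ = q / (q - 1) := by
      rw [hx]
      have : q - 1 ≠ 0 := by linarith
      field_simp
    rw [h2]
    have h3 : x ^ (M + 1) ≤ x ^ M := pow_le_pow_of_le_one hx0.le hx1.le (Nat.le_succ M)
    have h4 : 0 ≤ q / (q - 1) := div_nonneg hq0.le (by linarith)
    push_cast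
    rw [add_assoc, one_add_one_eq_two]
    gcongr
  have hsecond : ∑ l ∈ L, (if M + 1 ≤ ∑ j, (l j - 1) then
        ((b : ℝ)⁻¹) ^ M * x ^ r * y ^ (∑ j, (l j - 1)) else 0) ≤
      ((M : ℝ) + 2) ^ (r - 1) * x ^ M * (b * (1 / (q - b)) ^ r) := by
    rw [← Finset.sum_filter, ← Finset.mul_sum]
    set L' := L.filter fun l => M + 1 ≤ ∑ j, (l j - 1)
    have hinj : Set.InjOn (fun (l : J → ℕ) j => l j - 1) (L' : Set (J → ℕ)) := by
      intro l hl l' hl' he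
      funext j
      have h1 := congrFun he j
      have h2 := hlpos l (Finset.mem_filter.1 hl).1 j
      have h3 := hlpos l' (Finset.mem_filter.1 hl').1 j
      simp only at h1
      omega
    have h0 := Finset.sum_image (f := fun e : J → ℕ => y ^ (∑ j, e j)) hinj
    rw [← h0]
    have h1 := sum_pow_sum_tail_le hy0 hy1 (M + 1)
      (T := L'.image fun (l : J → ℕ) j => l j - 1) (by
        intro e he
        obtain ⟨l, hl, rfl⟩ := Finset.mem_image.1 he
        exact (Finset.mem_filter.1 hl).2)
    refine (mul_le_mul_of_nonneg_left h1 (by positivity)).trans ?_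
    have h2 : (1 - y)⁻¹ = q * (1 / (q - b)) := by
      rw [hy, hx]
      have : q - b ≠ 0 := by linarith
      field_simp
    rw [h2]
    -- The tail starts at `M + 1`, while the code bound removes only `b ^ M`; the power of `b` left
    -- over is the factor `b` in `constG`.
    have h3 : ((b : ℝ)⁻¹) ^ M * x ^ r * ((((M + 1 : ℕ) : ℝ) + 1) ^ (r - 1) * y ^ (M + 1) *
        (q * (1 / (q - b))) ^ r) =
        ((M : ℝ) + 2) ^ (r - 1) * x ^ (M + 1) * (b * (1 / (q - b)) ^ r) := by
      have hb0 : (b : ℝ)⁻¹ ^ M * (b : ℝ) ^ M = 1 := by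
        rw [← mul_pow, inv_mul_cancel₀ (by linarith), one_pow]
      have hxq : x ^ r * q ^ r = 1 := by
        rw [← mul_pow, hx, inv_mul_cancel₀ hq0.ne', one_pow]
      rw [hy, mul_pow, mul_pow, pow_succ (b : ℝ) M]
      push_cast
      rw [add_assoc, one_add_one_eq_two]
      linear_combination ((M : ℝ) + 2) ^ (r - 1) * x ^ (M + 1) * (b * (1 / (q - b)) ^ r) *
        (x ^ r * q ^ r) * hb0 +
        ((M : ℝ) + 2) ^ (r - 1) * x ^ (M + 1) * (b * (1 / (q - b)) ^ r) * hxq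
    rw [h3]
    have h4 : 0 ≤ 1 / (q - b) := div_nonneg zero_le_one (by linarith)
    have h5 : x ^ (M + 1) ≤ x ^ M := pow_le_pow_of_le_one hx0.le hx1.le (Nat.le_succ M)
    gcongr
  calc ∑ κ ∈ D.filter (fun κ => ∀ j, κ j ≠ 0), x ^ (∑ j, top (extend (κ j)).support)
      = ∑ l ∈ L, ∑ κ ∈ (D.filter (fun κ => ∀ j, κ j ≠ 0)).filter
        (fun κ => (fun j => top (extend (κ j)).support) = l),
        x ^ (∑ j, top (extend (κ j)).support) :=
        (Finset.sum_fiberwise_of_maps_to hmaps _).symm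
    _ ≤ ∑ l ∈ L, ((b : ℝ) - 1) ^ r * (b : ℝ) ^ (∑ j, (l j - 1) - M) * x ^ (∑ j, l j) :=
        Finset.sum_le_sum hterm
    _ ≤ ∑ l ∈ L, ((b : ℝ) - 1) ^ r * (x ^ (∑ j, l j) + if M + 1 ≤ ∑ j, (l j - 1) then
        ((b : ℝ)⁻¹) ^ M * x ^ r * y ^ (∑ j, (l j - 1)) else 0) := by
        refine Finset.sum_le_sum fun l hl => ?_
        rw [mul_assoc]
        exact mul_le_mul_of_nonneg_left (hsplit l hl) hbr
    _ ≤ ((b : ℝ) - 1) ^ r * (((M : ℝ) + 2) ^ (r - 1) * x ^ M * (q / (q - 1)) ^ r +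
        ((M : ℝ) + 2) ^ (r - 1) * x ^ M * (b * (1 / (q - b)) ^ r)) := by
        rw [← Finset.mul_sum, Finset.sum_add_distrib]
        exact mul_le_mul_of_nonneg_left (add_le_add hfirst hsecond) hbr
    _ = _ := by ring

end Counting

/-! ### Digits of shifted net points -/

section Shift

/-- The digitwise sum of two numbers, reduced to `[0,1)`. -/
noncomputable def shiftOne (b : ℕ) [NeZero b] (y x : ℝ) : ℝ := Int.fract (digitAdd b y x)

variable {b : ℕ} [NeZero b]

theorem shiftOne_mem (y x : ℝ) : shiftOne b y x ∈ Set.Ico (0 : ℝ) 1 :=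
  ⟨Int.fract_nonneg _, Int.fract_lt_one _⟩

theorem measurable_shiftOne (y : ℝ) : Measurable (shiftOne b y) := by
  have h1 : Measurable fun x : ℝ => fun i => Real.digits y b i + Real.digits x b i := by
    refine measurable_pi_lambda _ fun i => ?_
    have h2 : Measurable fun n : ℕ => Real.digits y b i + Fin.ofNat b n :=
      measurable_of_countable _
    exact h2.comp (Nat.measurable_floor.comp (measurable_id.mul_const _))
  exact measurable_fract.comp (Real.continuous_ofDigits.measurable.comp h1)

theorem digit_eq_digits {x : ℝ} (hx : 0 ≤ x) (i : ℕ) :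
    digit b i x = ((Real.digits x b i : ℕ) : ZMod b) := by
  have h0 : 0 ≤ (b : ℝ) ^ (i + 1) * x := by positivity
  rw [digit, Real.digits, Fin.ofNat, ZMod.natCast_mod, mul_comm x,
    ← Int.natCast_floor_eq_floor h0, Int.cast_natCast]

theorem ofDigits_eq_div (d : ℕ → Fin b) :
    (b : ℝ) * Real.ofDigits d = (d 0 : ℕ) + Real.ofDigits fun i => d (i + 1) := by
  have hb : (b : ℝ) ≠ 0 := by exact_mod_cast NeZero.ne b
  have h := Real.ofDigits_eq_sum_add_ofDigits d 1
  rw [h]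
  simp [Real.ofDigitsTerm]
  field_simp

/-- Infinitely many digits different from `b - 1` keep every tail below one, so no carry disturbs
the leading digits. -/
theorem digit_ofDigits {d : ℕ → Fin b} (hd : ∀ n, ∃ i, n ≤ i ∧ (d i : ℕ) + 1 < b) (i : ℕ) :
    digit b i (Real.ofDigits d) = ((d i : ℕ) : ZMod b) := by
  induction i generalizing d with
  | zero =>
    obtain ⟨i, hi, hlt⟩ := hd 1
    have h1 : Real.ofDigits (fun i => d (i + 1)) < 1 :=
      ofDigits_lt_one _ (i - 1) (by simpa [Nat.sub_add_cancel hi] using hlt)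
    rw [digit, zero_add, pow_one, ofDigits_eq_div, Int.floor_natCast_add,
      Int.floor_eq_zero_iff.2 ⟨Real.ofDigits_nonneg _, h1⟩]
    simp
  | succ i ih =>
    have h1 := ih (d := fun i => d (i + 1)) fun n => by
      obtain ⟨i, hi, hlt⟩ := hd (n + 1)
      exact ⟨i - 1, by omega, by simpa [Nat.sub_add_cancel (show 1 ≤ i by omega)] using hlt⟩
    rw [← h1, digit, digit, pow_succ, mul_assoc, ofDigits_eq_div, mul_add]
    have h2 : (b : ℝ) ^ (i + 1) * ((d 0 : ℕ) : ℝ) = ((b ^ (i + 1) * (d 0 : ℕ) : ℕ) : ℝ) := by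
      push_cast
      ring
    rw [h2, Int.floor_natCast_add]
    simp

end Shift

/-! ### Rows of the generating matrices and the dual net -/

section Net

variable {b s n m : ℕ}

/-- The rows of a generating matrix, continued by zeros. -/
def row (A : Matrix (Fin n) (Fin m) (ZMod b)) (i : ℕ) : Fin m → ZMod b :=
  if hi : i < n then A ⟨i, hi⟩ else 0

theorem coe_netDigits [NeZero b] (A : Matrix (Fin n) (Fin m) (ZMod b)) (h i : ℕ) :
    ((netDigits A h i : ℕ) : ZMod b) = ∑ a, row A i a * digitVec b m h a := by
  rw [netDigits, row]
  split_ifs with hi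
  · rw [ZMod.natCast_val, ZMod.cast_id]
    rfl
  · simp

/-- Past position `n` the net point has zero digits, so the digitwise sum inherits infinitely many
digits different from `b - 1` from `x`. It is therefore an admissible expansion of a number below
one. -/
theorem digit_shiftOne [Fact b.Prime] (C : Fin s → Matrix (Fin n) (Fin m) (ZMod b))
    (h : Fin (b ^ m)) (j : Fin s) {x : ℝ} (hx : x ∈ Set.Ico (0 : ℝ) 1) (i : ℕ) :
    digit b i (shiftOne b (digitalNet C h j) x) =
      digit b i x + ∑ a, row (C j) i a * digitVec b m h a := by
  have hb := (Fact.out : b.Prime).one_lt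
  have h0 : shiftOne b (digitalNet C h j) x = digitAdd b (digitalNet C h j) x :=
    coe_digitShift_digitalNet C h (fun _ => ⟨x, hx⟩) j
  have hd : ∀ n, ∃ i, n ≤ i ∧ (netDigits (C j) h i : ℕ) + 1 < b := fun N =>
    ⟨max N n, le_max_left _ _, by
      rw [netDigits, dif_neg (by omega)]
      simpa using hb⟩
  have h1 : ∀ i, ((Real.digits (digitalNet C h j : ℝ) b i : ℕ) : ZMod b) =
      ∑ a, row (C j) i a * digitVec b m h a := by
    intro i
    rw [← digit_eq_digits (digitalNet C h j).2.1, ← coe_netDigits]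
    exact digit_ofDigits hd i
  rw [h0, digitAdd, digit_ofDigits, Fin.val_add, ZMod.natCast_mod, Nat.cast_add, h1,
    digit_eq_digits hx.1, add_comm]
  intro N
  obtain ⟨i, hi, hlt⟩ := exists_digits_add_one_lt hb hx (max N n)
  refine ⟨i, (le_max_left _ _).trans hi, ?_⟩
  have h2 : Real.digits (digitalNet C h j : ℝ) b i = 0 :=
    digits_ofDigits_netDigits (C j) h ((le_max_right _ _).trans hi)
  rw [h2, zero_add]
  exact hlt

theorem digitVec_bijective [NeZero b] :
    Function.Bijective fun h : Fin (b ^ m) => digitVec b m h := by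
  rw [Fintype.bijective_iff_injective_and_card]
  refine ⟨fun h h' he => ?_, by simp⟩
  have key : ∀ m (h h' : ℕ), h < b ^ m → h' < b ^ m →
      (∀ i < m, h / b ^ i % b = h' / b ^ i % b) → h = h' := by
    intro m
    induction m with
    | zero => intro h h' h1 h2 _; simp at h1 h2; omega
    | succ m ih =>
      intro h h' h1 h2 h3
      have h4 := ih (h / b) (h' / b) (Nat.div_lt_of_lt_mul (by rwa [← pow_succ']))
        (Nat.div_lt_of_lt_mul (by rwa [← pow_succ'])) fun i hi => by
          have := h3 (i + 1) (by omega)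
          rwa [pow_succ', ← Nat.div_div_eq_div_mul, ← Nat.div_div_eq_div_mul] at this
      have h5 := h3 0 (by omega)
      rw [pow_zero, Nat.div_one, Nat.div_one] at h5
      rw [← Nat.div_add_mod h b, ← Nat.div_add_mod h' b, h4, h5]
  refine Fin.ext (key m h h' h.2 h'.2 fun i hi => ?_)
  have h1 := congrFun he ⟨i, hi⟩
  simp only [digitVec] at h1
  have h2 := (ZMod.natCast_eq_natCast_iff' _ _ _).1 h1
  rwa [Nat.mod_mod, Nat.mod_mod] at h2

/-- The dual net property of higher order digital nets. -/
theorem lt_sum_mu_of_dual [NeZero b] {β t : ℕ} {C : Fin s → Matrix (Fin n) (Fin m) (ZMod b)}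
    (hβ : 1 ≤ β) (hC : IsOrderDigitalNet β t C) {κ : Fin s → ℕ →₀ ZMod b} (hκ : κ ≠ 0)
    (hdual : ∑ j, ∑ i ∈ (κ j).support, κ j i • row (C j) i = 0) :
    β * m - t < ∑ j, mu β (κ j).support := by
  by_contra! hle
  obtain ⟨hn, -, hind⟩ := hC
  -- If the sum of `mu β` were small, every position would be at most `β m ≤ n`, so only genuine
  -- rows of the matrices occur.
  have hlt : ∀ j, ∀ i ∈ (κ j).support, i < n := by
    intro j i hi
    have h1 := lt_top_of_mem hi
    have h2 := top_le_mu hβ (κ j).support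
    have h3 := Finset.single_le_sum (f := fun j => mu β (κ j).support)
      (fun j _ => Nat.zero_le _) (Finset.mem_univ j)
    omega
  let e : (j : Fin s) → Fin (κ j).support.card ↪o ℕ := fun j => (κ j).support.orderEmbOfFin rfl
  have he : ∀ j l, e j l ∈ (κ j).support := fun j l => Finset.orderEmbOfFin_mem _ rfl l
  -- The increasing enumeration is reversed, as the net condition lists rows in decreasing order.
  let i : (j : Fin s) → Fin (κ j).support.card → Fin n := fun j l =>
    ⟨e j l.rev, hlt j _ (he j _)⟩
  have hanti : ∀ j, StrictAnti (i j) := fun j l l' hl =>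
    Fin.mk_lt_mk.2 ((e j).strictMono (Fin.rev_lt_rev.2 hl))
  have hpos : ∀ j (l : Fin (κ j).support.card), (i j l : ℕ) + 1 ≤ pos (κ j).support l := by
    intro j l
    let i' : ℕ → ℕ := fun a => if ha : a < (κ j).support.card then i j ⟨a, ha⟩ else 0
    have h1 := succ_le_pos_of_strictAntiOn (S := (κ j).support) l i'
      (fun a ha => by
        have ha' : a < (κ j).support.card := ha.trans_lt l.2
        simp only [i', dif_pos ha']
        exact he j _)
      (fun a ha => by
        have ha' : a + 1 < (κ j).support.card := (Nat.succ_le_of_lt ha).trans_lt l.2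
        simp only [i', dif_pos ha', dif_pos (Nat.lt_of_succ_lt ha')]
        exact hanti j (Fin.mk_lt_mk.2 (Nat.lt_succ_self a)))
    simpa [i', l.2] using h1
  have hsum : ∀ j, (∑ l : Fin (κ j).support.card,
      if (l : ℕ) < β then (i j l : ℕ) + 1 else 0) ≤ mu β (κ j).support := by
    intro j
    have h1 : (∑ l : Fin (κ j).support.card, if (l : ℕ) < β then (i j l : ℕ) + 1 else 0) ≤
        ∑ l : Fin (κ j).support.card, if (l : ℕ) < β then pos (κ j).support l else 0 := by
      refine Finset.sum_le_sum fun l _ => ?_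
      split_ifs
      · exact hpos j l
      · exact le_rfl
    refine h1.trans ?_
    rw [Fin.sum_univ_eq_sum_range (fun l => if l < β then pos (κ j).support l else 0),
      ← Finset.sum_filter, mu]
    exact Finset.sum_le_sum_of_subset fun l hl => Finset.mem_range.2 (Finset.mem_filter.1 hl).2
  have hlin := hind (fun j => (κ j).support.card) i hanti
    ((Finset.sum_le_sum fun j _ => hsum j).trans hle)
  rw [Fintype.linearIndependent_iff] at hlin
  have hzero := hlin (fun p => κ p.1 (e p.1 p.2.rev)) (by
    rw [Fintype.sum_sigma, ← hdual]
    refine Finset.sum_congr rfl fun j _ => ?_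
    have h1 : ∀ l : Fin (κ j).support.card, κ j (e j l.rev) • C j (i j l) =
        (fun l => κ j (e j l) • row (C j) (e j l)) (Fin.revPerm l) := by
      intro l
      simp only [Fin.revPerm_apply, row, dif_pos (hlt j _ (he j l.rev)), i]
    simp_rw [h1]
    rw [Equiv.sum_comp Fin.revPerm fun l => κ j (e j l) • row (C j) (e j l)]
    conv_rhs => rw [← Finset.map_orderEmbOfFin_univ (κ j).support rfl]
    rw [Finset.sum_map]
    rfl)
  refine hκ (funext fun j => ?_)
  rw [Pi.zero_apply, ← Finsupp.support_eq_empty]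
  by_contra hne
  have hcard : 0 < (κ j).support.card := Finset.card_pos.2 (Finset.nonempty_iff_ne_empty.2 hne)
  have h2 := hzero ⟨j, ⟨0, hcard⟩⟩
  exact Finsupp.mem_support_iff.1 (he j _) h2

end Net

/-! ### The averaged squared error over one coordinate projection -/

section DualSum

theorem sum_support_extend {b R : ℕ} {V : Type*} [AddCommMonoid V] [Module (ZMod b) V]
    (k : Fin R → ZMod b) (v : ℕ → V) :
    ∑ i ∈ (extend k).support, extend k i • v i = ∑ i : Fin R, k i • v i := by
  have h1 : (extend k).support ⊆ Finset.range R := by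
    intro i hi
    obtain ⟨j, -, rfl⟩ := mem_support_extend.1 hi
    exact Finset.mem_range.2 j.2
  rw [Finset.sum_subset h1 fun i _ hi => by rw [Finsupp.notMem_support_iff.1 hi, zero_smul],
    ← Fin.sum_univ_eq_sum_range fun i => extend k i • v i]
  exact Finset.sum_congr rfl fun i _ => by rw [extend_apply]

variable {b s n m : ℕ}

/-- The linear combination of the rows of the generating matrices with coefficients `κ`. -/
def rowComb (C : Fin s → Matrix (Fin n) (Fin m) (ZMod b)) {u : Finset (Fin s)} {R : ℕ}
    (κ : u → Fin R → ZMod b) : Fin m → ZMod b :=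
  ∑ j, ∑ i, κ j i • row (C j) i

theorem rowComb_sub (C : Fin s → Matrix (Fin n) (Fin m) (ZMod b)) {u : Finset (Fin s)} {R : ℕ}
    (κ κ' : u → Fin R → ZMod b) : rowComb C (κ - κ') = rowComb C κ - rowComb C κ' := by
  simp only [rowComb, Pi.sub_apply, sub_smul, Finset.sum_sub_distrib]

variable [NeZero b]

/-- Indices supported on `u` are extended by zero to all coordinates, which changes neither side. -/
theorem lt_sum_mu_of_rowComb_eq_zero {β t : ℕ} {C : Fin s → Matrix (Fin n) (Fin m) (ZMod b)}
    (hβ : 1 ≤ β) (hC : IsOrderDigitalNet β t C) {u : Finset (Fin s)} {R : ℕ}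
    {κ : u → Fin R → ZMod b} (hκ : κ ≠ 0) (hdual : rowComb C κ = 0) :
    β * m - t < ∑ j, mu β (extend (κ j)).support := by
  set κ' : Fin s → ℕ →₀ ZMod b := fun j => if hj : j ∈ u then extend (κ ⟨j, hj⟩) else 0 with hκ'
  have hin : ∀ j : u, κ' j = extend (κ j) := fun j => dif_pos j.2
  have hout : ∀ j ∉ u, κ' j = 0 := fun j hj => dif_neg hj
  have h := lt_sum_mu_of_dual hβ hC (κ := κ') ?_ ?_
  · rw [← Finset.sum_subset (Finset.subset_univ u) fun j _ hj => by
        rw [hout j hj, Finsupp.support_zero, mu_empty],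
      ← Finset.sum_coe_sort u fun j => mu β (κ' j).support] at h
    simp_rw [hin] at h
    exact h
  · intro h0
    refine hκ (funext fun j => ?_)
    have := congrFun h0 j
    rw [hin] at this
    exact extend_eq_zero.1 this
  · rw [← Finset.sum_subset (Finset.subset_univ u) fun j _ hj => by
        rw [hout j hj, Finsupp.support_zero, Finset.sum_empty],
      ← Finset.sum_coe_sort u fun j => ∑ i ∈ (κ' j).support, κ' j i • row (C j) i]
    simp_rw [hin, sum_support_extend]
    exact hdual

/-- The digit vectors of `0, …, b^m - 1` run through all vectors exactly once, so this is
orthogonality of characters. -/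
theorem sum_stdAddChar_digitVec (d : Fin m → ZMod b) :
    ∑ h : Fin (b ^ m), (ZMod.stdAddChar (∑ a, d a * digitVec b m h a) : ℂ) =
      if d = 0 then (b : ℂ) ^ m else 0 := by
  have h1 := (digitVec_bijective (b := b) (m := m)).sum_comp
    fun c : Fin m → ZMod b => (ZMod.stdAddChar (∑ a, d a * c a) : ℂ)
  rw [h1]
  have h2 := sum_stdAddChar_pi d
  rw [Fintype.card_fin] at h2
  rw [← h2]
  exact Finset.sum_congr rfl fun c _ => by simp_rw [mul_comm]

/-- Digital nets integrate Walsh functions exactly, unless the index is in the dual net. -/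
theorem sum_sum_prod_eq (C : Fin s → Matrix (Fin n) (Fin m) (ZMod b)) (u : Finset (Fin s))
    {R : ℕ} (r : (Fin R → ZMod b) → ℂ) :
    ((b : ℂ) ^ m)⁻¹ ^ 2 * ∑ h : Fin (b ^ m), ∑ h' : Fin (b ^ m), ∏ j ∈ u,
      ∑ k : Fin R → ZMod b, r k * ZMod.stdAddChar (∑ i, k i *
        ((∑ a, row (C j) i a * digitVec b m h a) - ∑ a, row (C j) i a * digitVec b m h' a)) =
      ∑ κ : u → Fin R → ZMod b with rowComb C κ = 0, ∏ j, r (κ j) := by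
  have hb : (b : ℂ) ^ m ≠ 0 := pow_ne_zero _ (by exact_mod_cast NeZero.ne b)
  -- Expanding the product over `u` makes the characters combine into one in `h` and its inverse in
  -- `h'`; each then sums to zero unless the row combination vanishes.
  have h1 : ∀ h h' : Fin (b ^ m), ∏ j ∈ u,
      ∑ k : Fin R → ZMod b, r k * (ZMod.stdAddChar (∑ i, k i *
        ((∑ a, row (C j) i a * digitVec b m h a) -
          ∑ a, row (C j) i a * digitVec b m h' a)) : ℂ) =
      ∑ κ : u → Fin R → ZMod b, (∏ j, r (κ j)) *
        (ZMod.stdAddChar (∑ a, rowComb C κ a * digitVec b m h a) *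
          ZMod.stdAddChar (∑ a, (-rowComb C κ) a * digitVec b m h' a)) := by
    intro h h'
    rw [← Finset.prod_coe_sort, Fintype.prod_sum]
    refine Finset.sum_congr rfl fun κ _ => ?_
    rw [Finset.prod_mul_distrib, ← addChar_sum, ← AddChar.map_add_eq_mul]
    congr 2
    have h2 : ∀ h : Fin (b ^ m), ∑ a, rowComb C κ a * digitVec b m h a =
        ∑ j, ∑ i, κ j i * ∑ a, row (C j) i a * digitVec b m h a := by
      intro h
      simp only [rowComb, Finset.sum_apply, Pi.smul_apply, smul_eq_mul, Finset.sum_mul,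
        Finset.mul_sum]
      rw [Finset.sum_comm]
      refine Finset.sum_congr rfl fun j _ => ?_
      rw [Finset.sum_comm]
      exact Finset.sum_congr rfl fun i _ => Finset.sum_congr rfl fun a _ => by ring
    simp only [Pi.neg_apply, neg_mul, Finset.sum_neg_distrib]
    rw [h2, h2, ← sub_eq_add_neg]
    simp only [mul_sub, Finset.sum_sub_distrib]
  have h3 : ∀ κ : u → Fin R → ZMod b, ∑ h : Fin (b ^ m), ∑ h' : Fin (b ^ m), (∏ j, r (κ j)) *
        ((ZMod.stdAddChar (∑ a, rowComb C κ a * digitVec b m h a) : ℂ) *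
          ZMod.stdAddChar (∑ a, (-rowComb C κ) a * digitVec b m h' a)) =
      ((b : ℂ) ^ m) ^ 2 * if rowComb C κ = 0 then ∏ j, r (κ j) else 0 := by
    intro κ
    simp_rw [← Finset.mul_sum, ← Finset.sum_mul]
    rw [sum_stdAddChar_digitVec, sum_stdAddChar_digitVec]
    by_cases h : rowComb C κ = 0
    · simp only [h, neg_zero, if_true]
      ring
    · simp only [h, if_false]
      ring
  simp_rw [h1]
  have h4 : ∑ h : Fin (b ^ m), ∑ h' : Fin (b ^ m), ∑ κ : u → Fin R → ZMod b, (∏ j, r (κ j)) *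
        ((ZMod.stdAddChar (∑ a, rowComb C κ a * digitVec b m h a) : ℂ) *
          ZMod.stdAddChar (∑ a, (-rowComb C κ) a * digitVec b m h' a)) =
      ∑ κ : u → Fin R → ZMod b, ∑ h : Fin (b ^ m), ∑ h' : Fin (b ^ m), (∏ j, r (κ j)) *
        ((ZMod.stdAddChar (∑ a, rowComb C κ a * digitVec b m h a) : ℂ) *
          ZMod.stdAddChar (∑ a, (-rowComb C κ) a * digitVec b m h' a)) := by
    rw [Finset.sum_comm]
    refine (Finset.sum_congr rfl fun h' _ => Finset.sum_comm).trans ?_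
    rw [Finset.sum_comm]
    exact Finset.sum_congr rfl fun κ _ => Finset.sum_comm
  rw [h4]
  simp_rw [h3]
  rw [← Finset.mul_sum, ← Finset.sum_filter, ← mul_assoc, ← mul_pow, inv_mul_cancel₀ hb, one_pow,
    one_mul]

/-- The kernel has mean zero in its first variable. Hence only dual words with all components
nonzero contribute. -/
theorem walCoeff_kernelOne_zero {α : ℕ} (hα : α ≠ 0) :
    walCoeff (fun x y => (kernelOne α x y : ℂ)) (0 : ℕ →₀ ZMod b) = 0 := by
  simp only [walCoeff, neg_zero, wal_zero, mul_one]
  have h1 : ∫ z : ℝ × ℝ, kernelOne α z.1 z.2 ∂(unitMeasure.prod unitMeasure) = 0 := by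
    rw [integral_prod_symm _ (integrable_kernel_prod (continuous_kernelOne α))]
    refine integral_eq_zero_of_ae ?_
    filter_upwards [ae_unitMeasure_mem] with x hx
    rw [integral_unitMeasure, integral_kernelOne hα x hx]
    rfl
  refine (integral_ofReal (𝕜 := ℂ) (f := fun z : ℝ × ℝ => kernelOne α z.1 z.2)).trans ?_
  rw [h1]
  rfl

end DualSum

/-! ### The exponents `A`, `B` and the constants of the bound -/

section Constants

variable {α β b : ℕ}

theorem constA_nonneg (hα : 1 ≤ α) (hβ : 1 ≤ β) : 0 ≤ constA α β := by
  have h1 : (1 : ℝ) ≤ α := by exact_mod_cast hα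
  have h2 : (1 : ℝ) ≤ β := by exact_mod_cast hβ
  exact div_nonneg (by linarith) (by linarith)

/-- This identity makes the two decay factors, of exponents `A β m` and `B m`, combine to the rate
`N^(-α)`. -/
theorem constA_mul_add_constB (hβ : 2 ≤ β) : constA α β * β + constB α β = α := by
  have h2 : (2 : ℝ) ≤ β := by exact_mod_cast hβ
  have : (β : ℝ) - 1 ≠ 0 := by linarith
  rw [constA, constB]
  field_simp
  ring

/-- This is where `2 * α ≤ β` is needed: it gives `b^(2B) > b`, so that the decay beats the growth
of the number of code words. -/
theorem one_lt_two_mul_constB (hβ : 2 ≤ β) (hαβ : 2 * α ≤ β) : 1 < 2 * constB α β := by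
  have h1 : (2 : ℝ) ≤ β := by exact_mod_cast hβ
  have h2 : (2 : ℝ) * α ≤ β := by exact_mod_cast hαβ
  rw [constB, ← mul_div_assoc, lt_div_iff₀ (by linarith)]
  linarith

theorem lt_rpow_constB (hb : 1 < b) (hβ : 2 ≤ β) (hαβ : 2 * α ≤ β) :
    (b : ℝ) < (b : ℝ) ^ (2 * constB α β) := by
  have hb1 : (1 : ℝ) < b := by exact_mod_cast hb
  conv_lhs => rw [← Real.rpow_one (b : ℝ)]
  exact Real.rpow_lt_rpow_of_exponent_lt hb1 (one_lt_two_mul_constB hβ hαβ)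

theorem constG_pos (hb : 1 < b) (hβ : 2 ≤ β) (hαβ : 2 * α ≤ β) (k : ℕ) : 0 < constG α β b k := by
  have hb1 : (1 : ℝ) < b := by exact_mod_cast hb
  have h1 := lt_rpow_constB hb hβ hαβ
  have h2 : 0 < (b : ℝ) - 1 := by linarith
  have h3 : 0 < (b : ℝ) ^ (2 * constB α β) - 1 := by linarith
  have h4 : 0 < (b : ℝ) ^ (2 * constB α β) - b := by linarith
  have h5 : 0 < (b : ℝ) ^ (2 * constB α β) := by linarith
  rw [constG]
  positivity

theorem constD_pos (hb : 1 < b) (hα : 1 ≤ α) : 0 < constD α b := by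
  have : NeZero b := ⟨by omega⟩
  have hb1 : (1 : ℝ) < b := by exact_mod_cast hb
  refine lt_of_lt_of_le ?_ (le_csSup (bddAbove_constD α b)
    (Set.mem_image_of_mem _ (Set.mem_Icc.2 ⟨le_rfl, hα⟩)))
  have hc : 0 < cosec b := by
    have : 0 < Real.sin (Real.pi / b) := Real.sin_pos_of_pos_of_lt_pi (by positivity)
      (div_lt_self Real.pi_pos hb1)
    rw [cosec]
    positivity
  have hw : 0 < constW (2 * α) b := by
    have := growth_pos b
    rw [constW_of_two_le (by omega)]
    positivity
  have h1 : 0 ≤ ∑ τ ∈ Finset.Icc 1 α, constW τ b ^ 2 / (b : ℝ) ^ (2 * (τ - 1)) :=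
    Finset.sum_nonneg fun τ _ => by positivity
  have h2 : 0 < 2 * constW (2 * α) b / (b : ℝ) ^ (2 * (α - 1)) := by positivity
  linarith

theorem constC_pos (hb : 1 < b) (hα : 1 ≤ α) (hβ : 2 ≤ β) (hαβ : 2 * α ≤ β) (t k : ℕ) :
    0 < constC α β b t k := by
  have hb1 : (1 : ℝ) < b := by exact_mod_cast hb
  have h1 := constD_pos hb hα
  have h2 := constG_pos hb hβ hαβ k
  have h3 := Real.log_pos hb1
  rw [constC]
  positivity

/-- The squared constant of the error bound. -/
theorem sq_constC_mul (hb : 1 < b) (hα : 1 ≤ α) (hβ : 2 ≤ β) (hαβ : 2 * α ≤ β) {m t k : ℕ}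
    (hm : 1 ≤ m) (ht : t ≤ β * m) (hk : 1 ≤ k) :
    (1 / ((b : ℝ) ^ m) ^ α * (constC α β b t k *
      Real.log ((b : ℝ) ^ m) ^ (((k : ℝ) - 1) / 2))) ^ 2 =
    constD α b ^ k * (b : ℝ) ^ (-(2 * constA α β * ((β * m - t : ℕ) : ℝ))) *
      ((3 * (m : ℝ)) ^ (k - 1) *
        (((b : ℝ) ^ (2 * constB α β))⁻¹) ^ (m - ⌈(t : ℝ) / β⌉₊) * constG α β b k) := by
  have hb1 : (1 : ℝ) < b := by exact_mod_cast hb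
  have hb0 : (0 : ℝ) < b := by linarith
  have hD := constD_pos hb hα
  have hG := constG_pos hb hβ hαβ k
  have hlog := Real.log_pos hb1
  have hm0 : (0 : ℝ) < m := by exact_mod_cast hm
  have hβ0 : (0 : ℝ) < β := by exact_mod_cast (by omega : 0 < β)
  have hc : ⌈(t : ℝ) / β⌉₊ ≤ m := by
    rw [Nat.ceil_le, div_le_iff₀ hβ0, mul_comm]
    exact_mod_cast ht
  have e1 : (1 / ((b : ℝ) ^ m) ^ α) ^ 2 = (b : ℝ) ^ (-(2 * (α : ℝ) * m)) := by
    rw [Real.rpow_neg hb0.le, one_div, inv_pow, ← pow_mul, ← pow_mul, ← Real.rpow_natCast]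
    push_cast
    ring_nf
  have hsq : ∀ {x : ℝ} (y : ℝ), 0 ≤ x → (x ^ y) ^ 2 = x ^ (2 * y) := by
    intro x y hx
    rw [← Real.rpow_natCast, ← Real.rpow_mul hx, mul_comm]
    norm_num
  have e2 : (constD α b ^ ((k : ℝ) / 2)) ^ 2 = constD α b ^ k := by
    rw [hsq _ hD.le, mul_div_cancel₀ _ (two_ne_zero), Real.rpow_natCast]
  have e3 : (constG α β b k ^ (1 / 2 : ℝ)) ^ 2 = constG α β b k := by
    rw [hsq _ hG.le]
    norm_num
  have e4 : ((3 / Real.log b) ^ (((k : ℝ) - 1) / 2)) ^ 2 *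
      (Real.log ((b : ℝ) ^ m) ^ (((k : ℝ) - 1) / 2)) ^ 2 = (3 * (m : ℝ)) ^ (k - 1) := by
    rw [Real.log_pow, hsq _ (by positivity), hsq _ (by positivity),
      mul_div_cancel₀ _ (two_ne_zero), ← Real.mul_rpow (by positivity) (by positivity),
      ← Real.rpow_natCast, Nat.cast_sub hk, Nat.cast_one]
    congr 1
    field_simp
  have e5 : (((b : ℝ) ^ (2 * constB α β))⁻¹) ^ (m - ⌈(t : ℝ) / β⌉₊) =
      (b : ℝ) ^ (-(2 * constB α β * ((m : ℝ) - (⌈(t : ℝ) / β⌉₊ : ℝ)))) := by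
    rw [← Real.rpow_neg hb0.le, ← Real.rpow_natCast, ← Real.rpow_mul hb0.le, Nat.cast_sub hc]
    ring_nf
  -- All powers of `b` are compared here; the exponents match because `A β + B = α`.
  have e6 : (b : ℝ) ^ (-(2 * (α : ℝ) * m)) *
      ((b : ℝ) ^ (constA α β * (t : ℝ) + constB α β * (⌈(t : ℝ) / (β : ℝ)⌉₊ : ℝ))) ^ 2 =
      (b : ℝ) ^ (-(2 * constA α β * ((β * m - t : ℕ) : ℝ))) *
        (b : ℝ) ^ (-(2 * constB α β * ((m : ℝ) - (⌈(t : ℝ) / β⌉₊ : ℝ)))) := by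
    rw [hsq _ hb0.le, ← Real.rpow_add hb0, ← Real.rpow_add hb0, Nat.cast_sub ht]
    congr 1
    push_cast
    linear_combination (-2 * (m : ℝ)) * -constA_mul_add_constB (α := α) hβ
  rw [mul_pow, constC, mul_pow, mul_pow, mul_pow, mul_pow, e1, e2, e3, e5, ← e4]
  linear_combination (constD α b ^ k * constG α β b k *
    (((3 / Real.log b) ^ (((k : ℝ) - 1) / 2)) ^ 2 *
      (Real.log ((b : ℝ) ^ m) ^ (((k : ℝ) - 1) / 2)) ^ 2)) * e6

end Constants

/-! ### The mean squared worst-case error -/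

section Main

variable {b s n m α β t : ℕ} [Fact b.Prime]

/-- The contribution of the projection to the coordinates in `u`. -/
noncomputable def meanSq (α : ℕ) (C : Fin s → Matrix (Fin n) (Fin m) (ZMod b))
    (u : Finset (Fin s)) : ℝ :=
  ((b : ℝ) ^ m)⁻¹ ^ 2 * ∑ h : Fin (b ^ m), ∑ h' : Fin (b ^ m), ∏ j ∈ u,
    ∫ x, kernelOne α (shiftOne b (digitalNet C h j) x) (shiftOne b (digitalNet C h' j) x)
      ∂unitMeasure

/-- The Walsh truncation is taken in each factor separately. Finite sums and products preserve the
limit, and the net sum of a truncation is a sum over the dual net. -/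
theorem tendsto_meanSq (α : ℕ) (C : Fin s → Matrix (Fin n) (Fin m) (ZMod b))
    (u : Finset (Fin s)) :
    Filter.Tendsto (fun R : ℕ => ∑ κ : u → Fin R → ZMod b with rowComb C κ = 0,
      ∏ j, walCoeff (fun x y => (kernelOne α x y : ℂ)) (extend (κ j))) Filter.atTop
      (nhds (meanSq α C u : ℂ)) := by
  have hb := (Fact.out : b.Prime).one_lt
  have h1 : ∀ h h' : Fin (b ^ m), ∀ j : Fin s, Filter.Tendsto (fun R : ℕ =>
      ∑ k : Fin R → ZMod b, walCoeff (fun x y => (kernelOne α x y : ℂ)) (extend k) *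
        ZMod.stdAddChar (∑ i, k i * ((∑ a, row (C j) i a * digitVec b m h a) -
          ∑ a, row (C j) i a * digitVec b m h' a))) Filter.atTop
      (nhds ((∫ x, kernelOne α (shiftOne b (digitalNet C h j) x)
        (shiftOne b (digitalNet C h' j) x) ∂unitMeasure : ℝ) : ℂ)) := fun h h' j =>
    tendsto_sum_walCoeff (K := kernelOne α) hb (continuous_kernelOne α)
      (z := fun i => ∑ a, row (C j) i a * digitVec b m h a)
      (z' := fun i => ∑ a, row (C j) i a * digitVec b m h' a)
      (measurable_shiftOne _) (measurable_shiftOne _) (shiftOne_mem _) (shiftOne_mem _)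
      (fun x hx i => digit_shiftOne C h j hx i) (fun x hx i => digit_shiftOne C h' j hx i)
  have h2 := (tendsto_finsetSum Finset.univ fun (h : Fin (b ^ m)) _ =>
    tendsto_finsetSum Finset.univ fun (h' : Fin (b ^ m)) _ =>
      tendsto_finsetProd u fun j _ => h1 h h' j).const_mul (((b : ℂ) ^ m)⁻¹ ^ 2)
  simp_rw [sum_sum_prod_eq] at h2
  convert h2 using 2
  rw [meanSq]
  push_cast
  rfl

/-- Decay of the product of the Walsh coefficients over the dual net. -/
theorem norm_prod_walCoeff_le (hα : 1 ≤ α) (hαβ : α ≤ β)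
    {C : Fin s → Matrix (Fin n) (Fin m) (ZMod b)} (hβ : 2 ≤ β) (hC : IsOrderDigitalNet β t C)
    {u : Finset (Fin s)} (hu : u.Nonempty) {R : ℕ} {κ : u → Fin R → ZMod b}
    (hκ : ∀ j, κ j ≠ 0) (hdual : rowComb C κ = 0) :
    ‖∏ j, walCoeff (fun x y => (kernelOne α x y : ℂ)) (extend (κ j))‖ ≤
      constD α b ^ u.card * (b : ℝ) ^ (-(2 * constA α β * ((β * m - t : ℕ) : ℝ))) *
        (((b : ℝ) ^ (2 * constB α β))⁻¹) ^ (∑ j, top (extend (κ j)).support) := by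
  have hb := (Fact.out : b.Prime).one_lt
  have hb1 : (1 : ℝ) < b := by exact_mod_cast hb
  have hb0 : (0 : ℝ) < b := by linarith
  have hκ0 : κ ≠ 0 := by
    obtain ⟨j, hj⟩ := hu
    exact fun h => hκ ⟨j, hj⟩ (congrFun h _)
  have h1 := lt_sum_mu_of_rowComb_eq_zero (by omega) hC hκ0 hdual
  rw [norm_prod]
  refine (Finset.prod_le_prod (fun j _ => norm_nonneg _) fun j _ =>
    norm_walCoeff_kernelOne_le hb hα (mt extend_eq_zero.1 (hκ j))).trans ?_
  rw [Finset.prod_mul_distrib, Finset.prod_const, Finset.card_univ, Fintype.card_coe,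
    Finset.prod_pow_eq_pow_sum, mul_assoc]
  refine mul_le_mul_of_nonneg_left ?_ (pow_nonneg (constD_pos hb hα).le _)
  rw [← Finset.mul_sum]
  set Mα := ∑ j, mu α (extend (κ j)).support with hMα
  set Mβ := ∑ j, mu β (extend (κ j)).support with hMβ
  set T := ∑ j, top (extend (κ j)).support with hT
  -- Interpolation in each coordinate; the part with `Mβ` is bounded by the dual net property and
  -- the part with `T` is kept for the code count.
  have h2 : (α - 1) * Mβ + (β - α) * T ≤ (β - 1) * Mα := by
    rw [hMα, hMβ, hT, Finset.mul_sum, Finset.mul_sum, Finset.mul_sum, ← Finset.sum_add_distrib]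
    refine Finset.sum_le_sum fun j _ => ?_
    have := mu_interpolation hα hαβ (extend (κ j)).support
    rwa [mu_one] at this
  have h3 : ((α : ℝ) - 1) * Mβ + ((β : ℝ) - α) * T ≤ ((β : ℝ) - 1) * Mα := by
    have h4 : (((α - 1) * Mβ + (β - α) * T : ℕ) : ℝ) ≤ (((β - 1) * Mα : ℕ) : ℝ) := by
      exact_mod_cast h2
    push_cast [Nat.cast_sub hα, Nat.cast_sub hαβ, Nat.cast_sub (show 1 ≤ β by omega)] at h4
    exact h4
  have hβ1 : 0 < (β : ℝ) - 1 := by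
    have : (2 : ℝ) ≤ β := by exact_mod_cast hβ
    linarith
  have h4 : constA α β * Mβ + constB α β * T ≤ Mα := by
    rw [constA, constB, div_mul_eq_mul_div, div_mul_eq_mul_div, ← add_div, div_le_iff₀ hβ1]
    linarith
  have h5 : constA α β * ((β * m - t : ℕ) : ℝ) ≤ constA α β * Mβ :=
    mul_le_mul_of_nonneg_left (by exact_mod_cast h1.le) (constA_nonneg hα (by omega))
  rw [← Real.rpow_neg hb0.le, ← Real.rpow_natCast ((b : ℝ) ^ _), ← Real.rpow_mul hb0.le,
    ← Real.rpow_add hb0, inv_pow, ← Real.rpow_natCast, ← Real.rpow_neg hb0.le]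
  refine Real.rpow_le_rpow_of_exponent_le hb1.le ?_
  push_cast
  linarith

/-- The truncated dual net is an additive code. `norm_prod_walCoeff_le` bounds each term,
`sum_code_le` bounds the sum uniformly in the truncation `R`, and the bound passes to the limit. -/
theorem meanSq_le (hα : 1 ≤ α) (hαβ : 2 * α ≤ β) (hm : 1 ≤ m) (ht : t ≤ β * m)
    {C : Fin s → Matrix (Fin n) (Fin m) (ZMod b)} (hC : IsOrderDigitalNet β t C)
    {u : Finset (Fin s)} (hu : u.Nonempty) :
    meanSq α C u ≤ (1 / ((b : ℝ) ^ m) ^ α * (constC α β b t u.card *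
      Real.log ((b : ℝ) ^ m) ^ (((u.card : ℝ) - 1) / 2))) ^ 2 := by
  have hb := (Fact.out : b.Prime).one_lt
  have hb1 : (1 : ℝ) < b := by exact_mod_cast hb
  have hb0 : (0 : ℝ) < b := by linarith
  have hβ : 2 ≤ β := by omega
  have hD := constD_pos hb hα
  have hG := constG_pos (α := α) hb hβ hαβ u.card
  rw [sq_constC_mul hb hα hβ hαβ hm ht hu.card_pos]
  refine (Real.le_norm_self _).trans ?_
  rw [← Complex.norm_real]
  refine le_of_tendsto (tendsto_meanSq α C u).norm (Filter.Eventually.of_forall fun R => ?_)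
  set M := m - ⌈(t : ℝ) / β⌉₊ with hM
  set D : Finset (u → Fin R → ZMod b) := Finset.univ.filter fun κ => rowComb C κ = 0 with hDdef
  have hnonempty : Nonempty u := hu.to_subtype
  have hsub : ∀ κ ∈ D, ∀ κ' ∈ D, κ - κ' ∈ D := by
    intro κ hκ κ' hκ'
    rw [hDdef, Finset.mem_filter] at hκ hκ' ⊢
    exact ⟨Finset.mem_univ _, by rw [rowComb_sub, hκ.2, hκ'.2, sub_zero]⟩
  -- At most `β` positions enter `mu β`, each at most the leading one; dividing the dual net bound
  -- by `β` rounds `t / β` up.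
  have hmin : ∀ κ ∈ D, κ ≠ 0 → M < ∑ j, top (extend (κ j)).support := by
    intro κ hκ hκ0
    have h1 := lt_sum_mu_of_rowComb_eq_zero (by omega) hC hκ0 (Finset.mem_filter.1 hκ).2
    have h2 : ∑ j, mu β (extend (κ j)).support ≤ β * ∑ j, top (extend (κ j)).support := by
      rw [Finset.mul_sum]
      exact Finset.sum_le_sum fun j _ => mu_le_mul_top _ _
    have h3 : t ≤ β * ⌈(t : ℝ) / β⌉₊ := by
      have h4 := Nat.le_ceil ((t : ℝ) / β)
      rw [div_le_iff₀ (by exact_mod_cast (by omega : 0 < β)), mul_comm] at h4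
      exact_mod_cast h4
    by_contra! hle
    have h5 := Nat.mul_le_mul_left β hle
    rw [hM, Nat.mul_sub] at h5
    omega
  have hzero : ∀ κ ∈ D, ∏ j, walCoeff (fun x y => (kernelOne α x y : ℂ)) (extend (κ j)) ≠ 0 →
      ∀ j, κ j ≠ 0 := by
    intro κ _ hne j hj
    refine hne (Finset.prod_eq_zero (Finset.mem_univ j) ?_)
    rw [extend_eq_zero.2 hj, walCoeff_kernelOne_zero (by omega)]
  rw [← Finset.sum_filter_of_ne hzero]
  refine (norm_sum_le _ _).trans ?_
  have hstep : ∀ κ ∈ D.filter (fun κ => ∀ j, κ j ≠ 0),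
      ‖∏ j, walCoeff (fun x y => (kernelOne α x y : ℂ)) (extend (κ j))‖ ≤
      constD α b ^ u.card * (b : ℝ) ^ (-(2 * constA α β * ((β * m - t : ℕ) : ℝ))) *
        (((b : ℝ) ^ (2 * constB α β))⁻¹) ^ (∑ j, top (extend (κ j)).support) := by
    intro κ hκ
    obtain ⟨h1, h2⟩ := Finset.mem_filter.1 hκ
    exact norm_prod_walCoeff_le hα (by omega) hβ hC hu h2 (Finset.mem_filter.1 h1).2
  refine (Finset.sum_le_sum hstep).trans ?_
  rw [← Finset.mul_sum]
  refine mul_le_mul_of_nonneg_left ?_ (by positivity)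
  refine (sum_code_le hb.le hsub hmin (lt_rpow_constB hb hβ hαβ)).trans ?_
  rw [Fintype.card_coe]
  change ((M : ℝ) + 2) ^ (u.card - 1) * _ * constG α β b u.card ≤ _
  -- Since `M ≤ m` and `m ≥ 1`; this is the origin of the `3` in `constC`.
  have hM2 : (M : ℝ) + 2 ≤ 3 * m := by
    have : M + 2 ≤ 3 * m := by omega
    exact_mod_cast this
  gcongr

theorem sum_sobolevKernel_sub (γ : Finset (Fin s) → ℝ≥0)
    (C : Fin s → Matrix (Fin n) (Fin m) (ZMod b)) (σ : UnitCube s) (h h' : Fin (b ^ m)) :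
    sobolevKernel α γ (digitShift b (digitalNet C h) σ) (digitShift b (digitalNet C h') σ) - γ ∅ =
      ∑ u : Finset (Fin s) with u.Nonempty, (γ u : ℝ) * ∏ j ∈ u,
        kernelOne α (shiftOne b (digitalNet C h j) (σ j))
          (shiftOne b (digitalNet C h' j) (σ j)) := by
  rw [sobolevKernel, sub_eq_iff_eq_add]
  have hfilter : (Finset.univ.filter fun u : Finset (Fin s) => u.Nonempty) =
      Finset.univ.erase ∅ := by
    ext u
    simp [Finset.nonempty_iff_ne_empty]
  rw [hfilter, ← Finset.sum_erase_add _ _ (Finset.mem_univ (∅ : Finset (Fin s))),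
    Finset.prod_empty, mul_one]
  rfl

theorem measurable_kernelOne_shiftOne (α : ℕ) (y y' : ℝ) :
    Measurable fun x => kernelOne α (shiftOne b y x) (shiftOne b y' x) :=
  Measurable.comp (g := fun z : ℝ × ℝ => kernelOne α z.1 z.2)
    (f := fun x => (shiftOne b y x, shiftOne b y' x)) (continuous_kernelOne α).measurable
    ((measurable_shiftOne y).prodMk (measurable_shiftOne y'))

theorem measurable_prod_kernelOne_shiftOne (α : ℕ) (u : Finset (Fin s)) (y y' : Fin s → ℝ) :
    Measurable fun σ : UnitCube s => ∏ j ∈ u,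
      kernelOne α (shiftOne b (y j) (σ j)) (shiftOne b (y' j) (σ j)) := by
  refine Finset.measurable_fun_prod u fun j _ => ?_
  exact (measurable_kernelOne_shiftOne α (y j) (y' j)).comp
    (measurable_subtype_coe.comp (measurable_pi_apply j))

theorem integrable_prod_kernelOne_shiftOne (α : ℕ) (u : Finset (Fin s)) (y y' : Fin s → ℝ) :
    Integrable fun σ : UnitCube s => ∏ j ∈ u,
      kernelOne α (shiftOne b (y j) (σ j)) (shiftOne b (y' j) (σ j)) := by
  obtain ⟨B, hB⟩ := exists_bound_of_continuous (continuous_kernelOne α)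
  refine Integrable.of_bound (C := ∏ _j ∈ u, B)
    (measurable_prod_kernelOne_shiftOne α u y y').aestronglyMeasurable
    (Filter.Eventually.of_forall fun σ => ?_)
  rw [norm_prod]
  exact Finset.prod_le_prod (fun j _ => norm_nonneg _) fun j _ =>
    hB _ (Set.Ico_subset_Icc_self (shiftOne_mem _ _)) _ (Set.Ico_subset_Icc_self (shiftOne_mem _ _))

theorem integral_prod_kernelOne_shiftOne (α : ℕ) (u : Finset (Fin s)) (y y' : Fin s → ℝ) :
    ∫ σ : UnitCube s, ∏ j ∈ u, kernelOne α (shiftOne b (y j) (σ j)) (shiftOne b (y' j) (σ j)) =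
      ∏ j ∈ u, ∫ x, kernelOne α (shiftOne b (y j) x) (shiftOne b (y' j) x) ∂unitMeasure := by
  refine (integral_prod_unitCube u fun j x =>
    kernelOne α (shiftOne b (y j) x) (shiftOne b (y' j) x)).trans ?_
  refine Finset.prod_congr rfl fun j _ => ?_
  rw [integral_unitMeasure]
  exact integral_unitInterval fun x => kernelOne α (shiftOne b (y j) x) (shiftOne b (y' j) x)

/-- The squared worst-case error of the shifted net. -/
noncomputable def shiftSq (α : ℕ) (γ : Finset (Fin s) → ℝ≥0)
    (C : Fin s → Matrix (Fin n) (Fin m) (ZMod b)) (σ : UnitCube s) : ℝ :=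
  ((b : ℝ) ^ m)⁻¹ ^ 2 * ∑ h : Fin (b ^ m), ∑ h' : Fin (b ^ m),
    ∑ u : Finset (Fin s) with u.Nonempty, (γ u : ℝ) * ∏ j ∈ u,
      kernelOne α (shiftOne b (digitalNet C h j) (σ j)) (shiftOne b (digitalNet C h' j) (σ j))

theorem worstCaseError_digitShift_sq [NeZero α] (γ : Finset (Fin s) → ℝ≥0)
    (C : Fin s → Matrix (Fin n) (Fin m) (ZMod b)) (σ : UnitCube s) :
    0 ≤ shiftSq α γ C σ ∧
      worstCaseError (WeightedSobolevSpace α γ) (fun h => digitShift b (digitalNet C h) σ) ^ 2 =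
        ENNReal.ofReal (shiftSq α γ C σ) := by
  have hne : Nonempty (Fin (b ^ m)) :=
    ⟨⟨0, pow_pos (Fact.out : b.Prime).pos m⟩⟩
  have h := worstCaseError_sq (α := α) γ fun h => digitShift b (digitalNet C h) σ
  simp_rw [sum_sobolevKernel_sub, Fintype.card_fin, Nat.cast_pow] at h
  exact h

theorem measurable_shiftSq (α : ℕ) (γ : Finset (Fin s) → ℝ≥0)
    (C : Fin s → Matrix (Fin n) (Fin m) (ZMod b)) : Measurable (shiftSq α γ C) := by
  refine Measurable.const_mul ?_ _
  refine Finset.measurable_fun_sum _ fun h _ => Finset.measurable_fun_sum _ fun h' _ =>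
    Finset.measurable_fun_sum _ fun u _ => Measurable.const_mul ?_ _
  exact measurable_prod_kernelOne_shiftOne α u (fun j => digitalNet C h j)
    fun j => digitalNet C h' j

/-- The coordinates of the shift are independent, so the mean of each product of kernels factors
into one-dimensional means. -/
theorem integrable_integral_shiftSq (α : ℕ) (γ : Finset (Fin s) → ℝ≥0)
    (C : Fin s → Matrix (Fin n) (Fin m) (ZMod b)) :
    Integrable (shiftSq α γ C) ∧
      ∫ σ, shiftSq α γ C σ = ∑ u : Finset (Fin s) with u.Nonempty, (γ u : ℝ) * meanSq α C u := by
  have hi : ∀ (h h' : Fin (b ^ m)) (u : Finset (Fin s)), Integrable fun σ : UnitCube s =>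
      (γ u : ℝ) * ∏ j ∈ u, kernelOne α (shiftOne b (digitalNet C h j) (σ j))
        (shiftOne b (digitalNet C h' j) (σ j)) := fun h h' u =>
    (integrable_prod_kernelOne_shiftOne α u (fun j => digitalNet C h j)
      fun j => digitalNet C h' j).const_mul _
  refine ⟨(integrable_finsetSum _ fun h _ => integrable_finsetSum _ fun h' _ =>
    integrable_finsetSum _ fun u _ => hi h h' u).const_mul _, ?_⟩
  simp only [shiftSq]
  rw [integral_const_mul, integral_finsetSum _ fun h _ => integrable_finsetSum _ fun h' _ =>
    integrable_finsetSum _ fun u _ => hi h h' u]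
  simp_rw [integral_finsetSum _ fun h' _ => integrable_finsetSum _ fun u _ => hi _ h' u,
    integral_finsetSum _ fun u _ => hi _ _ u, integral_const_mul]
  simp_rw [integral_prod_kernelOne_shiftOne α _ (fun j => (digitalNet C _ j : ℝ))
    fun j => (digitalNet C _ j : ℝ)]
  simp_rw [meanSq, Finset.mul_sum]
  rw [Finset.sum_comm]
  refine (Finset.sum_congr rfl fun h _ => Finset.sum_comm).trans ?_
  rw [Finset.sum_comm]
  refine Finset.sum_congr rfl fun u _ => ?_
  rw [Finset.sum_comm]
  exact Finset.sum_congr rfl fun h _ => Finset.sum_congr rfl fun h' _ => by ring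

theorem measurable_worstCaseError_digitShift [NeZero α] (γ : Finset (Fin s) → ℝ≥0)
    (C : Fin s → Matrix (Fin n) (Fin m) (ZMod b)) :
    Measurable fun σ : UnitCube s => worstCaseError (WeightedSobolevSpace α γ)
      fun h => digitShift b (digitalNet C h) σ := by
  have h1 : ∀ σ : UnitCube s, worstCaseError (WeightedSobolevSpace α γ)
      (fun h => digitShift b (digitalNet C h) σ) =
        ENNReal.ofReal (shiftSq α γ C σ) ^ (1 / 2 : ℝ) := by
    intro σ
    rw [← (worstCaseError_digitShift_sq γ C σ).2, ← ENNReal.rpow_natCast, ← ENNReal.rpow_mul]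
    norm_num
  simp_rw [h1]
  exact (measurable_shiftSq α γ C).ennreal_ofReal.pow_const _

theorem rmsWorstCaseError_le [NeZero α] (hα : 1 ≤ α) (hαβ : 2 * α ≤ β) (hm : 1 ≤ m)
    (ht : t ≤ β * m) {C : Fin s → Matrix (Fin n) (Fin m) (ZMod b)}
    (hC : IsOrderDigitalNet β t C) (γ : Finset (Fin s) → ℝ≥0) :
    rmsWorstCaseError b (WeightedSobolevSpace α γ) (digitalNet C) ≤
      ENNReal.ofReal (1 / ((b : ℝ) ^ m) ^ α *
        ∑ u : Finset (Fin s) with u.Nonempty, (γ u : ℝ) ^ (1 / 2 : ℝ) *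
          constC α β b t u.card * Real.log ((b : ℝ) ^ m) ^ (((u.card : ℝ) - 1) / 2)) := by
  have hb := (Fact.out : b.Prime).one_lt
  have hb1 : (1 : ℝ) < b := by exact_mod_cast hb
  have hlog : 0 ≤ Real.log ((b : ℝ) ^ m) := Real.log_nonneg (one_le_pow₀ hb1.le)
  set V : Finset (Fin s) → ℝ := fun u => 1 / ((b : ℝ) ^ m) ^ α * (constC α β b t u.card *
      Real.log ((b : ℝ) ^ m) ^ (((u.card : ℝ) - 1) / 2)) with hV
  have hV0 : ∀ u, 0 ≤ V u := fun u => by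
    have := constC_pos hb hα (by omega) hαβ t u.card
    rw [hV]
    positivity
  have hrhs : 1 / ((b : ℝ) ^ m) ^ α *
        ∑ u : Finset (Fin s) with u.Nonempty, (γ u : ℝ) ^ (1 / 2 : ℝ) *
          constC α β b t u.card * Real.log ((b : ℝ) ^ m) ^ (((u.card : ℝ) - 1) / 2) =
      ∑ u : Finset (Fin s) with u.Nonempty, (γ u : ℝ) ^ (1 / 2 : ℝ) * V u := by
    rw [Finset.mul_sum]
    exact Finset.sum_congr rfl fun u _ => by rw [hV]; ring
  rw [hrhs]
  set W := ∑ u : Finset (Fin s) with u.Nonempty, (γ u : ℝ) ^ (1 / 2 : ℝ) * V u with hW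
  have hterm0 : ∀ u : Finset (Fin s), 0 ≤ (γ u : ℝ) ^ (1 / 2 : ℝ) * V u := fun u =>
    mul_nonneg (Real.rpow_nonneg (γ u).coe_nonneg _) (hV0 u)
  have hW0 : 0 ≤ W := Finset.sum_nonneg fun u _ => hterm0 u
  obtain ⟨hinteg, heq⟩ := integrable_integral_shiftSq α γ C
  -- The mean square is a sum of squares over `u`; it is at most the square of the sum because all
  -- terms are nonnegative.
  have hle : ∫ σ, shiftSq α γ C σ ≤ W ^ 2 := by
    rw [heq]
    refine (Finset.sum_le_sum fun u hu => ?_).trans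
      (Finset.sum_sq_le_sq_sum_of_nonneg fun u _ => hterm0 u)
    rw [mul_pow, ← Real.sqrt_eq_rpow, Real.sq_sqrt (γ u).coe_nonneg]
    exact mul_le_mul_of_nonneg_left (meanSq_le hα hαβ hm ht hC (Finset.mem_filter.1 hu).2)
      (γ u).coe_nonneg
  rw [rmsWorstCaseError]
  simp_rw [fun σ => (worstCaseError_digitShift_sq (α := α) γ C σ).2]
  rw [← ofReal_integral_eq_lintegral_ofReal hinteg
    (Filter.Eventually.of_forall fun σ => (worstCaseError_digitShift_sq γ C σ).1)]
  refine (ENNReal.rpow_le_rpow (ENNReal.ofReal_le_ofReal hle) (by norm_num)).trans_eq ?_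
  rw [ENNReal.ofReal_pow hW0, ← ENNReal.rpow_natCast, ← ENNReal.rpow_mul]
  norm_num

end Main

end HigherOrderNet

theorem theorem1 (b s n m α β t : ℕ) [Fact b.Prime] [NeZero α]
    (hs : 1 ≤ s) (hm : 1 ≤ m) (hα : 2 ≤ α) (hβ : 2 * α ≤ β) (ht : t ≤ β * m)
    (C : Fin s → Matrix (Fin n) (Fin m) (ZMod b))
    (hC : HigherOrderNet.IsOrderDigitalNet β t C)
    (γ : Finset (Fin s) → ℝ≥0) :
    (∀ f : HigherOrderNet.WeightedSobolevSpace α γ,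
      Integrable (fun x : HigherOrderNet.UnitCube s => f x)) ∧
    Measurable (fun σ : HigherOrderNet.UnitCube s =>
      HigherOrderNet.worstCaseError (HigherOrderNet.WeightedSobolevSpace α γ)
        fun h => HigherOrderNet.digitShift b (HigherOrderNet.digitalNet C h) σ) ∧
    (∀ u : Finset (Fin s), u.Nonempty → 0 < HigherOrderNet.constC α β b t u.card) ∧
    HigherOrderNet.rmsWorstCaseError b (HigherOrderNet.WeightedSobolevSpace α γ)
        (HigherOrderNet.digitalNet C) ≤
      ENNReal.ofReal (1 / ((b : ℝ) ^ m) ^ α *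
        ∑ u : Finset (Fin s) with u.Nonempty, (γ u : ℝ) ^ (1 / 2 : ℝ) *
          HigherOrderNet.constC α β b t u.card *
          Real.log ((b : ℝ) ^ m) ^ (((u.card : ℝ) - 1) / 2)) := by
  have hb := (Fact.out : b.Prime).one_lt
  exact ⟨HigherOrderNet.integrable_coe γ, HigherOrderNet.measurable_worstCaseError_digitShift γ C,
    fun u _ => HigherOrderNet.constC_pos hb (by omega) (by omega) hβ t u.card,
    HigherOrderNet.rmsWorstCaseError_le (by omega) hβ hm ht hC γ⟩
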